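/- Let $p$ be an odd prime, $q=p^s$, and let $\phi,\psi\in\mathbb F_q$. Let $$P=x_1^8x_6^4+x_2^8x_6^4+x_3^4+x_4^4+x_5^4-8\psi x_1x_2x_3x_4x_5x_6-2\phi x_1^4x_2^4x_6^4 ,$$ and let $X$ be the hypersurface $P=0$ in the toric variety $(\mathbb A^6\setminus Z)/\mathbb G_m^2$, where $Z=\{x_1=x_2=0\}\cup\{x_3=x_4=x_5=x_6=0\}$ and $(a,b)\in\mathbb G_m^2$ acts by $(x_1,\dots,x_6)\mapsto(ax_1,ax_2,bx_3,bx_4,bx_5,ba^{-2}x_6)$. Let $N$ be the number of its $\mathbb F_q$-points, i.e. of the $(\mathbb F_q^*)^2$-orbits of solutions of $P=0$ in $\mathbb F_q^6\setminus Z$. **Gauss sums.** Let $\pi\in\mathbb C_p$ with $\pi^{p-1}=-p$. Let $\mathrm{Teich}:\mathbb F_q\to\mathbb C_p$ be the Teichmüller character, defined through the Witt vectors $W(\mathbb F_q)$ and a ring homomorphism $W(\mathbb F_q)\to\mathcal O_{\mathbb C_p}$. Let $\Theta_s(x)=F(\pi\,\mathrm{Teich}(\mathrm{tr}\,x))$,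 where $F(X)=\exp(X+X^p/p)=\sum c_nX^n$ and $\mathrm{tr}\,x=\sum_{j<s}x^{p^j}$, be Dwork's additive character, and for $n\in\mathbb Z$ let $G_n=\sum_{x\in\mathbb F_q^*}\Theta_s(x)\mathrm{Teich}^n(x)$. Put $$N_{\rm mon}=\frac1{q(q-1)^2}\sum_{y\ne0,\,x_6\neq0}\ \sum_{x_1,\dots,x_5\in\mathbb F_q}\Theta_s(yP),$$ $$N_{\rm exceptional}=\frac1{q(q-1)^2}\Big(\sum_{\substack{y\ne0,\;x_6=0\\(x_1,x_2)\ne(0,0)}}-\sum_{\substack{y\ne0,\;x_6\ne0\\x_1=x_2=0}}\Big)\sum_{x_3,x_4,x_5\in\mathbb F_q}\Theta_s\big(y(x_3^4+x_4^4+x_5^4)\big).$$ **Monomials.** Consider vectors $v=(v_1,\dots,v_5)$, $v_1,v_2$ modulo $8$ and $v_3,v_4,v_5$ modulo $4$, with $8\mid v_1+v_2+2(v_3+v_4+v_5)$. Call two of them equivalent if they agree up to adding a multiple of $(1,1,1,1,1)$ and permuting $v_1,v_2$ and $v_3,v_4,v_5$. There are 15 classes, with the following representatives and weights $\lambda_v$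 ($\lambda_v$ is the number of distinct permutations of $v$ times the least $n\ge1$ for which $v+n(1,1,1,1,1)$ is a permutation of $v$, divided by 8): $(0,0,0,0,0):1$; $(0,2,1,1,1):2$; $(0,4,2,2,2):1$; $(0,0,0,2,2):3$; $(2,0,1,3,3):6$; $(4,0,2,0,0):3$; $(0,0,2,1,1):3$; $(6,0,1,0,0):6$; $(0,4,0,3,3):3$; $(4,0,1,1,0):3$; $(2,0,3,0,0):6$; $(2,2,1,1,0):3$; $(0,0,3,1,0):6$; $(2,0,2,1,0):12$; $(4,0,2,3,1):6$. Below $\sum_v$ runs over these 15 representatives if $4\mid q-1$, and over the four representatives $(0,0,0,0,0),(0,4,2,2,2),(0,0,0,2,2),(4,0,2,0,0)$, with the same weights, if $4\nmid q-1$. Put $k=\frac{q-1}8$, $l=\frac{q-1}4$, $m=\frac{q-1}2$ and, where the denominators do not vanish, $\mu=\frac1{(2\phi)^2}$ and $\Psi=\frac{-2\phi}{(8\psi)^4}$. For integers $c,d$ (shifts) and a representative $v$, write $Z_5(c)$ for the condition that at least one of $v_3+c,v_4+c,v_5+c$ is divisible by $4$, and $Z_2(d)$ for the condition that at least one of $v_1+d,v_2+d$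 is divisible by $8$. A condition under a summation sign restricts $v$. **Theorem.** $$N=1+2q+2q^2+q^3+N_{\rm exceptional}+N_{\rm mon}.$$ *Exceptional part.* $N_{\rm exceptional}=q\,(\#C(\mathbb F_q)-(q+1))$, where $C$ is the plane quartic $x_3^4+x_4^4+x_5^4=0$ (of genus 3), over which the exceptional divisor is ruled. If $4\mid q-1$, then $N_{\rm exceptional}=\sum\prod_{i=3,4,5}G_{-v_il}$ over the six permutations $(v_3,v_4,v_5)$ of $(2,1,1)$ and $(3,3,2)$. If $4\nmid q-1$, then $N_{\rm exceptional}=0$. *Monomial part.* Define $C_0(\text{cond})$ as - $\frac1q\sum_{b=0}^1\sum_{a=0}^3\sum_{v:\,\text{cond}}\lambda_v\prod_{i=1,2}G_{-(v_i+a+4b)k}\prod_{i=3,4,5}G_{-2(v_i+a)k}$ if $8\mid q-1$, with $c=a$, $d=a+4b$; - $\frac1q\sum_{a=0}^3\sum_{v:\,\text{cond}}\lambda_v\prod_{i=1,2}G_{-\frac{v_i+2a}2l}\prod_{i=3,4,5}G_{-(v_i+2a)l}$ if $4\mid q-1$, $8\nmid q-1$, with $c=d=2a$; equivalently $\frac1q\sum_{b=0}^1\sum_{a=0}^1\sum_{v:\,\text{cond}}\lambda_v\prod_{i=1,2}G_{-\frac{v_i+2a+4b}2l}\prod_{i=3,4,5}G_{-(v_i+2a)l}$,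 with $c=2a$, $d=2a+4b$; - $\frac1q\sum_{b=0}^1\sum_{v:\,\text{cond}}\lambda_v\prod_{i=1,2}G_{-\frac{v_i+4b}4m}\prod_{i=3,4,5}G_{-\frac{v_i}2m}$ if $4\nmid q-1$, with $c=0$, $d=4b$. Define, for $\phi\neq0$, $C_1(\text{cond})$ as - $\frac1{q(q-1)}\sum_{u=0}^{q-2}\sum_{a=0}^3\sum_{v:\,\text{cond}}\lambda_v\prod_{i=1,2}G_{-((v_i+a)k+u)}\prod_{i=3,4,5}G_{-2(v_i+a)k}\,G_{2u}\mathrm{Teich}^u(\mu)$ if $8\mid q-1$, with $c=a$; - if $4\mid q-1$, $8\nmid q-1$, the sum of $\frac1{q(q-1)}\sum_{u=0}^{q-2}\sum_{a=0}^1\sum_{v:\,\text{cond}}\lambda_v\prod_{i=1,2}G_{-(\frac{v_i+2a}2l+u)}\prod_{i=3,4,5}G_{-(v_i+2a)l}\,G_{2u}\mathrm{Teich}^u(\mu)$, with $c=2a$, and $\frac1{q(q-1)}\sum_{u=0}^{q-2}\sum_{a=0}^1\sum_{v:\,\text{cond}}\lambda_v\prod_{i=1,2}G_{-(\frac{v_i+2a+1}2l+u+\frac12)}\prod_{i=3,4,5}G_{-(v_i+2a+1)l}\,G_{2u+1}\mathrm{Teich}^u(\mu)\mathrm{Teich}^{-1}(-2\phi)$,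 with $c=2a+1$; - if $4\nmid q-1$, the sum of $\frac1{q(q-1)}\sum_{u=0}^{q-2}\sum_{v:\,\text{cond}}\lambda_v\prod_{i=1,2}G_{-(\frac{v_i}4m+u)}\prod_{i=3,4,5}G_{-\frac{v_i}2m}\,G_{2u}\mathrm{Teich}^u(\mu)$, with $c=0$, and $\frac1{q(q-1)}\sum_{u=0}^{q-2}\sum_{v:\,\text{cond}}\lambda_v\prod_{i=1,2}G_{-(\frac{v_i+2}4m+u+\frac12)}\prod_{i=3,4,5}G_{-\frac{v_i+2}2m}\,G_{2u+1}\mathrm{Teich}^u(\mu)\mathrm{Teich}^{-1}(-2\phi)$, with $c=2$. Write $(e_i(v))=\big(v_1k,v_2k,2v_3k,2v_4k,2v_5k\big)$ if $8\mid q-1$, $\big(\frac{v_1}2l,\frac{v_2}2l,v_3l,v_4l,v_5l\big)$ if $4\mid q-1$, $8\nmid q-1$, and $\big(\frac{v_1}4m,\frac{v_2}4m,\frac{v_3}2m,\frac{v_4}2m,\frac{v_5}2m\big)$ if $4\nmid q-1$. All indices of Gauss sums are integers. Then in each of the three cases for $q$: 1. If $\phi=\psi=0$: $N_{\rm mon}=C_0(\text{neither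 }Z_2(d)\text{ nor }Z_5(c))$. 2. If $\phi=0$, $\psi\ne0$: $$N_{\rm mon}=\frac1{q(q-1)}\sum_{w=0}^{q-2}\sum_v\lambda_v\prod_{i=1,2}G_{-(e_i(v)+w)}\prod_{i=3,4,5}G_{-(e_i(v)+2w)}\,G_{8w}\,\mathrm{Teich}^w\Big(\frac1{(8\psi)^8}\Big)-C_0\big(Z_2(d)\text{ or }Z_5(c)\big).$$ 3. If $\psi=0$, $\phi\ne0$: $N_{\rm mon}=C_1(\text{not }Z_5(c))-C_0\big(Z_2(d)\text{ and not }Z_5(c)\big)$. 4. If $\phi\psi\ne0$: $$N_{\rm mon}=\frac1{q(q-1)^2}\sum_{t=0}^{q-2}\ \sum_{u=\lceil t/2\rceil}^{\lfloor(2q-3+t)/2\rfloor}\sum_v\lambda_v\prod_{i=1,2}G_{-(e_i(v)+u)}\prod_{i=3,4,5}G_{-(e_i(v)+t)}\,G_{2u-t}G_{4t}\,\mathrm{Teich}^u(\mu)\mathrm{Teich}^t(\Psi)-C_1\big(Z_5(c)\big)-C_0\big(Z_2(d)\text{ and not }Z_5(c)\big).$$ -/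

import Mathlib

/-! ### The octic family and its rational points -/

section Octic

variable {F : Type*} [Field F]

/-- The defining polynomial
`x₁⁸x₆⁴ + x₂⁸x₆⁴ + x₃⁴ + x₄⁴ + x₅⁴ - 8ψ x₁x₂x₃x₄x₅x₆ - 2φ x₁⁴x₂⁴x₆⁴`
in the Cox variables `x₁, …, x₆` (which are `x 0, …, x 5`). -/
def octicPoly (φ ψ : F) (x : Fin 6 → F) : F :=
  x 0 ^ 8 * x 5 ^ 4 + x 1 ^ 8 * x 5 ^ 4 + x 2 ^ 4 + x 3 ^ 4 + x 4 ^ 4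
    - 8 * ψ * x 0 * x 1 * x 2 * x 3 * x 4 * x 5
    - 2 * φ * x 0 ^ 4 * x 1 ^ 4 * x 5 ^ 4

/-- Homogeneous coordinates of a point of the hypersurface `octicPoly φ ψ = 0`. The sets of Cox
variables that must not vanish simultaneously are `{x₁, x₂}` and `{x₃, x₄, x₅, x₆}` (the fan is
that of the weighted projective space `P(1,1,2,2,2)`, subdivided at the ray of `x₆`, which is the
midpoint of the rays of `x₁` and `x₂`). -/
def OcticCoords (φ ψ : F) : Type _ :=
  {x : Fin 6 → F // ¬ (x 0 = 0 ∧ x 1 = 0) ∧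
    ¬ (x 2 = 0 ∧ x 3 = 0 ∧ x 4 = 0 ∧ x 5 = 0) ∧ octicPoly φ ψ x = 0}

/-- The action of the two-dimensional torus `(a, b)` on the Cox variables: `x₁, x₂` have weight
`(1,0)`, `x₃, x₄, x₅` have weight `(0,1)`, and `x₆` has weight `(-2,1)`. -/
def octicScale (a b : Fˣ) (x : Fin 6 → F) : Fin 6 → F :=
  ![(a : F) * x 0, (a : F) * x 1, (b : F) * x 2, (b : F) * x 3, (b : F) * x 4,
    (b : F) * ((a : F)⁻¹) ^ 2 * x 5]

/-- Two coordinate vectors are equivalent when they lie in one orbit of the torus. -/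
def octicSetoid (φ ψ : F) : Setoid (OcticCoords φ ψ) where
  r x y := ∃ a b : Fˣ, y.1 = octicScale a b x.1
  iseqv :=
    { refl := fun x => ⟨1, 1, by
        funext i
        fin_cases i <;> simp [octicScale]⟩
      symm := by
        rintro x y ⟨a, b, h⟩
        refine ⟨a⁻¹, b⁻¹, ?_⟩
        rw [h]
        funext i
        fin_cases i <;> simp [octicScale]
        field_simp
      trans := by
        rintro x y z ⟨a, b, h⟩ ⟨c, d, h'⟩
        refine ⟨c * a, d * b, ?_⟩
        rw [h', h]
        funext i
        fin_cases i <;> simp [octicScale] <;> ring }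

/-- The number `N(φ, ψ)` of `F`-rational points of the octic threefold with parameters `φ, ψ`. -/
noncomputable def octicCount (φ ψ : F) : ℕ := Nat.card (Quotient (octicSetoid φ ψ))

variable (F) in
/-- The number of `F`-rational points of the plane quartic `x₃⁴ + x₄⁴ + x₅⁴ = 0` (the curve of
genus 3 over which the exceptional divisor is ruled). -/
noncomputable def quarticCount : ℕ :=
  Nat.card {P : Projectivization F (Fin 3 → F) // P.rep 0 ^ 4 + P.rep 1 ^ 4 + P.rep 2 ^ 4 = 0}

end Octic

/-! ### Dwork's character, the Teichmüller character and Gauss sums -/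

section Dwork

/-- The power series `F(X) = exp (X + X ^ p / p)`. -/
noncomputable def dworkSeries (p : ℕ) : PowerSeries ℚ :=
  (PowerSeries.exp ℚ).subst
    (PowerSeries.X + PowerSeries.C ((p : ℚ)⁻¹) * PowerSeries.X ^ p : PowerSeries ℚ)

variable {p : ℕ} [Fact p.Prime]

/-- The value `F(z) = ∑ cₙ zⁿ` of the series `exp (X + X ^ p / p)` at a point of `ℂ_p`. -/
noncomputable def dworkEval (z : ℂ_[p]) : ℂ_[p] :=
  ∑' n : ℕ, ((PowerSeries.coeff n (dworkSeries p) : ℚ) : ℂ_[p]) * z ^ n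

variable {F : Type*} [Field F]

/-- The Teichmüller character `F → ℂ_p`. The homomorphism `ι` embeds the ring of integers `W(F)` of
the unramified extension of `ℚ_p` with residue field `F` into the ring of integers of `ℂ_p`. -/
noncomputable def teichChar (ι : WittVector p F →+* 𝓞_ℂ_[p]) (x : F) : ℂ_[p] :=
  ((ι (WittVector.teichmuller p x) : 𝓞_ℂ_[p]) : ℂ_[p])

/-- Dwork's additive character `Θ_s(x) = F(π Teich(tr x))` of the field `F` with `p ^ s` elements,
where `tr x = x + x ^ p + ⋯ + x ^ (p ^ (s - 1))` and `π ^ (p - 1) = -p`. -/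
noncomputable def dworkChar (s : ℕ) (π : ℂ_[p]) (ι : WittVector p F →+* 𝓞_ℂ_[p]) (x : F) : ℂ_[p] :=
  dworkEval (π * teichChar ι (∑ j ∈ Finset.range s, x ^ p ^ j))

variable [Fintype F] [DecidableEq F]

/-- The Gauss sum `G_n = ∑_{x ≠ 0} Θ_s(x) Teich(x) ^ n`, for an integer `n`. -/
noncomputable def dworkGauss (s : ℕ) (π : ℂ_[p]) (ι : WittVector p F →+* 𝓞_ℂ_[p]) (n : ℤ) : ℂ_[p] :=
  ∑ x : Fˣ, dworkChar s π ι (x : F) * teichChar ι (x : F) ^ n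

/-- `N_mon = (1 / (q (q - 1)²)) ∑_{y ≠ 0} ∑_{x₆ ≠ 0} ∑_{x₁, …, x₅} Θ_s(y P(x₁, …, x₆))`. -/
noncomputable def octicMon (s : ℕ) (π : ℂ_[p]) (ι : WittVector p F →+* 𝓞_ℂ_[p]) (φ ψ : F) :
    ℂ_[p] :=
  1 / ((Fintype.card F : ℂ_[p]) * ((Fintype.card F : ℂ_[p]) - 1) ^ 2) *
    ∑ y : Fˣ, ∑ x₆ : Fˣ, ∑ x : Fin 5 → F,
      dworkChar s π ι ((y : F) * octicPoly φ ψ ![x 0, x 1, x 2, x 3, x 4, (x₆ : F)])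

/-- `N_exceptional`: the factor `1 / (q (q - 1)²)` times
`∑ Θ_s(y (x₃⁴ + x₄⁴ + x₅⁴))` over `y ≠ 0`, `x₆ = 0`, `(x₁, x₂) ≠ (0, 0)` and all `x₃, x₄, x₅`,
minus the same sum over `y ≠ 0`, `x₆ ≠ 0`, `x₁ = x₂ = 0` and all `x₃, x₄, x₅`. -/
noncomputable def octicExc (s : ℕ) (π : ℂ_[p]) (ι : WittVector p F →+* 𝓞_ℂ_[p]) : ℂ_[p] :=
  1 / ((Fintype.card F : ℂ_[p]) * ((Fintype.card F : ℂ_[p]) - 1) ^ 2) *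
    ((∑ y : Fˣ, ∑ w : F × F with w ≠ (0, 0), ∑ x : Fin 3 → F,
        dworkChar s π ι ((y : F) * (x 0 ^ 4 + x 1 ^ 4 + x 2 ^ 4)))
      - ∑ y : Fˣ, ∑ _x₆ : Fˣ, ∑ x : Fin 3 → F,
        dworkChar s π ι ((y : F) * (x 0 ^ 4 + x 1 ^ 4 + x 2 ^ 4)))

end Dwork

/-! ### The classes of monomials

A monomial is `v = (v₁, v₂, v₃, v₄, v₅)`, with `v₁, v₂` modulo 8 and `v₃, v₄, v₅` modulo 4, such
that `8 ∣ v₁ + v₂ + 2 (v₃ + v₄ + v₅)`. Two monomials are in the same class if they differ by a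
multiple of `(1,1,1,1,1)` and by permutations of `v₁, v₂` and of `v₃, v₄, v₅`. The weight `λ_v` is
the number of distinct permutations of `v`, times the least `n ≥ 1` such that `v + n (1,1,1,1,1)` is
a permutation of `v`, divided by 8. -/

/-- Representatives `((v₁, v₂), (v₃, v₄, v₅))` of the 15 classes, with `v₁` and `v₂` even. -/
def octicMonomial : Fin 15 → (Fin 2 → ℤ) × (Fin 3 → ℤ) :=
  ![(![0, 0], ![0, 0, 0]), (![0, 2], ![1, 1, 1]), (![0, 4], ![2, 2, 2]),
    (![0, 0], ![0, 2, 2]), (![2, 0], ![1, 3, 3]), (![4, 0], ![2, 0, 0]),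
    (![0, 0], ![2, 1, 1]), (![6, 0], ![1, 0, 0]), (![0, 4], ![0, 3, 3]),
    (![4, 0], ![1, 1, 0]), (![2, 0], ![3, 0, 0]), (![2, 2], ![1, 1, 0]),
    (![0, 0], ![3, 1, 0]), (![2, 0], ![2, 1, 0]), (![4, 0], ![2, 3, 1])]

/-- The weights `λ_v` of the 15 classes. -/
def octicWeight : Fin 15 → ℕ :=
  ![1, 2, 1, 3, 6, 3, 3, 6, 3, 3, 6, 3, 6, 12, 6]

/-- Representatives of the four classes that contain a monomial with `4 ∣ v₁, v₂` and
`2 ∣ v₃, v₄, v₅`. -/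
def octicMonomialFour : Fin 4 → (Fin 2 → ℤ) × (Fin 3 → ℤ) :=
  ![(![0, 0], ![0, 0, 0]), (![0, 4], ![2, 2, 2]), (![0, 0], ![0, 2, 2]), (![4, 0], ![2, 0, 0])]

/-- The weights `λ_v` of these four classes. -/
def octicWeightFour : Fin 4 → ℕ := ![1, 1, 3, 3]

/-! ### Convergence of the Dwork series on the circle `‖z‖ = ‖π‖` -/

section DworkConvergence

open PowerSeries Filter Topology

/-! The count is a character sum in the manner of Dwork. For a nontrivial additive character Θ of
`F`, q times the number of zeros of P in the Cox domain is the sum of Θ(yP) over all y and all x in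
that domain. The two-dimensional torus acts freely on the zeros (`octicScale_injective`), so N is
this number divided by (q - 1)². The terms y = 0, together with the missing points x₃ = x₄ = x₅ = x₆
= 0 for y ≠ 0, give (q + 1)(q² + q + 1). The rest is the exceptional sum plus the monomial sum
(`mul_card_octicCoords`, `octicCount_eq`).

That Θ_s is such a character is Dwork's theorem. Since π^p / p = -π, the series F(πX) is exp(π(X -
X^p)). It equals 1 + π(X + V), where V has coefficients in π𝒪 tending to 0 (`exists_dwork_eq`), so
it can be evaluated on the closed unit disc. At a point with t^p = t its value is a p-th root of
unity congruent to 1 + πt modulo π² (`dwork_tsum_spec`). A p-th root of unity closer to 1 than |π|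
is 1 (`eq_one_of_pow_prime_eq_one`), so congruences modulo π² between these values are equalities:
this gives additivity (`dwork_tsum_add`). The value at t = 1 is not 1, which gives nontriviality.

Fourier inversion on the multiplicative group expresses Θ through Gauss sums. A torus sum of a
product of values of Θ at monomials becomes a sum of products of Gauss sums over the exponent
vectors that solve a linear system modulo q - 1 (`torus_sum_monomials`). For the octic the solutions
form a family with parameters u and t, or w when φ = 0, up to solutions of 8n = 0 and 4n = 0
(`torsionEight_mul_octicTorusSum`, `torsionEight_mul_octicTorusSum_zero`). The latter are the
monomials v. `octicSum_eq_sum_classes` groups them into the 15 classes, and `IsClassSum` records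
which translates survive for each residue of q - 1 modulo 8.

Finally, the ψ-term of P vanishes when a coordinate does, and the φ-term vanishes when x₁ or x₂
does. So `octicAffineSum_eq` turns the affine sum into the torus sum plus sums of products of
simpler pieces. In a full one-variable sum the point x = 0 cancels the trivial character, because G₀
= -1 (`sum_addChar_pow`). Replacing torus sums by affine ones therefore removes exactly the vectors
with a vanishing index, and these are the conditions Z₂ and Z₅. -/

theorem PowerSeries.eq_of_derivative_eq_mul {k : Type*} [Field k] [CharZero k] {a f g : k⟦X⟧}
    (hf : d⁄dX k f = a * f) (hg : d⁄dX k g = a * g)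
    (h0 : constantCoeff f = constantCoeff g) : f = g := by
  ext n
  induction n using Nat.strong_induction_on with
  | _ n ih =>
    cases n with
    | zero => simpa using h0
    | succ n =>
      have h1 := congrArg (coeff n) hf
      have h2 := congrArg (coeff n) hg
      rw [coeff_derivative, coeff_mul] at h1 h2
      have h3 : coeff (n + 1) f * ((n : k) + 1) = coeff (n + 1) g * ((n : k) + 1) := by
        rw [h1, h2]
        refine Finset.sum_congr rfl fun x hx => ?_
        rw [ih x.2 (by have := Finset.HasAntidiagonal.mem_antidiagonal.1 hx; omega)]
      exact mul_right_cancel₀ (by exact_mod_cast Nat.succ_ne_zero n) h3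

/-- Both sides have constant term 1 and satisfy Y' = (1 + X^(p-1)) Y, and this equation determines
all the coefficients in characteristic zero. -/
theorem dworkSeries_eq_mul (p : ℕ) (hp : p ≠ 0) :
    dworkSeries p = exp ℚ * expand p hp (rescale ((p : ℚ)⁻¹) (exp ℚ)) := by
  have h0 : constantCoeff (X + C ((p : ℚ)⁻¹) * X ^ p : ℚ⟦X⟧) = 0 := by simp [hp]
  have hsub : HasSubst (X + C ((p : ℚ)⁻¹) * X ^ p : ℚ⟦X⟧) := HasSubst.of_constantCoeff_zero' h0
  have hsubX : HasSubst (X ^ p : ℚ⟦X⟧) := HasSubst.X_pow hp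
  have hp' : (p : ℚ) ≠ 0 := by exact_mod_cast hp
  have hdX : d⁄dX ℚ (X ^ p : ℚ⟦X⟧) = C (p : ℚ) * X ^ (p - 1) := by
    rw [Derivation.leibniz_pow]; simp
  have hdr : d⁄dX ℚ (rescale ((p : ℚ)⁻¹) (exp ℚ)) = C ((p : ℚ)⁻¹) * rescale ((p : ℚ)⁻¹) (exp ℚ) := by
    ext n
    have h := congrArg (coeff n) (derivative_exp ℚ)
    rw [coeff_derivative] at h
    rw [coeff_derivative, coeff_rescale, coeff_C_mul, coeff_rescale, ← h]
    ring
  apply eq_of_derivative_eq_mul (a := 1 + X ^ (p - 1))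
  · rw [dworkSeries, derivative_subst hsub, derivative_exp]
    rw [map_add, derivative_X, Derivation.leibniz, hdX, derivative_C]
    simp only [smul_eq_mul, mul_zero, add_zero]
    rw [← mul_assoc, ← map_mul, inv_mul_cancel₀ hp']
    simp [mul_comm]
  · rw [Derivation.leibniz, derivative_exp, expand_apply, derivative_subst hsubX, hdr, hdX,
      subst_mul hsubX]
    have : (C ((p : ℚ)⁻¹) : ℚ⟦X⟧).subst (X ^ p : ℚ⟦X⟧) = C ((p : ℚ)⁻¹) := subst_C _
    rw [this]
    simp only [smul_eq_mul]
    have h2 : (C ((p : ℚ)⁻¹) * C (p : ℚ) : ℚ⟦X⟧) = 1 := by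
      rw [← map_mul, inv_mul_cancel₀ hp', map_one]
    linear_combination (exp ℚ * subst (X ^ p : ℚ⟦X⟧) (rescale ((p : ℚ)⁻¹) (exp ℚ)) * X ^ (p - 1)) * h2
  · have := constantCoeff_subst_eq_zero (R := ℚ) (S := ℚ) (a := (X + C ((p : ℚ)⁻¹) * X ^ p : ℚ⟦X⟧))
      h0 (exp ℚ - 1) (by simp)
    rw [subst_sub hsub, ← map_one (C : ℚ →+* ℚ⟦X⟧), subst_C] at this
    have h1 : constantCoeff (dworkSeries p) = 1 := by
      have h := sub_eq_zero.1 ((map_sub (constantCoeff (R := ℚ)) _ _).symm.trans this)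
      rw [dworkSeries]
      refine h.trans ?_
      exact constantCoeff_C (1 : ℚ)
    rw [h1, map_mul, constantCoeff_expand, constantCoeff_exp, ← coeff_zero_eq_constantCoeff_apply,
      coeff_rescale]
    simp

end DworkConvergence

/-! ### Power series with eventually small coefficients over an ultrametric field. -/

section DworkConvergence

open PowerSeries Filter Topology

variable {K : Type*} [NormedField K] [IsUltrametricDist K]

/-- The subring of power series with coefficients of norm at most `1`, and eventually at most `r`. -/
def eventuallySmall (K : Type*) [NormedField K] [IsUltrametricDist K] (r : NNReal) :
    Subring K⟦X⟧ where
  carrier := {f | (∀ n, ‖coeff n f‖ ≤ 1) ∧ ∀ᶠ n in atTop, ‖coeff n f‖ ≤ r}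
  zero_mem' := by simp
  one_mem' := by
    refine ⟨fun n => ?_, ?_⟩
    · rw [coeff_one]; split_ifs <;> simp
    · filter_upwards [eventually_gt_atTop 0] with n hn
      rw [coeff_one, if_neg hn.ne']; simp
  add_mem' := by
    rintro f g ⟨hf, hf'⟩ ⟨hg, hg'⟩
    refine ⟨fun n => ?_, ?_⟩
    · rw [map_add]
      exact (IsUltrametricDist.norm_add_le_max _ _).trans (max_le (hf n) (hg n))
    · filter_upwards [hf', hg'] with n h1 h2
      rw [map_add]
      exact (IsUltrametricDist.norm_add_le_max _ _).trans (max_le h1 h2)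
  neg_mem' := by
    rintro f ⟨hf, hf'⟩
    exact ⟨fun n => by simpa using hf n, by simpa only [map_neg, norm_neg] using hf'⟩
  mul_mem' := by
    rintro f g ⟨hf, hf'⟩ ⟨hg, hg'⟩
    refine ⟨fun n => ?_, ?_⟩
    · rw [coeff_mul]
      refine IsUltrametricDist.norm_sum_le_of_forall_le_of_nonneg zero_le_one fun x _ => ?_
      rw [norm_mul]
      exact mul_le_one₀ (hf _) (norm_nonneg _) (hg _)
    · obtain ⟨N, hN⟩ := eventually_atTop.1 (hf'.and hg')
      filter_upwards [eventually_ge_atTop (2 * N)] with n hn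
      rw [coeff_mul]
      refine IsUltrametricDist.norm_sum_le_of_forall_le_of_nonneg r.2 fun x hx => ?_
      have hx' := Finset.HasAntidiagonal.mem_antidiagonal.1 hx
      rw [norm_mul]
      rcases le_or_gt N x.1 with h | h
      · calc _ ≤ (r : ℝ) * 1 := mul_le_mul (hN _ h).1 (hg _) (norm_nonneg _) r.2
          _ = r := mul_one _
      · calc _ ≤ 1 * (r : ℝ) := mul_le_mul (hf _) (hN _ (by omega)).2 (norm_nonneg _) zero_le_one
          _ = r := one_mul _

/-- In a coefficient of index at least 2N every product has a factor of index at least N. Membership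
of both factors in `eventuallySmall` would only bound the product by the larger eventual bound. Here
the global bound of the other factor is kept as well, and this gains a power of |π| for V^p. -/
theorem eventually_norm_coeff_mul_le {f g : K⟦X⟧} {b b' r r' R : ℝ}
    (hb : 0 ≤ b) (hr : 0 ≤ r) (hR : 0 ≤ R)
    (hf : ∀ n, ‖coeff n f‖ ≤ b) (hg : ∀ n, ‖coeff n g‖ ≤ b')
    (hf' : ∀ᶠ n in atTop, ‖coeff n f‖ ≤ r) (hg' : ∀ᶠ n in atTop, ‖coeff n g‖ ≤ r')
    (h1 : r * b' ≤ R) (h2 : b * r' ≤ R) : ∀ᶠ n in atTop, ‖coeff n (f * g)‖ ≤ R := by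
  obtain ⟨N, hN⟩ := eventually_atTop.1 (hf'.and hg')
  filter_upwards [eventually_ge_atTop (2 * N)] with n hn
  rw [coeff_mul]
  refine IsUltrametricDist.norm_sum_le_of_forall_le_of_nonneg hR fun x hx => ?_
  have hx' := Finset.HasAntidiagonal.mem_antidiagonal.1 hx
  rw [norm_mul]
  rcases le_or_gt N x.1 with h | h
  · exact (mul_le_mul (hN _ h).1 (hg _) (norm_nonneg _) hr).trans h1
  · exact (mul_le_mul (hf _) (hN _ (by omega)).2 (norm_nonneg _) hb).trans h2

theorem norm_coeff_mul_le {f g : K⟦X⟧} {b b' : ℝ} (hb : 0 ≤ b) (hb' : 0 ≤ b')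
    (hf : ∀ n, ‖coeff n f‖ ≤ b) (hg : ∀ n, ‖coeff n g‖ ≤ b') (n : ℕ) :
    ‖coeff n (f * g)‖ ≤ b * b' := by
  rw [coeff_mul]
  refine IsUltrametricDist.norm_sum_le_of_forall_le_of_nonneg (by positivity) fun x _ => ?_
  rw [norm_mul]
  exact mul_le_mul (hf _) (hg _) (norm_nonneg _) hb

/-- If `V - V ^ (n + 2)` has coefficients bounded by `b ≤ 1`, so does `V`. -/
theorem norm_coeff_le_of_sub_pow {V : K⟦X⟧} {b : ℝ} (hb : 0 ≤ b) (h0 : coeff 0 V = 0)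
    (h1 : V ∈ eventuallySmall K 1) (k : ℕ)
    (h : ∀ n, ‖coeff n (V - V ^ (k + 2))‖ ≤ b) (n : ℕ) : ‖coeff n V‖ ≤ b := by
  induction n using Nat.strong_induction_on with
  | _ n ih =>
    have hU : V * V ^ k ∈ eventuallySmall K 1 := mul_mem h1 (pow_mem h1 k)
    have hU0 : coeff 0 (V * V ^ k) = 0 := by
      rw [coeff_zero_eq_constantCoeff_apply] at h0 ⊢
      rw [map_mul, h0, zero_mul]
    have h2 : ‖coeff n (V ^ (k + 2))‖ ≤ b := by
      rw [show V ^ (k + 2) = V * (V * V ^ k) by ring, coeff_mul]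
      refine IsUltrametricDist.norm_sum_le_of_forall_le_of_nonneg hb fun x hx => ?_
      have hx' := Finset.HasAntidiagonal.mem_antidiagonal.1 hx
      -- The constant term of V^(k+1) vanishes, so the coefficient of V in each remaining product
      -- has index below n and the induction hypothesis bounds it.
      rcases Nat.eq_zero_or_pos x.2 with h' | h'
      · rw [h', hU0, mul_zero, norm_zero]; exact hb
      · rw [norm_mul]
        calc _ ≤ b * 1 := mul_le_mul (ih _ (by omega)) (hU.1 _) (norm_nonneg _) hb
          _ = b := mul_one b
    have h3 : coeff n V = coeff n (V - V ^ (k + 2)) + coeff n (V ^ (k + 2)) := by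
      rw [map_sub]; ring
    rw [h3]
    exact (IsUltrametricDist.norm_add_le_max _ _).trans (max_le (h n) h2)

/-- The inner binomial coefficients are divisible by the prime q. The ring is arbitrary so that the
statement can be applied inside a subring such as `eventuallySmall`: the remainder s then lies in
that subring too. -/
theorem exists_one_add_pow_prime_eq {R : Type*} [CommRing R] (q : ℕ) (hq : q.Prime) (hq2 : q ≠ 2) :
    ∀ y : R, ∃ s, (1 + y) ^ q = 1 + q * y + y ^ q + q * y ^ 2 * s := by
  intro y
  obtain ⟨k, rfl⟩ : ∃ k, q = k + 3 := ⟨q - 3, by have := hq.two_le; omega⟩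
  refine ⟨∑ i ∈ Finset.range (k + 1), y ^ i * (((k + 3).choose (i + 2) / (k + 3) : ℕ) : R), ?_⟩
  rw [add_comm 1 y, add_pow, Finset.sum_range_succ, Finset.sum_range_succ', Finset.sum_range_succ',
    Finset.mul_sum]
  have : ∀ i ∈ Finset.range (k + 1), ((k + 3 : ℕ) : R) * y ^ 2 *
      (y ^ i * (((k + 3).choose (i + 2) / (k + 3) : ℕ) : R)) =
      y ^ (i + 1 + 1) * 1 ^ (k + 3 - (i + 1 + 1)) * ((k + 3).choose (i + 1 + 1) : R) := by
    intro i hi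
    have hd : (k + 3) ∣ (k + 3).choose (i + 2) := by
      apply hq.dvd_choose_self (by omega)
      have := Finset.mem_range.1 hi
      omega
    have h2 : (((k + 3).choose (i + 2) : ℕ) : R) =
        ((k + 3 : ℕ) : R) * (((k + 3).choose (i + 2) / (k + 3) : ℕ) : R) := by
      rw [← Nat.cast_mul, Nat.mul_div_cancel' hd]
    rw [h2, one_pow]
    ring
  rw [Finset.sum_congr rfl this]
  simp
  ring

end DworkConvergence

/-! ### The exponential series exp(cπX) and the splitting series. -/

section DworkConvergence

open PowerSeries Filter Topology

variable {p : ℕ} [hp : Fact p.Prime] {K : Type*} [NormedField K] [NormedAlgebra ℚ_[p] K]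

theorem norm_natCast_eq_pow_padicValNat {n : ℕ} (hn : n ≠ 0) :
    ‖(n : K)‖ = ((p : ℝ)⁻¹) ^ padicValNat p n := by
  have hn' : (n : ℚ_[p]) ≠ 0 := by exact_mod_cast hn
  rw [← map_natCast (algebraMap ℚ_[p] K), norm_algebraMap', Padic.norm_eq_zpow_neg_valuation hn',
    Padic.valuation_natCast, zpow_neg, zpow_natCast, inv_pow]

variable {π : K} (hπ : π ^ (p - 1) = -(p : K))

include hπ

theorem norm_pi_pow : ‖π‖ ^ (p - 1) = (p : ℝ)⁻¹ := by
  rw [← norm_pow, hπ, norm_neg, norm_natCast_eq_pow_padicValNat (p := p) hp.out.ne_zero,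
    padicValNat_self, pow_one]

theorem norm_pi_pos : 0 < ‖π‖ := by
  rw [norm_pos_iff]
  rintro rfl
  have h := norm_pi_pow hπ
  have h1 := hp.out.two_le
  rw [norm_zero, zero_pow (by omega)] at h
  have : (0 : ℝ) < (p : ℝ)⁻¹ := by have := hp.out.pos; positivity
  exact this.ne h

theorem norm_pi_lt_one : ‖π‖ < 1 := by
  by_contra! h
  have h1 := one_le_pow₀ h (n := p - 1)
  rw [norm_pi_pow hπ] at h1
  have : (p : ℝ)⁻¹ < 1 := inv_lt_one_of_one_lt₀ (by exact_mod_cast hp.out.one_lt)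
  linarith

omit hp [NormedAlgebra ℚ_[p] K] in
theorem norm_prime_eq : ‖(p : K)‖ = ‖π‖ ^ (p - 1) := by
  rw [← norm_pow, hπ, norm_neg]

theorem norm_prime_le : ‖(p : K)‖ ≤ ‖π‖ := by
  rw [norm_prime_eq hπ]
  have h1 := hp.out.two_le
  exact pow_le_of_le_one (norm_nonneg _) (norm_pi_lt_one hπ).le (by omega)

theorem norm_prime_lt_one : ‖(p : K)‖ < 1 := (norm_prime_le hπ).trans_lt (norm_pi_lt_one hπ)

/-- Legendre's formula gives (p - 1) v_p(n!) < n, and |p| = |π|^(p-1). Hence the coefficients of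
exp(πX) are at most |π| in norm from degree one on; nothing here forces them to tend to 0. -/
theorem norm_pi_pow_le_factorial {n : ℕ} (hn : n ≠ 0) :
    ‖π‖ ^ (n - 1) ≤ ‖(n.factorial : K)‖ := by
  rw [norm_natCast_eq_pow_padicValNat (p := p) n.factorial_ne_zero, ← norm_pi_pow hπ, ← pow_mul]
  have := sub_one_mul_padicValNat_factorial_lt_of_ne_zero (p := p) hn
  exact pow_le_pow_of_le_one (norm_nonneg _) (norm_pi_lt_one hπ).le (by omega)

variable [CharZero K]

theorem norm_pow_div_factorial_le (c : K) {n : ℕ} (hn : n ≠ 0) :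
    ‖(c * π) ^ (n - 1) / (n.factorial : K)‖ ≤ ‖c‖ ^ (n - 1) := by
  have h0 : 0 < ‖(n.factorial : K)‖ := norm_pos_iff.2 (by exact_mod_cast n.factorial_ne_zero)
  rw [norm_div, norm_pow, norm_mul, mul_pow, div_le_iff₀ h0]
  exact mul_le_mul_of_nonneg_left (norm_pi_pow_le_factorial hπ hn) (by positivity)

omit hπ [NormedAlgebra ℚ_[p] K] in
theorem coeff_rescale_exp (a : K) (n : ℕ) :
    coeff n (rescale a (exp K)) = a ^ n / (n.factorial : K) := by
  rw [coeff_rescale, coeff_exp]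
  simp [div_eq_mul_inv]

variable [IsUltrametricDist K]

/-- The coefficient of A in degree n ≥ 2 is (cπ)^(n-1) / n!, of norm at most |c|^(n-1). For |c| = 1
this only gives integrality; for |c| < 1 it gives decay. The two cases are used with c = ±1 and c =
±p. -/
theorem rescale_exp_eq (c : K) (hc : ‖c‖ = 1 ∨ ‖c‖ < 1) :
    ∃ A : K⟦X⟧, rescale (c * π) (exp K) = 1 + C (c * π) * (X + A) ∧ coeff 0 A = 0 ∧
      (∀ n, ‖coeff n A‖ ≤ ‖c‖) ∧
      (‖c‖ < 1 → ∀ r : NNReal, 0 < r → A ∈ eventuallySmall K r) := by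
  have hA : ∀ n, 2 ≤ n → ‖(c * π) ^ (n - 1) / (n.factorial : K)‖ ≤ ‖c‖ ^ (n - 1) :=
    fun n hn => norm_pow_div_factorial_le hπ c (by omega)
  have hc1 : ‖c‖ ≤ 1 := by rcases hc with h | h <;> linarith
  have hb : ∀ n, ‖(if n < 2 then 0 else (c * π) ^ (n - 1) / (n.factorial : K) : K)‖ ≤ ‖c‖ := by
    intro n
    split_ifs with h
    · simp
    · exact (hA n (by omega)).trans (pow_le_of_le_one (norm_nonneg _) hc1 (by omega))
  refine ⟨mk fun n => if n < 2 then 0 else (c * π) ^ (n - 1) / (n.factorial : K), ?_, by simp,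
    fun n => by rw [coeff_mk]; exact hb n, fun hlt r hr => ⟨fun n => ?_, ?_⟩⟩
  · ext n
    rw [coeff_rescale_exp, map_add, coeff_C_mul, map_add, coeff_mk, coeff_one, coeff_X]
    rcases n with _ | _ | n
    · simp
    · simp
    · have : n + 1 + 1 - 1 = n + 1 := rfl
      simp only [this]
      simp
      ring
  · rw [coeff_mk]; exact (hb n).trans hc1
  · have h1 : Tendsto (fun n : ℕ => ‖c‖ ^ (n - 1)) atTop (𝓝 0) :=
      (tendsto_pow_atTop_nhds_zero_of_lt_one (norm_nonneg _) hlt).comp (tendsto_sub_atTop_nat 1)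
    filter_upwards [h1.eventually_lt_const (show (0 : ℝ) < r from hr), eventually_ge_atTop 2]
      with n hn h2
    rw [coeff_mk, if_neg (by omega)]
    exact (hA n h2).trans hn.le

omit hπ hp [NormedAlgebra ℚ_[p] K] [CharZero K] in
theorem expand_mem_eventuallySmall (hp0 : p ≠ 0) {A : K⟦X⟧} {r : NNReal}
    (hA : A ∈ eventuallySmall K r) : expand p hp0 A ∈ eventuallySmall K r := by
  refine ⟨fun n => ?_, ?_⟩
  · rw [coeff_expand]
    split_ifs
    · exact hA.1 _
    · simp
  · obtain ⟨N, hN⟩ := eventually_atTop.1 hA.2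
    filter_upwards [eventually_ge_atTop (p * N)] with n hn
    rw [coeff_expand]
    split_ifs with h
    · exact hN _ ((Nat.le_div_iff_mul_le (Nat.pos_of_ne_zero hp0)).2 (by rwa [mul_comm]))
    · simp

omit hπ hp [NormedAlgebra ℚ_[p] K] [CharZero K] in
theorem C_mem_eventuallySmall {c : K} (hc : ‖c‖ ≤ 1) (r : NNReal) :
    (C c : K⟦X⟧) ∈ eventuallySmall K r := by
  refine ⟨fun n => ?_, ?_⟩
  · rw [coeff_C]; split_ifs <;> simp [hc]
  · filter_upwards [eventually_gt_atTop 0] with n hn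
    rw [coeff_C, if_neg hn.ne']; simp

omit hπ hp [NormedAlgebra ℚ_[p] K] [CharZero K] in
theorem X_mem_eventuallySmall (r : NNReal) : (X : K⟦X⟧) ∈ eventuallySmall K r := by
  refine ⟨fun n => ?_, ?_⟩
  · rw [coeff_X]; split_ifs <;> simp
  · filter_upwards [eventually_gt_atTop 1] with n hn
    rw [coeff_X, if_neg hn.ne']; simp

omit hπ hp [NormedAlgebra ℚ_[p] K] [CharZero K] in
theorem mem_eventuallySmall_one {A : K⟦X⟧} (hA : ∀ n, ‖coeff n A‖ ≤ 1) :
    A ∈ eventuallySmall K 1 := ⟨hA, Eventually.of_forall hA⟩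

omit hπ hp [NormedAlgebra ℚ_[p] K] [CharZero K] [IsUltrametricDist K] in
theorem norm_coeff_expand_le (hp0 : p ≠ 0) {A : K⟦X⟧} {b : ℝ} (hb : 0 ≤ b)
    (hA : ∀ n, ‖coeff n A‖ ≤ b) (n : ℕ) : ‖coeff n (expand p hp0 A)‖ ≤ b := by
  rw [coeff_expand]
  split_ifs
  · exact hA _
  · simpa

/-- The series `exp (π (X - X ^ p))` equals `1 + π X` up to terms with coefficients in `π ² 𝒪`. -/
theorem exists_dwork_eq (hp2 : p ≠ 2) : ∃ V : K⟦X⟧,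
    rescale π (exp K) * expand p hp.out.ne_zero (rescale (-π) (exp K)) = 1 + C π * (X + V) ∧
    coeff 0 V = 0 ∧ (∀ n, ‖coeff n V‖ ≤ ‖π‖) ∧ Tendsto (fun n => coeff n V) atTop (𝓝 0) := by
  have hp0 := hp.out.ne_zero
  have hpi : π ≠ 0 := norm_pos_iff.1 (norm_pi_pos hπ)
  have hpK : (p : K) ≠ 0 := by exact_mod_cast hp0
  have hlt := norm_prime_lt_one hπ
  have hple := norm_prime_le hπ
  have hpi1 := norm_pi_lt_one hπ
  obtain ⟨A, hA, hA0, hA1, -⟩ := rescale_exp_eq hπ (1 : K) (by simp)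
  obtain ⟨B, hB, hB0, hB1, -⟩ := rescale_exp_eq hπ (-1 : K) (by simp)
  obtain ⟨A', hA', -, hA'1, hA'2⟩ := rescale_exp_eq hπ (p : K) (Or.inr hlt)
  obtain ⟨B', hB', -, hB'1, hB'2⟩ := rescale_exp_eq hπ (-(p : K)) (by simp [hlt])
  rw [norm_neg] at hB'1 hB'2
  specialize hA'2 hlt
  specialize hB'2 hlt
  rw [one_mul] at hA
  rw [neg_mul, one_mul] at hB
  rw [norm_neg, norm_one] at hB1
  rw [norm_one] at hA1
  set f := rescale π (exp K) * expand p hp0 (rescale (-π) (exp K)) with hf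
  -- The p-th power multiplies the exponents by p, so unlike those of f its two factors have
  -- coefficients tending to 0.
  have hfp : f ^ p = rescale (p * π) (exp K) * expand p hp0 (rescale (-p * π) (exp K)) := by
    rw [hf, mul_pow, ← map_pow, ← map_pow, ← map_pow, exp_pow_eq_rescale_exp, rescale_rescale,
      rescale_rescale]
    congr 4; ring_nf
  -- This V is read off from f = (1 + π(X + A)) (1 - π(X^p + B(X^p))).
  set V : K⟦X⟧ := A - (X ^ p + expand p hp0 B)
    - C π * (X + A) * (X ^ p + expand p hp0 B) with hV
  have hfV : f = 1 + C π * (X + V) := by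
    rw [hf, hA, hB, map_add, map_mul, map_add, expand_X, map_one, expand_C, hV, map_neg]
    ring
  have memA := mem_eventuallySmall_one hA1
  have memB := expand_mem_eventuallySmall hp0 (mem_eventuallySmall_one hB1)
  have memX := X_mem_eventuallySmall (K := K)
  have memV1 : V ∈ eventuallySmall K 1 := by
    refine sub_mem (sub_mem memA (add_mem (pow_mem (memX 1) p) memB)) (mul_mem (mul_mem
      (C_mem_eventuallySmall hpi1.le 1) (add_mem (memX 1) memA)) (add_mem (pow_mem (memX 1) p) memB))
  have hV0 : coeff 0 V = 0 := by
    rw [coeff_zero_eq_constantCoeff_apply] at hA0 hB0 ⊢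
    simp [hV, hA0, hB0, hp0]
  set g : K⟦X⟧ := A' - expand p hp0 B'
    - C (p * π) * ((X + A') * (X ^ p + expand p hp0 B')) with hg
  have hfg : f ^ p = 1 + C (p * π) * (X - X ^ p + g) := by
    rw [hfp, hA', hB', map_add (expand p hp0), map_mul (expand p hp0), map_add (expand p hp0),
      expand_X, map_one, expand_C, hg, neg_mul, map_neg]
    ring
  have memg : ∀ r : NNReal, 0 < r → g ∈ eventuallySmall K r := by
    intro r hr
    have hc : ‖(p : K) * π‖ ≤ 1 := by
      rw [norm_mul]; exact mul_le_one₀ hlt.le (norm_nonneg _) hpi1.le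
    exact sub_mem (sub_mem (hA'2 r hr) (expand_mem_eventuallySmall hp0 (hB'2 r hr)))
      (mul_mem (C_mem_eventuallySmall hc r) (mul_mem (add_mem (memX r) (hA'2 r hr))
      (add_mem (pow_mem (memX r) p) (expand_mem_eventuallySmall hp0 (hB'2 r hr)))))
  have norm_sub_le : ∀ {x y : K} {b : ℝ}, ‖x‖ ≤ b → ‖y‖ ≤ b → ‖x - y‖ ≤ b := fun {x y b} hx hy =>
    sub_eq_add_neg x y ▸ (IsUltrametricDist.norm_add_le_max x (-y)).trans
      (max_le hx (by rwa [norm_neg]))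
  have norm_add_le : ∀ {x y : K} {b : ℝ}, ‖x‖ ≤ b → ‖y‖ ≤ b → ‖x + y‖ ≤ b := fun {x y b} hx hy =>
    (IsUltrametricDist.norm_add_le_max x y).trans (max_le hx hy)
  have hgb : ∀ n, ‖coeff n g‖ ≤ ‖π‖ := by
    intro n
    have m1 := (mul_mem (add_mem (memX 1) (hA'2 1 one_pos)) (add_mem (pow_mem (memX 1) p)
      (expand_mem_eventuallySmall hp0 (hB'2 1 one_pos)))).1 n
    rw [hg, map_sub, map_sub, coeff_C_mul]
    refine norm_sub_le (norm_sub_le ((hA'1 n).trans hple)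
      ((norm_coeff_expand_le hp0 (norm_nonneg _) hB'1 n).trans hple)) ?_
    rw [norm_mul, norm_mul]
    calc ‖(p : K)‖ * ‖π‖ * _ ≤ 1 * ‖π‖ * 1 := by gcongr
      _ = ‖π‖ := by ring
  -- the fixed point equation
  have key : ∀ r : NNReal, V ∈ eventuallySmall K r → ∃ s ρ, s ∈ eventuallySmall K r ∧
      ρ ∈ eventuallySmall K r ∧ V = g + V ^ p + C (p : K) * (ρ * V) - C π * s := by
    intro r hr
    -- The expansions of (1 + y)^p and (X + V)^p are applied inside the subring, so that the
    -- remainders s and ρ inherit the bound r known for V.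
    let y : eventuallySmall K r :=
      ⟨C π * (X + V), mul_mem (C_mem_eventuallySmall hpi1.le r) (add_mem (memX r) hr)⟩
    obtain ⟨s, hs⟩ := exists_one_add_pow_prime_eq p hp.out hp2 y
    obtain ⟨ρ, hρ⟩ := exists_add_pow_prime_eq hp.out (⟨X, memX r⟩ : eventuallySmall K r) ⟨V, hr⟩
    have hs' : (1 + C π * (X + V)) ^ p = 1 + (p : K⟦X⟧) * (C π * (X + V)) + (C π * (X + V)) ^ p
        + (p : K⟦X⟧) * (C π * (X + V)) ^ 2 * (s : K⟦X⟧) := congrArg Subtype.val hs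
    have hρ' : (X + V) ^ p = X ^ p + V ^ p + (p : K⟦X⟧) * X * V * (ρ : K⟦X⟧) :=
      congrArg Subtype.val hρ
    refine ⟨(X + V) ^ 2 * s.1, X * ρ.1, mul_mem (pow_mem (add_mem (memX r) hr) 2) s.2,
      mul_mem (memX r) ρ.2, ?_⟩
    -- By π^p = -pπ the term π^p (X + V)^p carries the same factor pπ as the linear term. After
    -- division by pπ the term X^p cancels against the one in f^p.
    rw [← hfV, hfg, mul_pow, hρ', ← map_pow, ← pow_sub_one_mul hp0 π, hπ,
      ← map_natCast (C : K →+* K⟦X⟧)] at hs'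
    have hne : (C ((p : K) * π) : K⟦X⟧) ≠ 0 := by
      rw [Ne, map_eq_zero_iff _ (C_injective (R := K))]
      exact mul_ne_zero hpK hpi
    apply mul_left_cancel₀ hne
    simp only [map_mul, map_neg, mul_pow] at hs' ⊢
    linear_combination -hs'
  have hVb : ∀ n, ‖coeff n V‖ ≤ ‖π‖ := by
    obtain ⟨s, ρ, hs, hρ, h⟩ := key 1 memV1
    obtain ⟨k, hk⟩ : ∃ k, p = k + 2 := ⟨p - 2, by have := hp.out.two_le; omega⟩
    refine norm_coeff_le_of_sub_pow (norm_nonneg _) hV0 memV1 k fun n => ?_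
    rw [← hk, show V - V ^ p = g + C (p : K) * (ρ * V) - C π * s by linear_combination h, map_sub,
      map_add, coeff_C_mul, coeff_C_mul]
    refine norm_sub_le (norm_add_le (hgb n) ?_) ?_
    · rw [norm_mul]
      exact (mul_le_of_le_one_right (norm_nonneg _) ((mul_mem hρ memV1).1 n)).trans hple
    · rw [norm_mul]
      exact mul_le_of_le_one_right (norm_nonneg _) (hs.1 n)
  -- Each pass through the fixed point equation gains one power of |π|: two terms carry a factor p
  -- or π, V^p is V times a series of norm at most |π|, and g decays faster than any given bound.
  have step : ∀ k : ℕ, ∀ᶠ n in atTop, ‖coeff n V‖ ≤ ‖π‖ ^ (k + 1) := by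
    intro k
    induction k with
    | zero => exact Eventually.of_forall (by simpa using hVb)
    | succ k ih =>
      have hr : V ∈ eventuallySmall K (‖π‖₊ ^ (k + 1)) := ⟨memV1.1, by simpa using ih⟩
      obtain ⟨s, ρ, hs, hρ, h⟩ := key _ hr
      obtain ⟨j, hj⟩ : ∃ j, p = j + 2 := ⟨p - 2, by have := hp.out.two_le; omega⟩
      have hpow : ∀ᶠ n in atTop, ‖coeff n (V ^ p)‖ ≤ ‖π‖ ^ (k + 1 + 1) := by
        rw [hj, show V ^ (j + 2) = V * (V * V ^ j) by ring]
        have hm : V * V ^ j ∈ eventuallySmall K (‖π‖₊ ^ (k + 1)) := mul_mem hr (pow_mem hr j)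
        have hb : ∀ n, ‖coeff n (V * V ^ j)‖ ≤ ‖π‖ := fun n => by
          simpa using norm_coeff_mul_le (norm_nonneg _) zero_le_one hVb (pow_mem hr j).1 n
        refine eventually_norm_coeff_mul_le (norm_nonneg π) (by positivity) (by positivity) hVb hb
          ih hm.2 (by rw [pow_succ _ (k + 1)]) ?_
        rw [NNReal.coe_pow, coe_nnnorm, ← pow_succ']
      have hgr := (memg (‖π‖₊ ^ (k + 1 + 1)) (pow_pos (norm_pi_pos hπ) _)).2
      filter_upwards [hpow, hgr, hs.2, (mul_mem hρ hr).2] with n h1 h2 h3 h4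
      rw [h, map_sub, map_add, map_add, coeff_C_mul, coeff_C_mul]
      simp only [NNReal.coe_pow, coe_nnnorm] at h2 h3 h4
      refine norm_sub_le (norm_add_le (norm_add_le h2 h1) ?_) ?_
      · rw [norm_mul, pow_succ' _ (k + 1)]
        exact mul_le_mul hple h4 (norm_nonneg _) (norm_nonneg _)
      · rw [norm_mul, pow_succ' _ (k + 1)]
        exact mul_le_mul_of_nonneg_left h3 (norm_nonneg _)
  refine ⟨V, hfV, hV0, hVb, ?_⟩
  rw [Metric.tendsto_atTop]
  intro ε hε
  obtain ⟨k, hk⟩ := exists_pow_lt_of_lt_one hε hpi1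
  obtain ⟨N, hN⟩ := eventually_atTop.1 (step k)
  refine ⟨N, fun n hn => ?_⟩
  rw [dist_zero_right]
  refine (hN n hn).trans_lt (lt_of_le_of_lt ?_ hk)
  exact pow_le_pow_of_le_one (norm_nonneg _) hpi1.le (by omega)

end DworkConvergence

/-! ### Evaluation on the closed unit disc and the values of Dwork's series. -/

section DworkConvergence

open PowerSeries Filter Topology

section Evaluation

variable {K : Type*} [NormedField K] [IsUltrametricDist K] [CompleteSpace K]

/-- The subring of power series with coefficients of norm at most `1` that tend to `0`. -/
noncomputable def restrictedIntegral (K : Type*) [NormedField K] [IsUltrametricDist K] : Subring K⟦X⟧ :=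
  ⨅ r : {r : NNReal // 0 < r}, eventuallySmall K r

omit [CompleteSpace K] in
theorem mem_restrictedIntegral {f : K⟦X⟧} (h1 : ∀ n, ‖coeff n f‖ ≤ 1)
    (h : Tendsto (fun n => coeff n f) atTop (𝓝 0)) : f ∈ restrictedIntegral K := by
  refine Subring.mem_iInf.2 fun r => ⟨h1, ?_⟩
  have h2 := (tendsto_zero_iff_norm_tendsto_zero.1 h).eventually_lt_const
    (show (0 : ℝ) < r.1 from r.2)
  exact h2.mono fun n hn => hn.le

theorem summable_of_mem {f : K⟦X⟧} (hf : f ∈ restrictedIntegral K) {z : K} (hz : ‖z‖ ≤ 1) :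
    Summable fun n => coeff n f * z ^ n := by
  apply NonarchimedeanAddGroup.summable_of_tendsto_cofinite_zero
  rw [Nat.cofinite_eq_atTop, Metric.tendsto_atTop]
  intro ε hε
  obtain ⟨N, hN⟩ := eventually_atTop.1
    (Subring.mem_iInf.1 hf ⟨⟨ε / 2, by positivity⟩, half_pos hε⟩).2
  refine ⟨N, fun n hn => ?_⟩
  rw [dist_zero_right, norm_mul, norm_pow]
  calc _ ≤ ‖coeff n f‖ * 1 := by gcongr; exact pow_le_one₀ (norm_nonneg _) hz
    _ ≤ ε / 2 := by rw [mul_one]; exact hN n hn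
    _ < ε := half_lt_self hε

omit [CompleteSpace K] in
theorem summable_mul_of_ultrametric {u v : ℕ → K} (hu : Summable u) (hv : Summable v) :
    Summable fun x : ℕ × ℕ => u x.1 * v x.2 := by
  have : NonarchimedeanRing K := ⟨NonarchimedeanAddGroup.is_nonarchimedean⟩
  exact hu.mul_of_nonarchimedean hv

/-- The value of a power series at `z`. -/
noncomputable def seriesEval (z : K) (f : K⟦X⟧) : K := ∑' n, coeff n f * z ^ n

theorem seriesEval_mul {f g : K⟦X⟧} (hf : f ∈ restrictedIntegral K)
    (hg : g ∈ restrictedIntegral K) {z : K} (hz : ‖z‖ ≤ 1) :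
    seriesEval z (f * g) = seriesEval z f * seriesEval z g := by
  let u : ℕ → K := fun n => coeff n f * z ^ n
  let v : ℕ → K := fun n => coeff n g * z ^ n
  have h1 : Summable u := summable_of_mem hf hz
  have h2 : Summable v := summable_of_mem hg hz
  have h3 := h1.tsum_mul_tsum_eq_tsum_sum_antidiagonal h2 (summable_mul_of_ultrametric h1 h2)
  refine Eq.trans ?_ h3.symm
  refine tsum_congr fun n => ?_
  rw [coeff_mul, Finset.sum_mul]
  refine Finset.sum_congr rfl fun x hx => ?_
  rw [← Finset.HasAntidiagonal.mem_antidiagonal.1 hx, pow_add]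
  simp only [u, v]
  ring

omit [IsUltrametricDist K] [CompleteSpace K] in
theorem seriesEval_one (z : K) : seriesEval z 1 = 1 := by
  rw [seriesEval, tsum_eq_single 0]
  · simp
  · intro n hn
    simp [coeff_one, hn]

theorem seriesEval_pow {f : K⟦X⟧} (hf : f ∈ restrictedIntegral K) {z : K} (hz : ‖z‖ ≤ 1) (n : ℕ) :
    seriesEval z (f ^ n) = seriesEval z f ^ n := by
  induction n with
  | zero => simp [seriesEval_one]
  | succ n ih => rw [pow_succ, seriesEval_mul (pow_mem hf n) hf hz, ih, pow_succ]

omit [IsUltrametricDist K] [CompleteSpace K] in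
theorem seriesEval_expand (z : K) (p : ℕ) (hp : p ≠ 0) (f : K⟦X⟧) :
    seriesEval z (expand p hp f) = seriesEval (z ^ p) f := by
  have hinj : Function.Injective fun n : ℕ => p * n := fun a b h =>
    Nat.eq_of_mul_eq_mul_left (Nat.pos_of_ne_zero hp) h
  rw [seriesEval, seriesEval, ← hinj.tsum_eq]
  · refine tsum_congr fun n => ?_
    rw [coeff_expand_mul, pow_mul]
  · intro n hn
    rw [Function.mem_support, coeff_expand] at hn
    split_ifs at hn with h
    · obtain ⟨k, rfl⟩ := h
      exact ⟨k, rfl⟩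
    · simp at hn

end Evaluation

variable {p : ℕ} [hp : Fact p.Prime] {K : Type*} [NormedField K] [NormedAlgebra ℚ_[p] K]
  [IsUltrametricDist K] [CompleteSpace K] [CharZero K]
  {π : K} (hπ : π ^ (p - 1) = -(p : K))

-- This is where the choice of π enters: π^p / p = -π, so the correction factor exp(X^p / p) becomes
-- exp(-πX^p).
omit [NormedAlgebra ℚ_[p] K] [IsUltrametricDist K] [CompleteSpace K] in
include hπ in
theorem rescale_map_dworkSeries :
    rescale π (map (algebraMap ℚ K) (dworkSeries p)) =
      rescale π (exp K) * expand p hp.out.ne_zero (rescale (-π) (exp K)) := by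
  have hp0 := hp.out.ne_zero
  have hpK : (p : K) ≠ 0 := by exact_mod_cast hp0
  rw [dworkSeries_eq_mul p hp0, map_mul, map_mul, map_exp, map_expand]
  congr 1
  ext n
  rw [coeff_rescale, coeff_expand, coeff_expand]
  split_ifs with h
  · obtain ⟨k, rfl⟩ := h
    rw [Nat.mul_div_cancel_left _ hp.out.pos, coeff_map, coeff_rescale, coeff_rescale, map_mul,
      ← coeff_map, map_exp, ← mul_assoc, pow_mul, map_pow, ← mul_pow, ← pow_sub_one_mul hp0 π, hπ]
    congr 2
    simp
    field_simp
  · simp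

include hπ

/-- The values of Dwork's series at the points `π t` with `t ^ p = t` are `p`-th roots of unity,
congruent to `1 + π t` modulo `π ^ 2`. -/
theorem dwork_tsum_spec (hp2 : p ≠ 2) {t : K} (ht : ‖t‖ ≤ 1) (htp : t ^ p = t) :
    (∑' n : ℕ, ((coeff n (dworkSeries p) : ℚ) : K) * (π * t) ^ n) ^ p = 1 ∧
    ‖(∑' n : ℕ, ((coeff n (dworkSeries p) : ℚ) : K) * (π * t) ^ n) - (1 + π * t)‖ ≤ ‖π‖ ^ 2 := by
  have hp0 := hp.out.ne_zero
  have hlt := norm_prime_lt_one hπ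
  have hpi1 := norm_pi_lt_one hπ
  obtain ⟨V, hV, -, hVb, hVt⟩ := exists_dwork_eq hπ hp2
  set f := rescale π (exp K) * expand p hp0 (rescale (-π) (exp K)) with hf
  have hsum : (∑' n : ℕ, ((coeff n (dworkSeries p) : ℚ) : K) * (π * t) ^ n) = seriesEval t f := by
    rw [hf, ← rescale_map_dworkSeries hπ, seriesEval]
    refine tsum_congr fun n => ?_
    rw [coeff_rescale, coeff_map, mul_pow, eq_ratCast]
    ring
  have memV : V ∈ restrictedIntegral K := mem_restrictedIntegral (fun n => (hVb n).trans hpi1.le) hVt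
  have memC : ∀ c : K, ‖c‖ ≤ 1 → (C c : K⟦X⟧) ∈ restrictedIntegral K := fun c hc =>
    Subring.mem_iInf.2 fun r => C_mem_eventuallySmall hc _
  have memX : (X : K⟦X⟧) ∈ restrictedIntegral K :=
    Subring.mem_iInf.2 fun r => X_mem_eventuallySmall _
  have memf : f ∈ restrictedIntegral K := by
    rw [hV]
    exact add_mem (one_mem _) (mul_mem (memC π hpi1.le) (add_mem memX memV))
  rw [hsum]
  constructor
  -- The factors exp(πX) and exp(-πX^p) of f cannot be evaluated separately at t; those of f^p can.
  · have memE : ∀ c : K, ‖c‖ < 1 → rescale (c * π) (exp K) ∈ restrictedIntegral K := by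
      intro c hc
      obtain ⟨A, hA, -, -, hA2⟩ := rescale_exp_eq hπ c (Or.inr hc)
      rw [hA]
      refine add_mem (one_mem _) (mul_mem (memC _ ?_) (add_mem memX
        (Subring.mem_iInf.2 fun r => hA2 hc _ r.2)))
      rw [norm_mul]; exact mul_le_one₀ hc.le (norm_nonneg _) hpi1.le
    have hfp : f ^ p = rescale (p * π) (exp K) * expand p hp0 (rescale (-p * π) (exp K)) := by
      rw [hf, mul_pow, ← map_pow, ← map_pow, ← map_pow, exp_pow_eq_rescale_exp, rescale_rescale,
        rescale_rescale]
      congr 4; ring_nf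
    have m1 := memE p hlt
    have m2 := memE (-p) (by rwa [norm_neg])
    -- Because t^p = t, evaluating the second factor at t^p is evaluating it at t, and the product
    -- becomes exp(pπX) exp(-pπX) = 1.
    rw [← seriesEval_pow memf ht, hfp, seriesEval_mul m1
      (Subring.mem_iInf.2 fun r => expand_mem_eventuallySmall hp0 (Subring.mem_iInf.1 m2 r)) ht,
      seriesEval_expand, htp, ← seriesEval_mul m1 m2 ht, exp_mul_exp_eq_exp_add]
    rw [show (p : K) * π + -p * π = 0 by ring, rescale_zero]
    simp [seriesEval_one]
  · have h1 : seriesEval t f = 1 + π * t + π * seriesEval t V := by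
      have hs := (summable_of_mem memV ht).hasSum
      have h2 : HasSum (fun n => coeff n (1 : K⟦X⟧) * t ^ n) (1 : K) := by
        have := (summable_of_mem (one_mem (restrictedIntegral K)) ht).hasSum
        rwa [show ∑' n, coeff n (1 : K⟦X⟧) * t ^ n = 1 from seriesEval_one t] at this
      have h3 : HasSum (fun n => coeff n (X : K⟦X⟧) * t ^ n) t := by
        convert hasSum_single (f := fun n => coeff n (X : K⟦X⟧) * t ^ n) 1 ?_ using 1
        · simp
        · intro n hn
          simp [coeff_X, hn]
      have h4 := (h2.add ((h3.mul_left π).add (hs.mul_left π))).tsum_eq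
      rw [seriesEval, hV, add_assoc, seriesEval, ← h4]
      refine tsum_congr fun n => ?_
      rw [map_add, coeff_C_mul, map_add]
      ring
    rw [h1, add_sub_cancel_left, norm_mul, sq]
    refine mul_le_mul_of_nonneg_left ?_ (norm_nonneg _)
    refine IsUltrametricDist.norm_tsum_le_of_forall_le_of_nonneg (norm_nonneg _) fun n => ?_
    rw [norm_mul, norm_pow]
    exact (mul_le_of_le_one_right (norm_nonneg _) (pow_le_one₀ (norm_nonneg _) ht)).trans (hVb n)

-- With x = ζ - 1 ≠ 0, expanding (1 + x)^p = 1 and dividing by x gives p = -(x^(p-1) + pxc) with c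
-- integral. If |x| < |π| both terms on the right are smaller than |p| = |π|^(p-1), a contradiction.
omit [CompleteSpace K] in
theorem eq_one_of_pow_prime_eq_one (hp2 : p ≠ 2) {ζ : K} (hζ : ζ ^ p = 1) (h : ‖ζ - 1‖ < ‖π‖) :
    ζ = 1 := by
  have hp0 := hp.out.ne_zero
  have hpi1 := norm_pi_lt_one hπ
  have hpK : (p : K) ≠ 0 := by exact_mod_cast hp0
  set x := ζ - 1 with hx
  -- The element x is viewed as a constant series only so that the remainder comes from a subring of
  -- integral elements.
  let y : eventuallySmall K 1 := ⟨C x, C_mem_eventuallySmall (h.trans hpi1).le 1⟩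
  obtain ⟨s, hs⟩ := exists_one_add_pow_prime_eq p hp.out hp2 y
  have hs1 := congrArg (fun z : eventuallySmall K 1 => constantCoeff z.1) hs
  have hs2 : (1 + x) ^ p = 1 + p * x + x ^ p + p * x ^ 2 * constantCoeff s.1 := by
    simpa [y] using hs1
  set c := constantCoeff s.1
  have hc : ‖c‖ ≤ 1 := by simpa using s.2.1 0
  rw [show 1 + x = ζ by rw [hx]; ring, hζ, ← pow_sub_one_mul hp0 x] at hs2
  by_contra hne
  have hx0 : x ≠ 0 := sub_ne_zero.2 hne
  have h3 : (p : K) = -(x ^ (p - 1) + p * x * c) := by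
    apply mul_right_cancel₀ hx0
    linear_combination -hs2
  have h4 : ‖x ^ (p - 1) + p * x * c‖ < ‖(p : K)‖ := by
    refine (IsUltrametricDist.norm_add_le_max _ _).trans_lt (max_lt ?_ ?_)
    · rw [norm_prime_eq hπ, norm_pow]
      have := hp.out.two_le
      exact pow_lt_pow_left₀ h (norm_nonneg _) (by omega)
    · rw [norm_mul, norm_mul]
      have hp' : 0 < ‖(p : K)‖ := norm_pos_iff.2 hpK
      calc ‖(p : K)‖ * ‖x‖ * ‖c‖ ≤ ‖(p : K)‖ * ‖x‖ * 1 := by gcongr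
        _ < ‖(p : K)‖ * 1 * 1 := by gcongr; exact h.trans hpi1
        _ = _ := by ring
  rw [← norm_neg, ← h3] at h4
  exact lt_irrefl _ h4

/-- The three values are p-th roots of unity congruent to 1 + πa, 1 + πb, 1 + πc modulo π². Since c
≡ a + b modulo p, the quotient AB/D is a p-th root of unity congruent to 1 modulo π², hence equal to
1. -/
theorem dwork_tsum_add (hp2 : p ≠ 2) {a b c : K} (ha : ‖a‖ ≤ 1) (hb : ‖b‖ ≤ 1) (hc : ‖c‖ ≤ 1)
    (hap : a ^ p = a) (hbp : b ^ p = b) (hcp : c ^ p = c) (habc : ‖c - (a + b)‖ ≤ ‖(p : K)‖) :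
    (∑' n : ℕ, ((coeff n (dworkSeries p) : ℚ) : K) * (π * c) ^ n) =
      (∑' n : ℕ, ((coeff n (dworkSeries p) : ℚ) : K) * (π * a) ^ n) *
        ∑' n : ℕ, ((coeff n (dworkSeries p) : ℚ) : K) * (π * b) ^ n := by
  obtain ⟨a1, a2⟩ := dwork_tsum_spec hπ hp2 ha hap
  obtain ⟨b1, b2⟩ := dwork_tsum_spec hπ hp2 hb hbp
  obtain ⟨c1, c2⟩ := dwork_tsum_spec hπ hp2 hc hcp
  set A := ∑' n : ℕ, ((coeff n (dworkSeries p) : ℚ) : K) * (π * a) ^ n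
  set B := ∑' n : ℕ, ((coeff n (dworkSeries p) : ℚ) : K) * (π * b) ^ n
  set D := ∑' n : ℕ, ((coeff n (dworkSeries p) : ℚ) : K) * (π * c) ^ n
  have hp0 := hp.out.ne_zero
  have norm_one_of : ∀ x : K, x ^ p = 1 → ‖x‖ = 1 := fun x hx => by
    have := congrArg norm hx
    rw [norm_pow, norm_one] at this
    exact (pow_eq_one_iff_of_nonneg (norm_nonneg _) hp0).1 this
  have hD : D ≠ 0 := by
    rintro h
    rw [h, zero_pow hp0] at c1
    exact zero_ne_one c1
  have hpi1 := norm_pi_lt_one hπ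
  have hpi0 := norm_pi_pos hπ
  have norm_add_le : ∀ {x y : K} {b : ℝ}, ‖x‖ ≤ b → ‖y‖ ≤ b → ‖x + y‖ ≤ b := fun {x y b} hx hy =>
    (IsUltrametricDist.norm_add_le_max x y).trans (max_le hx hy)
  have key : ‖A * B - D‖ ≤ ‖π‖ ^ 2 := by
    have : A * B - D = (A - (1 + π * a)) * B + ((1 + π * a) * (B - (1 + π * b)) +
        (π ^ 2 * (a * b) + (-(D - (1 + π * c)) + -(π * (c - (a + b)))))) := by ring
    rw [this]
    refine norm_add_le ?_ (norm_add_le ?_ (norm_add_le ?_ (norm_add_le ?_ ?_)))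
    · rw [norm_mul, norm_one_of B b1, mul_one]; exact a2
    · rw [norm_mul]
      have : ‖1 + π * a‖ ≤ 1 := norm_add_le (by simp) (by
        rw [norm_mul]; exact mul_le_one₀ hpi1.le (norm_nonneg _) ha)
      calc _ ≤ 1 * ‖π‖ ^ 2 := by gcongr
        _ = _ := one_mul _
    · rw [norm_mul, norm_mul, norm_pow]
      exact mul_le_of_le_one_right (by positivity) (mul_le_one₀ ha (norm_nonneg _) hb)
    · rwa [norm_neg]
    · rw [norm_neg, norm_mul, sq]
      exact mul_le_mul_of_nonneg_left (habc.trans (norm_prime_le hπ)) (norm_nonneg _)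
  have h1 : A * B / D = 1 := by
    refine eq_one_of_pow_prime_eq_one hπ hp2 (by rw [div_pow, mul_pow, a1, b1, c1]; simp) ?_
    rw [show A * B / D - 1 = (A * B - D) / D by field_simp, norm_div, norm_one_of D c1, div_one]
    calc _ ≤ ‖π‖ ^ 2 := key
      _ < ‖π‖ := pow_lt_self_of_lt_one₀ hpi0 hpi1 (by norm_num)
  exact ((div_eq_one_iff_eq hD).1 h1).symm

/-- The value is congruent to 1 + π modulo π², and |π|² < |π|. -/
theorem dwork_tsum_one_ne_one (hp2 : p ≠ 2) :
    (∑' n : ℕ, ((coeff n (dworkSeries p) : ℚ) : K) * (π * 1) ^ n) ≠ 1 := by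
  intro h
  have h2 := (dwork_tsum_spec hπ hp2 (t := 1) (by simp) (one_pow _)).2
  rw [h, mul_one, sub_add_cancel_left, norm_neg] at h2
  exact (pow_lt_self_of_lt_one₀ (norm_pi_pos hπ) (norm_pi_lt_one hπ) (by norm_num)).not_ge h2

end DworkConvergence

/-! ### The Teichmüller character and Dwork's additive character. -/

section DworkCharacter

theorem PadicComplexInt.norm_le_one {p : ℕ} [Fact p.Prime] (x : 𝓞_ℂ_[p]) : ‖(x : ℂ_[p])‖ ≤ 1 := by
  have h : Valued.v (x : ℂ_[p]) ≤ 1 := x.2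
  rw [PadicComplex.norm_eq_norm]
  have := (Valued.toNormedField.norm_le_one_iff (x := (x : ℂ_[p]))).2 h
  exact this

variable {p : ℕ} [hp : Fact p.Prime] {F : Type*} [Field F] (ι : WittVector p F →+* 𝓞_ℂ_[p])

/-- The Teichmüller character as a monoid homomorphism. -/
noncomputable def teichHom : F →*₀ ℂ_[p] where
  toFun := teichChar ι
  map_zero' := by simp [teichChar, WittVector.teichmuller_zero]
  map_one' := by simp [teichChar]
  map_mul' x y := by simp [teichChar]

theorem teichHom_apply (x : F) : teichHom ι x = teichChar ι x := rfl

/-- If x ≠ 1, the Witt vector [x] - 1 has nonzero first component, so it is a unit and ι cannot send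
it to 0. No injectivity of ι has to be assumed. -/
theorem teichHom_injective [CharP F p] : Function.Injective (teichHom ι) := by
  have key : ∀ x : F, teichHom ι x = 1 → x = 1 := by
    intro x hx
    by_contra hne
    have hu : IsUnit (WittVector.teichmuller p x - 1) := by
      apply WittVector.isUnit_of_coeff_zero_ne_zero
      have : (WittVector.teichmuller p x - 1).coeff 0 = x - 1 := by
        have h := map_sub (WittVector.constantCoeff (p := p) (R := F)) (WittVector.teichmuller p x) 1
        rw [map_one] at h
        simpa [WittVector.constantCoeff_apply] using h
      rw [this]
      exact sub_ne_zero.2 hne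
    have h2 : ι (WittVector.teichmuller p x - 1) = 0 := by
      rw [map_sub, map_one, sub_eq_zero]
      exact Subtype.ext hx
    exact (hu.map ι).ne_zero h2
  intro x y hxy
  rcases eq_or_ne y 0 with rfl | hy
  · rw [map_zero] at hxy
    exact (map_eq_zero _).1 hxy
  · have h1 : teichHom ι (x / y) = 1 := by
      rw [map_div₀, hxy, div_self]
      exact (map_ne_zero _).2 hy
    exact (div_eq_one_iff_eq hy).1 (key _ h1)

theorem norm_teichChar_le (x : F) : ‖teichChar ι x‖ ≤ 1 := PadicComplexInt.norm_le_one _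

/-- The Witt vector [x + y] - [x] - [y] has first component 0, so over the perfect field `F` it is a
multiple of p. -/
theorem norm_teichChar_add_le [Finite F] [CharP F p] (x y : F) :
    ‖teichChar ι (x + y) - (teichChar ι x + teichChar ι y)‖ ≤ ‖(p : ℂ_[p])‖ := by
  have h : WittVector.teichmuller p (x + y)
      - (WittVector.teichmuller p x + WittVector.teichmuller p y) ∈
        Ideal.span {(p : WittVector p F)} := by
    rw [WittVector.mem_span_p_iff_coeff_zero_eq_zero]
    rw [← WittVector.constantCoeff_apply]
    rw [map_sub, map_add WittVector.constantCoeff]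
    simp [WittVector.constantCoeff_apply]
  obtain ⟨z, hz⟩ := Ideal.mem_span_singleton'.1 h
  have h2 := congrArg (fun w => ((ι w : 𝓞_ℂ_[p]) : ℂ_[p])) hz
  simp only [map_sub, map_add, map_mul, map_natCast] at h2
  have h3 : teichChar ι (x + y) - (teichChar ι x + teichChar ι y) = (ι z : ℂ_[p]) * p := by
    rw [teichChar, teichChar, teichChar]
    push_cast at h2
    exact h2.symm
  rw [h3, norm_mul]
  exact mul_le_of_le_one_left (norm_nonneg _) (PadicComplexInt.norm_le_one _)

variable [Fintype F] {s : ℕ} {π : ℂ_[p]} (hp2 : p ≠ 2) (hF : Fintype.card F = p ^ s)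
  (hπ : π ^ (p - 1) = -(p : ℂ_[p]))

include hF in
theorem sum_pow_eq_algebraMap_trace [CharP F p] [Algebra (ZMod p) F] (x : F) :
    ∑ j ∈ Finset.range s, x ^ p ^ j = algebraMap (ZMod p) F (Algebra.trace (ZMod p) F x) := by
  have hfin : Module.finrank (ZMod p) F = s := by
    have h := Module.card_eq_pow_finrank (K := ZMod p) (V := F)
    rw [hF, ZMod.card] at h
    exact (Nat.pow_right_injective hp.out.two_le h).symm
  rw [FiniteField.algebraMap_trace_eq_sum_pow, hfin, Nat.card_eq_fintype_card, ZMod.card]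

/-- Dwork's additive character as an `AddChar`. -/
noncomputable def dworkAddChar [CharP F p] : AddChar F ℂ_[p] where
  toFun := dworkChar s π ι
  map_zero_eq_one' := by
    have h := (dwork_tsum_spec hπ hp2 (t := 0) (by simp) (zero_pow hp.out.ne_zero)).2
    have : ∑ j ∈ Finset.range s, (0 : F) ^ p ^ j = 0 :=
      Finset.sum_eq_zero fun j _ => zero_pow (pow_pos hp.out.pos j).ne'
    rw [dworkChar, this, ← teichHom_apply, map_zero, mul_zero, dworkEval,
      tsum_eq_single 0 (fun n hn => by rw [zero_pow hn, mul_zero]), pow_zero, mul_one,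
      PowerSeries.coeff_zero_eq_constantCoeff_apply, dworkSeries_eq_mul p hp.out.ne_zero, map_mul,
      PowerSeries.constantCoeff_expand, PowerSeries.constantCoeff_exp,
      ← PowerSeries.coeff_zero_eq_constantCoeff_apply, PowerSeries.coeff_rescale]
    simp
  map_add_eq_mul' x y := by
    let _ := ZMod.algebra F p
    -- The trace takes values in the prime field, whose Teichmüller representatives satisfy t^p = t.
    -- These are the points where the series takes p-th roots of unity as values.
    have hT : ∀ a : ZMod p, teichChar ι (algebraMap (ZMod p) F a) ^ p =
        teichChar ι (algebraMap (ZMod p) F a) := fun a => by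
      rw [← teichHom_apply, ← map_pow, ← map_pow, ZMod.pow_card]
    simp only [dworkChar, sum_pow_eq_algebraMap_trace hF, dworkEval]
    refine dwork_tsum_add hπ hp2 (norm_teichChar_le ι _) (norm_teichChar_le ι _)
      (norm_teichChar_le ι _) (hT _) (hT _) (hT _) ?_
    rw [map_add, map_add]
    exact norm_teichChar_add_le ι _ _

theorem dworkAddChar_apply [CharP F p] (x : F) :
    dworkAddChar ι hp2 hF hπ x = dworkChar s π ι x := rfl

/-- The trace is not identically zero, so a multiple of some b has trace 1, and there the character
takes the value of Dwork's series at π, which is not 1. -/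
theorem dworkAddChar_ne_one [CharP F p] : dworkAddChar ι hp2 hF hπ ≠ 1 := by
  let _ := ZMod.algebra F p
  obtain ⟨b, hb⟩ : ∃ b : F, Algebra.trace (ZMod p) F b ≠ 0 := by
    have htr := (traceForm_nondegenerate (ZMod p) F).1 1
    simp_rw [Algebra.traceForm_apply, one_mul] at htr
    by_contra! hf
    exact one_ne_zero (htr hf)
  intro h
  have h1 := DFunLike.congr_fun h ((Algebra.trace (ZMod p) F b)⁻¹ • b)
  rw [dworkAddChar_apply, dworkChar, sum_pow_eq_algebraMap_trace hF, map_smul, smul_eq_mul,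
    inv_mul_cancel₀ hb, map_one, ← teichHom_apply, map_one, AddChar.one_apply] at h1
  exact dwork_tsum_one_ne_one hπ hp2 h1

end DworkCharacter

/-! ### Gauss sums and Fourier expansion over the multiplicative group -/

section GaussFourier

variable {F : Type*} [Field F] [Fintype F] [DecidableEq F] {K : Type*} [Field K]
  {M : ℕ} [NeZero M]

/-- The character `x ↦ τ(x)ⁿ` of `Fˣ`, with `n` modulo `M = |Fˣ|`. -/
noncomputable def torusChar (τ : F →*₀ K) (n : ZMod M) (x : Fˣ) : K := τ x ^ n.val

/-- The Gauss sum `∑ θ(x) τ(x)ⁿ`, with `n` modulo `M = |Fˣ|`. -/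
noncomputable def gaussZ (θ : AddChar F K) (τ : F →*₀ K) (n : ZMod M) : K :=
  ∑ x : Fˣ, θ x * torusChar τ n x

variable (hM : Fintype.card Fˣ = M) (θ : AddChar F K) (τ : F →*₀ K)

omit [Fintype F] [DecidableEq F] [NeZero M] in
theorem map_unit_ne_zero (x : Fˣ) : τ x ≠ 0 := (map_ne_zero τ).2 x.ne_zero

omit [Fintype F] [DecidableEq F] [NeZero M] in
theorem torusChar_prod {κ : Type*} (s : Finset κ) (n : ZMod M) (x : κ → Fˣ) :
    torusChar τ n (∏ j ∈ s, x j) = ∏ j ∈ s, torusChar τ n (x j) := by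
  simp [torusChar, Finset.prod_pow]

section
include hM

omit [NeZero M] in
theorem map_unit_pow_card (x : Fˣ) : τ x ^ M = 1 := by
  rw [← map_pow, ← Units.val_pow_eq_pow_val, ← hM, pow_card_eq_one]
  simp

theorem torusChar_intCast (k : ℤ) (x : Fˣ) : torusChar τ (k : ZMod M) x = τ x ^ k := by
  rw [torusChar, ← zpow_natCast, ZMod.val_intCast]
  conv_rhs => rw [← Int.emod_add_mul_ediv k M]
  rw [zpow_add₀ (map_unit_ne_zero τ x), zpow_mul, zpow_natCast, map_unit_pow_card hM, one_zpow,
    mul_one]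

theorem torusChar_natCast (k : ℕ) (x : Fˣ) : torusChar τ (k : ZMod M) x = τ x ^ k := by
  have := torusChar_intCast hM τ k x
  simpa using this

theorem torusChar_add (m n : ZMod M) (x : Fˣ) :
    torusChar τ (m + n) x = torusChar τ m x * torusChar τ n x := by
  obtain ⟨a, rfl⟩ := ZMod.intCast_surjective m
  obtain ⟨b, rfl⟩ := ZMod.intCast_surjective n
  rw [← Int.cast_add, torusChar_intCast hM, torusChar_intCast hM, torusChar_intCast hM,
    zpow_add₀ (map_unit_ne_zero τ x)]

omit [NeZero M] [Fintype F] [DecidableEq F] hM in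
theorem torusChar_mul (n : ZMod M) (x y : Fˣ) :
    torusChar τ n (x * y) = torusChar τ n x * torusChar τ n y := by
  simp [torusChar, mul_pow]

omit [NeZero M] [Fintype F] [DecidableEq F] hM in
theorem torusChar_zero (x : Fˣ) : torusChar τ (0 : ZMod M) x = 1 := by
  simp [torusChar]

omit [NeZero M] [Fintype F] [DecidableEq F] hM in
theorem torusChar_one (n : ZMod M) : torusChar τ n 1 = 1 := by
  simp [torusChar]

theorem torusChar_neg (n : ZMod M) (x : Fˣ) : torusChar τ (-n) x = (torusChar τ n x)⁻¹ := by
  apply eq_inv_of_mul_eq_one_left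
  rw [← torusChar_add hM, neg_add_cancel, torusChar_zero]

theorem torusChar_pow (n : ZMod M) (x : Fˣ) (k : ℕ) :
    torusChar τ n (x ^ k) = torusChar τ ((k : ZMod M) * n) x := by
  obtain ⟨a, rfl⟩ := ZMod.intCast_surjective n
  rw [torusChar_intCast hM, show ((k : ZMod M) * (a : ZMod M)) = ((k * a : ℤ) : ZMod M) by push_cast; rfl,
    torusChar_intCast hM, Units.val_pow_eq_pow_val, map_pow, ← zpow_natCast, ← zpow_mul]

theorem torusChar_sum {κ : Type*} (s : Finset κ) (n : κ → ZMod M) (x : Fˣ) :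
    torusChar τ (∑ j ∈ s, n j) x = ∏ j ∈ s, torusChar τ (n j) x := by
  classical
  induction s using Finset.induction_on with
  | empty => simp [torusChar_zero]
  | insert a s ha ih => rw [Finset.prod_insert ha, Finset.sum_insert ha, torusChar_add hM, ih]

theorem gaussZ_intCast (k : ℤ) : gaussZ θ τ (k : ZMod M) = ∑ x : Fˣ, θ x * τ x ^ k := by
  simp_rw [gaussZ, torusChar_intCast hM]

variable {τ} (hτ : Function.Injective τ)
include hτ

/-- Orthogonality: injectivity of τ gives τ(x) ≠ 1 for x ≠ 1, and translating the index by 1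
multiplies the sum by τ(x). -/
theorem sum_torusChar (x : Fˣ) :
    ∑ n : ZMod M, torusChar τ n x = if x = 1 then (M : K) else 0 := by
  split_ifs with h
  · simp [h, torusChar_one, ZMod.card]
  · have h1 : torusChar τ (1 : ZMod M) x ≠ 1 := by
      have := torusChar_natCast hM τ 1 x
      rw [Nat.cast_one, pow_one] at this
      rw [this, ← map_one τ]
      exact fun h' => h (Units.ext (hτ h'))
    have h2 : torusChar τ (1 : ZMod M) x * ∑ n : ZMod M, torusChar τ n x =
        ∑ n : ZMod M, torusChar τ n x := by
      rw [Finset.mul_sum]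
      refine Fintype.sum_equiv (Equiv.addLeft 1) _ _ fun n => ?_
      rw [Equiv.coe_addLeft, torusChar_add hM]
    have h3 : (torusChar τ (1 : ZMod M) x - 1) * ∑ n : ZMod M, torusChar τ n x = 0 := by
      rw [sub_mul, h2, one_mul, sub_self]
    exact (mul_eq_zero.1 h3).resolve_left (sub_ne_zero.2 h1)

theorem sum_units_torusChar (n : ZMod M) :
    ∑ x : Fˣ, torusChar τ n x = if n = 0 then (M : K) else 0 := by
  split_ifs with h
  · simp [h, torusChar_zero, hM]
  · obtain ⟨g, hg⟩ := IsCyclic.exists_generator (α := Fˣ)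
    have h1 : torusChar τ n g ≠ 1 := by
      intro h1
      rw [torusChar, ← map_pow, ← map_one τ, ← Units.val_pow_eq_pow_val, ← Units.val_one] at h1
      have h2 : g ^ n.val = 1 := Units.ext (hτ h1)
      have h3 := orderOf_dvd_of_pow_eq_one h2
      rw [orderOf_eq_card_of_forall_mem_zpowers hg, Nat.card_eq_fintype_card, hM] at h3
      have h4 := Nat.eq_zero_of_dvd_of_lt h3 (ZMod.val_lt n)
      exact h ((ZMod.val_eq_zero n).1 h4)
    have h2 : torusChar τ n g * ∑ x : Fˣ, torusChar τ n x = ∑ x : Fˣ, torusChar τ n x := by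
      rw [Finset.mul_sum]
      refine Fintype.sum_equiv (Equiv.mulLeft g) _ _ fun x => ?_
      rw [Equiv.coe_mulLeft, torusChar_mul]
    have h3 : (torusChar τ n g - 1) * ∑ x : Fˣ, torusChar τ n x = 0 := by
      rw [sub_mul, h2, one_mul, sub_self]
    exact (mul_eq_zero.1 h3).resolve_left (sub_ne_zero.2 h1)

/-- Fourier inversion: the additive character in terms of Gauss sums. -/
theorem sum_gaussZ_mul_torusChar (x : Fˣ) :
    ∑ n : ZMod M, gaussZ θ τ (-n) * torusChar τ n x = M * θ x := by
  simp_rw [gaussZ, Finset.sum_mul]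
  rw [Finset.sum_comm]
  have : ∀ y : Fˣ, ∑ n : ZMod M, θ y * torusChar τ (-n) y * torusChar τ n x =
      θ y * if y = x then (M : K) else 0 := by
    intro y
    have hif : (if y = x then (M : K) else 0) = if x * y⁻¹ = 1 then (M : K) else 0 :=
      if_congr (by rw [mul_inv_eq_one, eq_comm]) rfl rfl
    rw [hif, ← sum_torusChar hM hτ, Finset.mul_sum]
    refine Finset.sum_congr rfl fun n _ => ?_
    rw [torusChar_mul, torusChar_neg hM, mul_assoc, mul_comm (torusChar τ n y)⁻¹]
    congr 2
    simp [torusChar]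
  simp_rw [this]
  simp [mul_comm]

/-- Fourier expansion of a torus sum of products of values of the additive character at monomials. -/
theorem torus_sum_monomials {I J : Type*} [Fintype I] [DecidableEq I] [Fintype J]
    [DecidableEq J] (c : I → Fˣ) (B : I → J → ℕ) :
    (M : K) ^ Fintype.card I * ∑ x : J → Fˣ, ∏ i, θ ((c i * ∏ j, x j ^ B i j : Fˣ) : F) =
      (M : K) ^ Fintype.card J * ∑ n : I → ZMod M,
        if ∀ j, ∑ i, (B i j : ZMod M) * n i = 0 then
          ∏ i, gaussZ θ τ (-n i) * torusChar τ (n i) (c i) else 0 := by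
  -- Each factor is Fourier expanded; the coordinate x_j then occurs through the single character
  -- with index ∑ B i j n_i, and summing over x_j forces this index to vanish.
  have h1 : ∀ x : J → Fˣ, (M : K) ^ Fintype.card I * ∏ i, θ ((c i * ∏ j, x j ^ B i j : Fˣ) : F) =
      ∑ n : I → ZMod M, (∏ i, gaussZ θ τ (-n i) * torusChar τ (n i) (c i)) *
        ∏ j, torusChar τ (∑ i, (B i j : ZMod M) * n i) (x j) := by
    intro x
    rw [← Finset.card_univ, ← Finset.prod_const, ← Finset.prod_mul_distrib]
    simp_rw [← sum_gaussZ_mul_torusChar hM θ hτ]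
    rw [Finset.prod_univ_sum, Fintype.piFinset_univ]
    refine Finset.sum_congr rfl fun n _ => ?_
    simp_rw [torusChar_mul, torusChar_prod, torusChar_pow hM, torusChar_sum hM]
    rw [Finset.prod_comm (s := (Finset.univ : Finset J)), ← Finset.prod_mul_distrib]
    refine Finset.prod_congr rfl fun i _ => by ring
  rw [Finset.mul_sum]
  simp_rw [h1]
  rw [Finset.sum_comm, Finset.mul_sum]
  refine Finset.sum_congr rfl fun n _ => ?_
  rw [← Finset.mul_sum, ← Fintype.piFinset_univ, ← Finset.prod_univ_sum]
  simp_rw [sum_units_torusChar hM hτ]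
  split_ifs with h
  · rw [Finset.prod_congr rfl fun j _ => if_pos (h j), Finset.prod_const, Finset.card_univ, mul_comm]
  · push Not at h
    obtain ⟨j, hj⟩ := h
    rw [Finset.prod_eq_zero (Finset.mem_univ j) (if_neg hj), mul_zero, mul_zero]

end

end GaussFourier

/-! ### Rearrangement of finite sums. -/

section Sums

theorem Fintype.sum_fin_succ_fun {A R : Type*} [Fintype A] [AddCommMonoid R] {n : ℕ}
    (f : (Fin (n + 1) → A) → R) :
    ∑ x, f x = ∑ a, ∑ x : Fin n → A, f (Matrix.vecCons a x) := by
  rw [← Fintype.sum_prod_type']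
  exact (Fintype.sum_equiv (Fin.consEquiv fun _ => A) _ _ fun _ => rfl).symm

theorem Fintype.sum_fin_zero_fun {A R : Type*} [Fintype A] [AddCommMonoid R]
    (f : (Fin 0 → A) → R) : ∑ x, f x = f ![] := by
  rw [Fintype.sum_unique]
  exact congrArg f (Subsingleton.elim _ _)

theorem sum_eq_zero_add_sum_units {F R : Type*} [Field F] [Fintype F] [DecidableEq F]
    [AddCommMonoid R] (f : F → R) : ∑ x, f x = f 0 + ∑ x : Fˣ, f x := by
  rw [← Finset.add_sum_erase _ _ (Finset.mem_univ 0)]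
  congr 1
  refine (Finset.sum_bij (fun (x : Fˣ) _ => (x : F)) ?_ ?_ ?_ ?_).symm
  · simp
  · intro a _ b _ h; exact Units.ext h
  · intro b hb
    exact ⟨Units.mk0 b (Finset.ne_of_mem_erase hb), Finset.mem_univ _, rfl⟩
  · simp

/-- A function on `F ^ n` that vanishes where a coordinate vanishes is summed over the torus. -/
theorem sum_eq_sum_units_of_forall {F R J : Type*} [Field F] [Fintype F] [DecidableEq F]
    [Fintype J] [DecidableEq J] [AddCommMonoid R] (f : (J → F) → R)
    (hf : ∀ x, (∃ j, x j = 0) → f x = 0) : ∑ x, f x = ∑ x : J → Fˣ, f fun j => x j := by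
  have h := Finset.sum_image (s := (Finset.univ : Finset (J → Fˣ)))
    (g := fun x : J → Fˣ => fun j => (x j : F)) (f := f)
    (fun a _ b _ hab => funext fun j => Units.ext (congrFun hab j))
  rw [← h]
  refine (Finset.sum_subset (Finset.subset_univ _) fun x _ hx => hf x ?_).symm
  by_contra! hne
  exact hx (Finset.mem_image.2 ⟨fun j => Units.mk0 (x j) (hne j), Finset.mem_univ _, rfl⟩)

theorem ZMod.sum_eq_sum_range {M : ℕ} [NeZero M] {R : Type*} [AddCommMonoid R] (f : ZMod M → R) :
    ∑ n, f n = ∑ u ∈ Finset.range M, f u := by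
  refine Finset.sum_nbij' (fun n => n.val) (fun u => (u : ZMod M)) ?_ ?_ ?_ ?_ ?_
  · intro n _; exact Finset.mem_range.2 (ZMod.val_lt n)
  · intro u _; exact Finset.mem_univ _
  · intro n _; exact ZMod.natCast_zmod_val n
  · intro u hu; exact ZMod.val_cast_of_lt (Finset.mem_range.1 hu)
  · intro n _; rw [ZMod.natCast_zmod_val]

theorem Finset.sum_range_two_mul {R : Type*} [AddCommMonoid R] (f : ℕ → R) (m : ℕ) :
    ∑ r ∈ Finset.range (2 * m), f r = ∑ u ∈ Finset.range m, (f (2 * u) + f (2 * u + 1)) := by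
  induction m with
  | zero => simp
  | succ m ih =>
    rw [Finset.sum_range_succ, ← ih, show 2 * (m + 1) = 2 * m + 1 + 1 by ring,
      Finset.sum_range_succ, Finset.sum_range_succ, add_assoc]

/-- Summation over residues modulo an even number by parity. -/
theorem ZMod.sum_even_add_odd {M : ℕ} [NeZero M] (hM : Even M) {R : Type*} [CommRing R]
    (f : ZMod M → R) : ∑ u, (f (2 * u) + f (2 * u + 1)) = 2 * ∑ r, f r := by
  obtain ⟨m, hm⟩ := hM
  rw [ZMod.sum_eq_sum_range, ZMod.sum_eq_sum_range]
  rw [Finset.range_eq_Ico, ← Finset.sum_Ico_consecutive _ (Nat.zero_le m) (by omega : m ≤ M),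
    Finset.sum_Ico_eq_sum_range _ m M, ← Finset.range_eq_Ico, ← Finset.range_eq_Ico,
    show M - m = m by omega]
  -- Moving u by half the modulus does not change 2u, so the second half of the range repeats the
  -- first.
  have h2 : ∀ u : ℕ, (2 : ZMod M) * ((m + u : ℕ) : ZMod M) = 2 * (u : ZMod M) := by
    intro u
    have : ((m + m : ℕ) : ZMod M) = 0 := by rw [← hm]; exact ZMod.natCast_self M
    push_cast at this ⊢
    linear_combination this
  simp_rw [h2]
  have hr : Finset.range M = Finset.range (2 * m) := congrArg _ (by omega)
  rw [hr, Finset.sum_range_two_mul]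
  push_cast
  ring

theorem sum_prod_five {A R : Type*} [Fintype A] [CommSemiring R] (a b c d e : A → R) :
    ∑ N : A × A × A × A × A,
      a N.1 * b N.2.1 * (c N.2.2.1 * d N.2.2.2.1 * e N.2.2.2.2) =
    (∑ n, a n) * (∑ n, b n) * ((∑ n, c n) * (∑ n, d n) * ∑ n, e n) := by
  simp_rw [Fintype.sum_prod_type, mul_assoc, ← Finset.mul_sum, ← Finset.sum_mul]

end Sums

/-! ### Diagonal sums in terms of Gauss sums. -/

section OcticSums

variable {F : Type*} [Field F] [Fintype F] [DecidableEq F] {K : Type*} [Field K]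
  {M : ℕ} [NeZero M]

/-- The sum of `f₁(n₁) f₁(n₂) f₂(n₃) f₂(n₄) f₂(n₅)` over the residues modulo `M` with
`8 n₁ = 8 n₂ = 4 ρ`, `4 n₃ = 4 n₄ = 4 n₅ = 0` and `∑ nᵢ = ρ`. -/
def octicSum (ρ : ZMod M) (f₁ f₂ : ZMod M → K) : K :=
  ∑ N : ZMod M × ZMod M × ZMod M × ZMod M × ZMod M,
    if (8 * N.1 = 4 * ρ ∧ 8 * N.2.1 = 4 * ρ ∧ 4 * N.2.2.1 = 0 ∧ 4 * N.2.2.2.1 = 0 ∧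
      4 * N.2.2.2.2 = 0) ∧ N.1 + N.2.1 + N.2.2.1 + N.2.2.2.1 + N.2.2.2.2 = ρ then
      f₁ N.1 * f₁ N.2.1 * (f₂ N.2.2.1 * f₂ N.2.2.2.1 * f₂ N.2.2.2.2) else 0

variable (hM : Fintype.card Fˣ = M) (θ : AddChar F K) {τ : F →*₀ K} (hτ : Function.Injective τ)
include hM hτ

/-- The sum over `y` of a product of five character sums in which the `i`-th index is
subject to a condition. -/
theorem sum_units_prod_five (c r : ZMod M) (f₁ f₂ : ZMod M → K) :
    ∑ y : Fˣ, torusChar τ r y * ((∑ n, if 8 * n = c then f₁ n * torusChar τ n y else 0) ^ 2 *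
      (∑ n, if 4 * n = 0 then f₂ n * torusChar τ n y else 0) ^ 3) =
    M * ∑ N : ZMod M × ZMod M × ZMod M × ZMod M × ZMod M,
      if (8 * N.1 = c ∧ 8 * N.2.1 = c ∧ 4 * N.2.2.1 = 0 ∧ 4 * N.2.2.2.1 = 0 ∧
        4 * N.2.2.2.2 = 0) ∧ N.1 + N.2.1 + N.2.2.1 + N.2.2.2.1 + N.2.2.2.2 + r = 0 then
        f₁ N.1 * f₁ N.2.1 * (f₂ N.2.2.1 * f₂ N.2.2.2.1 * f₂ N.2.2.2.2) else 0 := by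
  simp_rw [pow_two, pow_succ, pow_zero, one_mul, ← sum_prod_five, Finset.mul_sum]
  rw [Finset.sum_comm]
  refine Finset.sum_congr rfl fun N _ => ?_
  obtain ⟨n₁, n₂, n₃, n₄, n₅⟩ := N
  by_cases h : 8 * n₁ = c ∧ 8 * n₂ = c ∧ 4 * n₃ = 0 ∧ 4 * n₄ = 0 ∧ 4 * n₅ = 0
  · obtain ⟨h1, h2, h3, h4, h5⟩ := h
    simp only [h1, h2, h3, h4, h5, if_true, and_self, true_and]
    have := sum_units_torusChar hM hτ (n₁ + n₂ + n₃ + n₄ + n₅ + r)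
    have h' : ∀ y : Fˣ, torusChar τ r y * (f₁ n₁ * torusChar τ n₁ y * (f₁ n₂ * torusChar τ n₂ y) *
        (f₂ n₃ * torusChar τ n₃ y * (f₂ n₄ * torusChar τ n₄ y) * (f₂ n₅ * torusChar τ n₅ y))) =
        (f₁ n₁ * f₁ n₂ * (f₂ n₃ * f₂ n₄ * f₂ n₅)) *
          torusChar τ (n₁ + n₂ + n₃ + n₄ + n₅ + r) y := fun y => by
      simp only [torusChar_add hM]
      ring
    simp_rw [h']
    rw [← Finset.mul_sum, this]
    split_ifs <;> ring
  · rw [if_neg (fun h' => h h'.1), mul_zero]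
    refine Finset.sum_eq_zero fun y _ => ?_
    simp only [not_and_or] at h
    rcases h with h | h | h | h | h <;> simp [h]

theorem sum_units_pow_mul_pow (f₁ f₂ : ZMod M → K) :
    ∑ y : Fˣ, (∑ n, if 8 * n = 0 then f₁ n * torusChar τ n y else 0) ^ 2 *
      (∑ n, if 4 * n = 0 then f₂ n * torusChar τ n y else 0) ^ 3 = M * octicSum 0 f₁ f₂ := by
  have h := sum_units_prod_five hM hτ 0 0 f₁ f₂
  simp only [torusChar_zero, one_mul, add_zero] at h
  rw [h, octicSum]
  simp only [mul_zero]

/-- After Fourier expansion, summing over x leaves only the characters whose d-th power is trivial.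
-/
theorem sum_units_addChar_pow [CharZero K] (d : ℕ) (y : Fˣ) :
    ∑ x : Fˣ, θ (y * (x : F) ^ d) =
      ∑ n : ZMod M, if d * n = 0 then gaussZ θ τ (-n) * torusChar τ n y else 0 := by
  have hM0 : (M : K) ≠ 0 := by exact_mod_cast NeZero.ne M
  apply mul_left_cancel₀ hM0
  rw [Finset.mul_sum, Finset.mul_sum]
  have h : ∀ x : Fˣ, (M : K) * θ (y * (x : F) ^ d) =
      ∑ n : ZMod M, gaussZ θ τ (-n) * torusChar τ n y * torusChar τ ((d : ZMod M) * n) x := fun x => by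
    have := sum_gaussZ_mul_torusChar hM θ hτ (y * x ^ d)
    push_cast at this
    rw [← this]
    refine Finset.sum_congr rfl fun n _ => ?_
    rw [torusChar_mul, torusChar_pow hM, mul_assoc]
  simp_rw [h]
  rw [Finset.sum_comm]
  refine Finset.sum_congr rfl fun n _ => ?_
  rw [← Finset.mul_sum, sum_units_torusChar hM hτ]
  split_ifs <;> ring

omit hτ [NeZero M] hM in
theorem gaussZ_zero (hθ : θ ≠ 1) : gaussZ θ τ (0 : ZMod M) = -1 := by
  have h := AddChar.sum_eq_zero_of_ne_one hθ
  rw [sum_eq_zero_add_sum_units, AddChar.map_zero_eq_one] at h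
  simp only [gaussZ, torusChar_zero, mul_one]
  linear_combination h

/-- The point x = 0 contributes 1, and the trivial character contributes G₀ = -1; they cancel.
Passing from nonzero x to all x is thus the same as deleting n = 0, the origin of the divisibility
conditions in the final formulas. -/
theorem sum_addChar_pow [CharZero K] (hθ : θ ≠ 1) {d : ℕ} (hd : d ≠ 0) (y : Fˣ) :
    ∑ x : F, θ (y * x ^ d) =
      ∑ n : ZMod M, if d * n = 0 then
        (if n = 0 then 0 else gaussZ θ τ (-n)) * torusChar τ n y else 0 := by
  rw [sum_eq_zero_add_sum_units, sum_units_addChar_pow hM θ hτ, zero_pow hd, mul_zero,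
    AddChar.map_zero_eq_one, ← Finset.add_sum_erase _ _ (Finset.mem_univ 0),
    ← Finset.add_sum_erase _ _ (Finset.mem_univ 0)]
  simp only [mul_zero, if_true, neg_zero, gaussZ_zero θ hθ, torusChar_zero]
  rw [mul_one, add_neg_cancel_left, zero_mul, zero_add]
  refine Finset.sum_congr rfl fun n hn => ?_
  rw [if_neg (Finset.ne_of_mem_erase hn)]

end OcticSums

/-! ### The binary form with its mixed term. -/

section OcticSums

variable {F : Type*} [Field F] [Fintype F] [DecidableEq F] {K : Type*} [Field K]
  {M : ℕ} [NeZero M]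

/-- The sum over the torus of `θ(y (x₁⁸ + x₂⁸ + a x₁⁴ x₂⁴))`. -/
noncomputable def binaryUnitSum (θ : AddChar F K) (a y : F) : K :=
  ∑ x : Fin 2 → Fˣ, θ (y * ((x 0 : F) ^ 8 + (x 1 : F) ^ 8 + a * (x 0 : F) ^ 4 * (x 1 : F) ^ 4))

variable (hM : Fintype.card Fˣ = M) (θ : AddChar F K) {τ : F →*₀ K} (hτ : Function.Injective τ)
  [CharZero K]
include hM hτ

/-- The three monomials get exponents n₁, n₂, r, and the sums over x₁ and x₂ impose 8nᵢ + 4r = 0.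
For fixed r the variables n₁ and n₂ are independent, which produces the square. -/
theorem binaryUnitSum_eq (a y : Fˣ) :
    (M : K) * binaryUnitSum θ a y = ∑ r : ZMod M, gaussZ θ τ (-r) * torusChar τ r a *
      (torusChar τ r y * (∑ n : ZMod M, if 8 * n = -(4 * r) then
        gaussZ θ τ (-n) * torusChar τ n y else 0) ^ 2) := by
  have hM0 : (M : K) ≠ 0 := by exact_mod_cast NeZero.ne M
  have h := torus_sum_monomials hM θ hτ (I := Fin 3) (J := Fin 2) ![y, y, y * a]
    ![![8, 0], ![0, 8], ![4, 4]]
  simp only [Fintype.card_fin, Fin.prod_univ_succ, Fin.sum_univ_succ, Fintype.sum_fin_succ_fun,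
    Fintype.sum_fin_zero_fun, Fin.forall_fin_succ] at h
  simp [torusChar_mul] at h
  have h1 : (M : K) ^ 2 * (M * binaryUnitSum θ a y) = (M : K) ^ 2 *
      ∑ n₁ : ZMod M, ∑ n₂ : ZMod M, ∑ r : ZMod M, if 8 * n₁ + 4 * r = 0 ∧ 8 * n₂ + 4 * r = 0 then
      gaussZ θ τ (-n₁) * torusChar τ n₁ y * (gaussZ θ τ (-n₂) * torusChar τ n₂ y *
        (gaussZ θ τ (-r) * (torusChar τ r y * torusChar τ r a))) else 0 := by
    rw [← h, binaryUnitSum, Fintype.sum_fin_succ_fun, ← mul_assoc, ← pow_succ]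
    congr 1
    refine Finset.sum_congr rfl fun x _ => ?_
    rw [Fintype.sum_fin_succ_fun]
    refine Finset.sum_congr rfl fun x' _ => ?_
    rw [Fintype.sum_fin_zero_fun]
    simp only [← AddChar.map_add_eq_mul, Matrix.cons_val_zero, Matrix.cons_val_one]
    congr 1
    ring
  rw [mul_left_cancel₀ (pow_ne_zero 2 hM0) h1]
  rw [Finset.sum_congr rfl fun n₁ _ => Finset.sum_comm, Finset.sum_comm]
  simp_rw [sq, Finset.sum_mul_sum, Finset.mul_sum]
  refine Finset.sum_congr rfl fun r _ => Finset.sum_congr rfl fun n₁ _ =>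
    Finset.sum_congr rfl fun n₂ _ => ?_
  simp only [← eq_neg_iff_add_eq_zero, ite_and]
  split_ifs <;> ring

/-- Put r = -2u or r = -(2u + 1) and shift n₁, n₂ by u: the condition 8n = -4r becomes 8n = 0 or 8n
= 4. Doubling is two-to-one because M is even, hence the factor 2. -/
theorem sum_binaryUnitSum_mul (hMe : Even M) (a : Fˣ) (f₂ : ZMod M → K) :
    2 * ∑ y : Fˣ, binaryUnitSum θ a y *
      (∑ n, if 4 * n = 0 then f₂ n * torusChar τ n y else 0) ^ 3 =
    ∑ u : ZMod M, (gaussZ θ τ (2 * u) * torusChar τ (-(2 * u)) a *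
        octicSum 0 (fun n => gaussZ θ τ (-(n + u))) f₂ +
      gaussZ θ τ (2 * u + 1) * torusChar τ (-(2 * u + 1)) a *
        octicSum 1 (fun n => gaussZ θ τ (-(n + u))) f₂) := by
  have hM0 : (M : K) ≠ 0 := by exact_mod_cast NeZero.ne M
  set H : ZMod M → K := fun r => gaussZ θ τ (-r) * torusChar τ r a *
    ∑ N : ZMod M × ZMod M × ZMod M × ZMod M × ZMod M,
      if (8 * N.1 = -(4 * r) ∧ 8 * N.2.1 = -(4 * r) ∧ 4 * N.2.2.1 = 0 ∧ 4 * N.2.2.2.1 = 0 ∧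
        4 * N.2.2.2.2 = 0) ∧ N.1 + N.2.1 + N.2.2.1 + N.2.2.2.1 + N.2.2.2.2 + r = 0 then
        gaussZ θ τ (-N.1) * gaussZ θ τ (-N.2.1) *
          (f₂ N.2.2.1 * f₂ N.2.2.2.1 * f₂ N.2.2.2.2) else 0 with hH
  have h1 : ∑ y : Fˣ, binaryUnitSum θ a y *
      (∑ n, if 4 * n = 0 then f₂ n * torusChar τ n y else 0) ^ 3 = ∑ r, H r := by
    apply mul_left_cancel₀ hM0
    rw [Finset.mul_sum]
    simp_rw [← mul_assoc, binaryUnitSum_eq hM θ hτ, Finset.sum_mul]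
    rw [Finset.sum_comm, Finset.mul_sum]
    refine Finset.sum_congr rfl fun r _ => ?_
    have h := sum_units_prod_five hM hτ (-(4 * r)) r (fun n => gaussZ θ τ (-n)) f₂
    rw [hH]
    simp only
    rw [mul_left_comm, ← h, Finset.mul_sum]
    refine Finset.sum_congr rfl fun y _ => by ring
  -- Negating r first makes the Gauss sums appear with the indices 2u and 2u + 1.
  rw [h1, ← Equiv.sum_comp (Equiv.neg (ZMod M)) H,
    ← ZMod.sum_even_add_odd hMe fun s => H (Equiv.neg (ZMod M) s)]
  refine Finset.sum_congr rfl fun u _ => ?_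
  simp only [Equiv.neg_apply, hH, neg_neg]
  congr 2
  · rw [octicSum]
    refine (Fintype.sum_equiv ((Equiv.addRight u).prodCongr
      ((Equiv.addRight u).prodCongr (Equiv.refl _))) _ _ fun N => ?_).symm
    refine if_congr ?_ rfl rfl
    simp only [Equiv.prodCongr_apply, Prod.map_fst, Prod.map_snd, Equiv.coe_addRight,
      Equiv.coe_refl, id_eq]
    refine and_congr (and_congr ?_ (and_congr ?_ Iff.rfl)) ?_ <;>
    · rw [← sub_eq_zero, iff_comm, ← sub_eq_zero]
      exact iff_of_eq (congrArg (· = 0) (by ring))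
  · rw [octicSum]
    refine (Fintype.sum_equiv ((Equiv.addRight u).prodCongr
      ((Equiv.addRight u).prodCongr (Equiv.refl _))) _ _ fun N => ?_).symm
    refine if_congr ?_ rfl rfl
    simp only [Equiv.prodCongr_apply, Prod.map_fst, Prod.map_snd, Equiv.coe_addRight,
      Equiv.coe_refl, id_eq]
    refine and_congr (and_congr ?_ (and_congr ?_ Iff.rfl)) ?_ <;>
    · rw [← sub_eq_zero, iff_comm, ← sub_eq_zero]
      exact iff_of_eq (congrArg (· = 0) (by ring))

end OcticSums

/-! ### The part of the sum with all coordinates nonzero. -/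

section TorusSums

variable {F : Type*} [Field F] [Fintype F] [DecidableEq F] {K : Type*} [Field K]
  {M : ℕ} [NeZero M]

/-- The part of the sum `∑ θ(y P(x₁, …, x₅, 1))` with all variables non-zero. -/
noncomputable def octicTorusSum (θ : AddChar F K) (φ ψ : F) : K :=
  ∑ y : Fˣ, ∑ x : Fin 5 → Fˣ, θ (y * octicPoly φ ψ ![x 0, x 1, x 2, x 3, x 4, 1])

variable (hM : Fintype.card Fˣ = M) (θ : AddChar F K) {τ : F →*₀ K} (hτ : Function.Injective τ)
  [CharZero K]
include hM hτ

/-- The rows of B are the six monomials of yP and its columns the six variables y, x₁, …, x₅. The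
numbers being equal, the powers of M cancel. -/
theorem octicTorusSum_zero_eq (ψ : F) (b : Fˣ) (hb : -(8 * ψ) = b) :
    octicTorusSum θ 0 ψ =
      ∑ n₁ : ZMod M, ∑ n₂ : ZMod M, ∑ n₃ : ZMod M, ∑ n₄ : ZMod M, ∑ n₅ : ZMod M, ∑ t : ZMod M,
        if (8 * n₁ + t = 0 ∧ 8 * n₂ + t = 0 ∧ 4 * n₃ + t = 0 ∧ 4 * n₄ + t = 0 ∧ 4 * n₅ + t = 0) ∧
          n₁ + n₂ + n₃ + n₄ + n₅ + t = 0 then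
        gaussZ θ τ (-n₁) * gaussZ θ τ (-n₂) *
          (gaussZ θ τ (-n₃) * gaussZ θ τ (-n₄) * gaussZ θ τ (-n₅)) *
          (gaussZ θ τ (-t) * torusChar τ t b) else 0 := by
  have hM0 : (M : K) ≠ 0 := by exact_mod_cast NeZero.ne M
  set B : Fin 6 → Fin 6 → ℕ := ![![1, 8, 0, 0, 0, 0], ![1, 0, 8, 0, 0, 0], ![1, 0, 0, 4, 0, 0],
    ![1, 0, 0, 0, 4, 0], ![1, 0, 0, 0, 0, 4], ![1, 1, 1, 1, 1, 1]] with hB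
  have h := mul_left_cancel₀ (pow_ne_zero _ hM0)
    (torus_sum_monomials hM θ hτ (I := Fin 6) (J := Fin 6) ![1, 1, 1, 1, 1, b] B)
  have hL : ∀ x : Fin 6 → Fˣ, ∏ i, θ (((![1, 1, 1, 1, 1, b] : Fin 6 → Fˣ) i * ∏ j, x j ^ B i j : Fˣ) : F) =
      θ (x 0 * octicPoly 0 ψ ![x 1, x 2, x 3, x 4, x 5, 1]) := by
    intro x
    simp only [Fin.prod_univ_six, ← AddChar.map_add_eq_mul, hB, octicPoly]
    simp [← hb]
    congr 1
    ring
  have hR : ∀ n : Fin 6 → ZMod M, (∀ j, ∑ i, (B i j : ZMod M) * n i = 0) ↔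
      (8 * n 0 + n 5 = 0 ∧ 8 * n 1 + n 5 = 0 ∧ 4 * n 2 + n 5 = 0 ∧ 4 * n 3 + n 5 = 0 ∧
        4 * n 4 + n 5 = 0) ∧ n 0 + n 1 + n 2 + n 3 + n 4 + n 5 = 0 := by
    intro n
    simp [Fin.forall_fin_succ, Fin.sum_univ_six, hB]
    tauto
  simp_rw [hL, hR] at h
  have e : octicTorusSum θ 0 ψ =
      ∑ x : Fin 6 → Fˣ, θ (x 0 * octicPoly 0 ψ ![x 1, x 2, x 3, x 4, x 5, 1]) := by
    rw [Fintype.sum_fin_succ_fun]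
    rfl
  rw [e, h]
  simp only [Fintype.sum_fin_succ_fun, Fintype.sum_fin_zero_fun]
  refine Finset.sum_congr rfl fun n₁ _ => Finset.sum_congr rfl fun n₂ _ =>
    Finset.sum_congr rfl fun n₃ _ => Finset.sum_congr rfl fun n₄ _ =>
    Finset.sum_congr rfl fun n₅ _ => Finset.sum_congr rfl fun t _ => if_congr Iff.rfl ?_ rfl
  simp only [Fin.prod_univ_six]
  simp [torusChar_one, -mul_eq_mul_right_iff, -mul_eq_mul_left_iff]
  ring

/-- Now there are seven monomials in six variables, which leaves one factor M on the left and one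
more free parameter in the exponents. -/
theorem octicTorusSum_eq (φ ψ : F) (a b : Fˣ) (ha : -(2 * φ) = a) (hb : -(8 * ψ) = b) :
    (M : K) * octicTorusSum θ φ ψ =
      ∑ n₁ : ZMod M, ∑ n₂ : ZMod M, ∑ n₃ : ZMod M, ∑ n₄ : ZMod M, ∑ n₅ : ZMod M,
        ∑ r : ZMod M, ∑ t : ZMod M,
        if (8 * n₁ + 4 * r + t = 0 ∧ 8 * n₂ + 4 * r + t = 0 ∧ 4 * n₃ + t = 0 ∧ 4 * n₄ + t = 0 ∧
          4 * n₅ + t = 0) ∧ n₁ + n₂ + n₃ + n₄ + n₅ + r + t = 0 then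
        gaussZ θ τ (-n₁) * gaussZ θ τ (-n₂) *
          (gaussZ θ τ (-n₃) * gaussZ θ τ (-n₄) * gaussZ θ τ (-n₅)) *
          (gaussZ θ τ (-r) * torusChar τ r a * (gaussZ θ τ (-t) * torusChar τ t b)) else 0 := by
  have hM0 : (M : K) ≠ 0 := by exact_mod_cast NeZero.ne M
  set B : Fin 7 → Fin 6 → ℕ := ![![1, 8, 0, 0, 0, 0], ![1, 0, 8, 0, 0, 0], ![1, 0, 0, 4, 0, 0],
    ![1, 0, 0, 0, 4, 0], ![1, 0, 0, 0, 0, 4], ![1, 4, 4, 0, 0, 0], ![1, 1, 1, 1, 1, 1]] with hB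
  have h := torus_sum_monomials hM θ hτ (I := Fin 7) (J := Fin 6) ![1, 1, 1, 1, 1, a, b] B
  have hL : ∀ x : Fin 6 → Fˣ,
      ∏ i, θ (((![1, 1, 1, 1, 1, a, b] : Fin 7 → Fˣ) i * ∏ j, x j ^ B i j : Fˣ) : F) =
      θ (x 0 * octicPoly φ ψ ![x 1, x 2, x 3, x 4, x 5, 1]) := by
    intro x
    simp only [Fin.prod_univ_six, Fin.prod_univ_seven, ← AddChar.map_add_eq_mul, hB, octicPoly]
    simp [← hb, ← ha]
    congr 1
    ring
  have hR : ∀ n : Fin 7 → ZMod M, (∀ j, ∑ i, (B i j : ZMod M) * n i = 0) ↔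
      (8 * n 0 + 4 * n 5 + n 6 = 0 ∧ 8 * n 1 + 4 * n 5 + n 6 = 0 ∧ 4 * n 2 + n 6 = 0 ∧
        4 * n 3 + n 6 = 0 ∧ 4 * n 4 + n 6 = 0) ∧
        n 0 + n 1 + n 2 + n 3 + n 4 + n 5 + n 6 = 0 := by
    intro n
    simp [Fin.forall_fin_succ, Fin.sum_univ_seven, hB]
    tauto
  simp_rw [hL, hR] at h
  have e : octicTorusSum θ φ ψ =
      ∑ x : Fin 6 → Fˣ, θ (x 0 * octicPoly φ ψ ![x 1, x 2, x 3, x 4, x 5, 1]) := by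
    rw [Fintype.sum_fin_succ_fun]
    rfl
  rw [Fintype.card_fin, Fintype.card_fin, pow_succ, mul_assoc] at h
  rw [e, mul_left_cancel₀ (pow_ne_zero _ hM0) h]
  simp only [Fintype.sum_fin_succ_fun, Fintype.sum_fin_zero_fun]
  refine Finset.sum_congr rfl fun n₁ _ => Finset.sum_congr rfl fun n₂ _ =>
    Finset.sum_congr rfl fun n₃ _ => Finset.sum_congr rfl fun n₄ _ =>
    Finset.sum_congr rfl fun n₅ _ => Finset.sum_congr rfl fun r _ =>
    Finset.sum_congr rfl fun t _ => if_congr Iff.rfl ?_ rfl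
  simp only [Fin.prod_univ_seven]
  simp [torusChar_one, -mul_eq_mul_right_iff, -mul_eq_mul_left_iff]
  ring

end TorusSums

/-! ### Parametrization of the exponent vectors. -/

section TorusSums

variable {K : Type*} [Field K] {M : ℕ} [NeZero M]

/-- Shifting the five indices turns the torsion conditions into congruences depending on u and t, in
the form in which they occur in the torus sums. -/
theorem octicSum_add (u t : ZMod M) (f₁ f₂ : ZMod M → K) :
    octicSum 0 (fun n => f₁ (n + u)) (fun n => f₂ (n + t)) =
      ∑ N : ZMod M × ZMod M × ZMod M × ZMod M × ZMod M,
        if (8 * N.1 = 8 * u ∧ 8 * N.2.1 = 8 * u ∧ 4 * N.2.2.1 = 4 * t ∧ 4 * N.2.2.2.1 = 4 * t ∧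
          4 * N.2.2.2.2 = 4 * t) ∧
          N.1 + N.2.1 + N.2.2.1 + N.2.2.2.1 + N.2.2.2.2 = 2 * u + 3 * t then
          f₁ N.1 * f₁ N.2.1 * (f₂ N.2.2.1 * f₂ N.2.2.2.1 * f₂ N.2.2.2.2) else 0 := by
  rw [octicSum]
  refine Fintype.sum_equiv ((Equiv.addRight u).prodCongr ((Equiv.addRight u).prodCongr
    ((Equiv.addRight t).prodCongr ((Equiv.addRight t).prodCongr (Equiv.addRight t))))) _ _
    fun N => ?_
  refine if_congr ?_ rfl rfl
  simp only [Equiv.prodCongr_apply, Prod.map_fst, Prod.map_snd, Equiv.coe_addRight]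
  refine and_congr (and_congr ?_ (and_congr ?_ (and_congr ?_ (and_congr ?_ ?_)))) ?_ <;>
  · rw [← sub_eq_zero, iff_comm, ← sub_eq_zero]
    exact iff_of_eq (congrArg (· = 0) (by ring))

/-- The number of residues `w` modulo `M` with `8 w = 0`. -/
def torsionEight (M : ℕ) [NeZero M] : ℕ := (Finset.univ.filter fun w : ZMod M => 8 * w = 0).card

theorem sum_ite_eight_mul_eq (n : ZMod M) :
    ∑ w : ZMod M, (if 8 * n = 8 * w then (1 : K) else 0) = torsionEight M := by
  rw [torsionEight, Finset.card_filter]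
  push_cast
  refine Fintype.sum_equiv (Equiv.subRight n) _ _ fun w => if_congr ?_ rfl rfl
  rw [Equiv.subRight_apply, mul_sub, sub_eq_zero, eq_comm]

variable {F : Type*} [Field F] [Fintype F] [DecidableEq F]
  (hM : Fintype.card Fˣ = M) (θ : AddChar F K) {τ : F →*₀ K} (hτ : Function.Injective τ)
  [CharZero K]
include hM hτ

/-- The exponent of the ψ-monomial is t = -8n₁. Choosing w with 8w = 8n₁ puts every solution in the
form: 8-torsion plus w, 4-torsion plus 2w. Each solution is met once for each such w, and their
number is `torsionEight M`. -/
theorem torsionEight_mul_octicTorusSum_zero (ψ : F) (b : Fˣ) (hb : -(8 * ψ) = b) :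
    torsionEight M * octicTorusSum θ 0 ψ = ∑ w : ZMod M,
      gaussZ θ τ (8 * w) * torusChar τ (-(8 * w)) b *
        octicSum 0 (fun n => gaussZ θ τ (-(n + w))) (fun n => gaussZ θ τ (-(n + 2 * w))) := by
  rw [octicTorusSum_zero_eq hM θ hτ ψ b hb]
  simp_rw [octicSum_add _ _ (fun n => gaussZ θ τ (-n)) (fun n => gaussZ θ τ (-n)),
    ← Fintype.sum_prod_type']
  rw [Finset.mul_sum]
  simp_rw [Finset.mul_sum]
  rw [Finset.sum_comm]
  simp_rw [Fintype.sum_prod_type]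
  refine Finset.sum_congr rfl fun n₁ _ => Finset.sum_congr rfl fun n₂ _ =>
    Finset.sum_congr rfl fun n₃ _ => Finset.sum_congr rfl fun n₄ _ =>
    Finset.sum_congr rfl fun n₅ _ => ?_
  rw [← Finset.mul_sum, Fintype.sum_eq_single (-(8 * n₁)), ← sum_ite_eight_mul_eq n₁,
    Finset.sum_mul]
  · refine Finset.sum_congr rfl fun w _ => ?_
    by_cases h : 8 * n₁ = 8 * w
    · rw [if_pos h, one_mul, h, mul_ite, mul_zero]
      refine if_congr ?_ ?_ rfl
      · refine and_congr (and_congr ?_ (and_congr ?_ (and_congr ?_ (and_congr ?_ ?_)))) ?_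
        · simp
        all_goals
        · rw [iff_comm, ← sub_eq_zero]
          exact iff_of_eq (congrArg (· = 0) (by ring))
      · rw [neg_neg]; ring
    · rw [if_neg h, zero_mul, if_neg (fun h' => h h'.1.1), mul_zero]
  · intro t ht
    refine if_neg fun h => ht ?_
    linear_combination h.1.1

/-- Choose u with 8u = 8n₁, in `torsionEight M` ways. The exponents of the φ- and ψ-monomials can
then be written as t - 2u and -4t for a unique t. The first two indices become 8-torsion plus u, the
last three 4-torsion plus t. -/
theorem torsionEight_mul_octicTorusSum (φ ψ : F) (a b : Fˣ) (ha : -(2 * φ) = a)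
    (hb : -(8 * ψ) = b) :
    torsionEight M * (M * octicTorusSum θ φ ψ) = ∑ u : ZMod M, ∑ t : ZMod M,
      gaussZ θ τ (2 * u - t) * torusChar τ (t - 2 * u) a *
        (gaussZ θ τ (4 * t) * torusChar τ (-(4 * t)) b) *
        octicSum 0 (fun n => gaussZ θ τ (-(n + u))) (fun n => gaussZ θ τ (-(n + t))) := by
  rw [octicTorusSum_eq hM θ hτ φ ψ a b ha hb]
  simp_rw [octicSum_add _ _ (fun n => gaussZ θ τ (-n)) (fun n => gaussZ θ τ (-n)),
    Finset.mul_sum]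
  refine Eq.trans ?_ (Finset.sum_congr rfl fun u _ => Finset.sum_comm).symm
  refine Eq.trans ?_ Finset.sum_comm.symm
  simp_rw [Fintype.sum_prod_type]
  refine Finset.sum_congr rfl fun n₁ _ => Finset.sum_congr rfl fun n₂ _ =>
    Finset.sum_congr rfl fun n₃ _ => Finset.sum_congr rfl fun n₄ _ =>
    Finset.sum_congr rfl fun n₅ _ => ?_
  simp_rw [← sum_ite_eight_mul_eq n₁, ← Finset.mul_sum]
  rw [Finset.sum_mul]
  refine Finset.sum_congr rfl fun u _ => ?_
  by_cases h : 8 * n₁ = 8 * u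
  · rw [if_pos h, one_mul]
    -- The exponent of the φ-monomial is free and is renamed t - 2u; the one of the ψ-monomial is
    -- then forced to be -4t by the first congruence.
    refine (Fintype.sum_equiv (Equiv.subRight (2 * u)) _ _ fun t => ?_).symm
    rw [Fintype.sum_eq_single (-(4 * t)), Equiv.subRight_apply, mul_ite, mul_zero]
    · refine if_congr ?_ ?_ rfl
      · refine and_congr (and_congr ?_ (and_congr ?_ (and_congr ?_ (and_congr ?_ ?_)))) ?_
        · rw [h]
          refine iff_of_true rfl (by ring)
        all_goals
        · rw [← sub_eq_zero]
          exact iff_of_eq (congrArg (· = 0) (by ring))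
      · rw [neg_neg, neg_sub]; ring
    · intro t' ht'
      refine if_neg fun h' => ht' ?_
      rw [Equiv.subRight_apply] at h'
      linear_combination h'.1.1 - h
  · rw [if_neg h, zero_mul]
    refine (Finset.sum_eq_zero fun t _ => ?_).symm
    rw [if_neg (fun h' => h h'.1.1), mul_zero]

end TorusSums

/-! ### The 15 classes of monomials. -/

section Monomials

variable {K : Type*} [Field K]

/-- The sum of `g(v₃) g(v₄) g(v₅)` over residues modulo `4` with `8 ∣ w + 2 (v₃ + v₄ + v₅)`. -/
def cubicSum (g : ℤ → K) (w : ℕ) : K :=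
  ∑ v₃ ∈ Finset.range 4, ∑ v₄ ∈ Finset.range 4, ∑ v₅ ∈ Finset.range 4,
    if 8 ∣ w + 2 * (v₃ + v₄ + v₅) then g v₃ * g v₄ * g v₅ else 0

theorem cubicSum_add_eight (g : ℤ → K) (w : ℕ) : cubicSum g (w + 8) = cubicSum g w := by
  simp only [cubicSum]
  refine Finset.sum_congr rfl fun a _ => Finset.sum_congr rfl fun b _ =>
    Finset.sum_congr rfl fun c _ => if_congr (by omega) rfl rfl

theorem cubicSum_odd (g : ℤ → K) (w : ℕ) : cubicSum g (2 * w + 1) = 0 := by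
  refine Finset.sum_eq_zero fun a _ => Finset.sum_eq_zero fun b _ =>
    Finset.sum_eq_zero fun c _ => if_neg (by omega)

/-- Of the 64 triples modulo 4 the condition leaves 16, grouped by multiset; the coefficients count
orderings. The cases 2, 4, 6 have the same shape. -/
theorem cubicSum_zero (g : ℤ → K) : cubicSum g 0 = g 0 ^ 3 + 6 * (g 0 * g 1 * g 3)
    + 3 * (g 0 * g 2 ^ 2) + 3 * (g 1 ^ 2 * g 2) + 3 * (g 2 * g 3 ^ 2) := by
  simp [cubicSum, Finset.sum_range_succ, Nat.dvd_iff_mod_eq_zero]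
  ring

theorem cubicSum_two (g : ℤ → K) : cubicSum g 2 = g 1 ^ 3 + 6 * (g 0 * g 1 * g 2)
    + 3 * (g 0 ^ 2 * g 3) + 3 * (g 1 * g 3 ^ 2) + 3 * (g 2 ^ 2 * g 3) := by
  simp [cubicSum, Finset.sum_range_succ, Nat.dvd_iff_mod_eq_zero]
  ring

theorem cubicSum_four (g : ℤ → K) : cubicSum g 4 = g 2 ^ 3 + 6 * (g 1 * g 2 * g 3)
    + 3 * (g 0 ^ 2 * g 2) + 3 * (g 0 * g 1 ^ 2) + 3 * (g 0 * g 3 ^ 2) := by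
  simp [cubicSum, Finset.sum_range_succ, Nat.dvd_iff_mod_eq_zero]
  ring

theorem cubicSum_six (g : ℤ → K) : cubicSum g 6 = g 3 ^ 3 + 6 * (g 0 * g 2 * g 3)
    + 3 * (g 0 ^ 2 * g 1) + 3 * (g 1 ^ 2 * g 3) + 3 * (g 1 * g 2 ^ 2) := by
  simp [cubicSum, Finset.sum_range_succ, Nat.dvd_iff_mod_eq_zero]
  ring

set_option maxHeartbeats 4000000 in
/-- The sum over all monomials in terms of representatives of the classes. -/
theorem sum_monomials_eq (f g : ℤ → K) (hf : ∀ v, f (v + 8) = f v) (hg : ∀ v, g (v + 4) = g v) :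
    ∑ v₁ ∈ Finset.range 8, ∑ v₂ ∈ Finset.range 8, f v₁ * f v₂ * cubicSum g (v₁ + v₂) =
    ∑ j, (octicWeight j : K) * ∑ a ∈ Finset.range 8,
      (∏ i, f ((octicMonomial j).1 i + a)) * ∏ i, g ((octicMonomial j).2 i + a) := by
  -- Representatives have first entries at most 6 and last entries at most 3, and are translated by
  -- at most 7. Arguments therefore reach 13 for f and 10 for g, and these are the periodicities
  -- needed. A class returning to a permutation of itself after n steps is met 8/n times, which the
  -- division by 8 in its weight corrects.
  have f8 := hf 0
  have f9 := hf 1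
  have f10 := hf 2
  have f11 := hf 3
  have f12 := hf 4
  have f13 := hf 5
  have g4 := hg 0
  have g5 := hg 1
  have g6 := hg 2
  have g7 := hg 3
  have g8 := hg 4
  have g9 := hg 5
  have g10 := hg 6
  norm_num at f8 f9 f10 f11 f12 f13 g4 g5 g6 g7 g8 g9 g10
  rw [g4] at g8
  rw [g5] at g9
  rw [g6] at g10
  have c8 := cubicSum_add_eight g 0
  have c10 := cubicSum_add_eight g 2
  have c12 := cubicSum_add_eight g 4
  have c14 := cubicSum_add_eight g 6
  have c1 := cubicSum_odd g 0
  have c3 := cubicSum_odd g 1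
  have c5 := cubicSum_odd g 2
  have c7 := cubicSum_odd g 3
  have c9 := cubicSum_odd g 4
  have c11 := cubicSum_odd g 5
  have c13 := cubicSum_odd g 6
  norm_num at c8 c10 c12 c14 c1 c3 c5 c7 c9 c11 c13
  simp only [Finset.sum_range_succ, Finset.sum_range_zero, zero_add, octicWeight, octicMonomial,
    Fin.sum_univ_succ, Fin.prod_univ_succ]
  simp [f8, f9, f10, f11, f12, f13, g4, g5, g6, g7, g8, g9, g10, c8, c10, c12, c14, c1, c3, c5, c7,
    c9, c11, c13, cubicSum_zero, cubicSum_two, cubicSum_four, cubicSum_six]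
  ring

end Monomials

/-! ### From residues modulo M to monomials. -/

section Classes

variable {K : Type*} [Field K] {M : ℕ} [NeZero M]

/-- The value of `f` at the residue `x / d`, extended by zero when `d ∤ x`. -/
def divValue (d : ℤ) (f : ZMod M → K) (x : ℤ) : K := if d ∣ x then f ((x / d : ℤ) : ZMod M) else 0

omit [NeZero M] in
theorem divValue_add_mul (d : ℤ) (hd : d ≠ 0) (f : ZMod M → K) (x : ℤ) :
    divValue d f (x + d * M) = divValue d f x := by
  rw [divValue, divValue]
  refine if_congr (by simp) ?_ rfl
  rw [Int.add_mul_ediv_left _ _ hd]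
  simp

/-- The solutions of `d n = c` modulo `M` are the `n` with `d n = v M + c`, with `v` modulo `d`. -/
theorem sum_ite_mul_eq (d : ℕ) (hd : d ≠ 0) (c : ℤ) (f : ZMod M → K) :
    ∑ n : ZMod M, (if (d : ZMod M) * n = (c : ZMod M) then f n else 0) =
      ∑ v ∈ Finset.range d, divValue d f (v * M + c) := by
  have hd' : (d : ℤ) ≠ 0 := by exact_mod_cast hd
  have hM' : (M : ℤ) ≠ 0 := by exact_mod_cast NeZero.ne M
  have hdpos : (0 : ℤ) < d := by positivity
  simp only [divValue]
  rw [← Finset.sum_filter, ← Finset.sum_filter]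
  symm
  refine Finset.sum_bij (fun v _ => (((v * M + c) / d : ℤ) : ZMod M)) ?_ ?_ ?_ ?_
  · intro v hv
    obtain ⟨e, he⟩ := (Finset.mem_filter.1 hv).2
    rw [Finset.mem_filter]
    refine ⟨Finset.mem_univ _, ?_⟩
    rw [he, Int.mul_ediv_cancel_left _ hd']
    have := congrArg (fun z : ℤ => (z : ZMod M)) he
    push_cast at this
    rw [← this]
    simp
  · intro v hv w hw h
    obtain ⟨hv1, e, he⟩ := Finset.mem_filter.1 hv
    obtain ⟨hw1, e', he'⟩ := Finset.mem_filter.1 hw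
    rw [he, he', Int.mul_ediv_cancel_left _ hd', Int.mul_ediv_cancel_left _ hd',
      ZMod.intCast_eq_intCast_iff_dvd_sub] at h
    obtain ⟨k, hk⟩ := h
    -- Both v and w lie in an interval of length d, so a difference divisible by d is zero.
    have h2 : (w : ℤ) - v = d * k := by
      apply mul_right_cancel₀ hM'
      linear_combination he' - he + d * hk
    have hv2 : (v : ℤ) < d := by exact_mod_cast Finset.mem_range.1 hv1
    have hw2 : (w : ℤ) < d := by exact_mod_cast Finset.mem_range.1 hw1
    have hk0 : k = 0 := by
      by_contra hk0
      rcases lt_or_gt_of_ne hk0 with hlt | hgt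
      · nlinarith
      · nlinarith
    rw [hk0, mul_zero] at h2
    omega
  · intro n hn
    have hn2 := (Finset.mem_filter.1 hn).2
    obtain ⟨k, rfl⟩ := ZMod.intCast_surjective n
    have h : ((d * k : ℤ) : ZMod M) = (c : ZMod M) := by push_cast; exact hn2
    rw [eq_comm, ZMod.intCast_eq_intCast_iff_dvd_sub] at h
    obtain ⟨e, he⟩ := h
    have hemod := Int.emod_add_mul_ediv e d
    have h0 := Int.emod_nonneg e hd'
    have h1 := Int.emod_lt_of_pos e hdpos
    have hcast : ((e % d).toNat : ℤ) = e % d := Int.toNat_of_nonneg h0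
    -- The multiplier e is reduced modulo d, which changes the solution only by a multiple of M.
    have heq : ((e % d).toNat : ℤ) * M + c = d * (k - M * (e / d)) := by
      rw [hcast]
      linear_combination M * hemod - he
    refine ⟨(e % d).toNat, ?_, ?_⟩
    · rw [Finset.mem_filter, Finset.mem_range]
      exact ⟨by omega, ⟨_, heq⟩⟩
    · rw [heq, Int.mul_ediv_cancel_left _ hd']
      push_cast
      simp
  · intro v hv
    rfl

theorem octicSum_eq_nested (ρ : ZMod M) (f₁ f₂ : ZMod M → K) :
    octicSum ρ f₁ f₂ = ∑ n₁ : ZMod M, if 8 * n₁ = 4 * ρ then ∑ n₂ : ZMod M, if 8 * n₂ = 4 * ρ then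
      ∑ n₃ : ZMod M, if 4 * n₃ = 0 then ∑ n₄ : ZMod M, if 4 * n₄ = 0 then
      ∑ n₅ : ZMod M, if 4 * n₅ = 0 then (if n₁ + n₂ + n₃ + n₄ + n₅ = ρ then
        f₁ n₁ * f₁ n₂ * (f₂ n₃ * f₂ n₄ * f₂ n₅) else 0) else 0 else 0 else 0 else 0 else 0 := by
  simp_rw [octicSum, Fintype.sum_prod_type]
  refine Finset.sum_congr rfl fun n₁ _ => ?_
  by_cases h1 : 8 * n₁ = 4 * ρ
  swap
  · simp [h1]
  rw [if_pos h1]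
  refine Finset.sum_congr rfl fun n₂ _ => ?_
  by_cases h2 : 8 * n₂ = 4 * ρ
  swap
  · simp [h2]
  rw [if_pos h2]
  refine Finset.sum_congr rfl fun n₃ _ => ?_
  by_cases h3 : 4 * n₃ = 0
  swap
  · simp [h3]
  rw [if_pos h3]
  refine Finset.sum_congr rfl fun n₄ _ => ?_
  by_cases h4 : 4 * n₄ = 0
  swap
  · simp [h4]
  rw [if_pos h4]
  refine Finset.sum_congr rfl fun n₅ _ => ?_
  simp only [h1, h2, h3, h4, true_and, ite_and]

/-- The sum over residues in terms of the classes of monomials. -/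
theorem octicSum_eq_sum_classes (r : ℤ) (f₁ f₂ : ZMod M → K) :
    octicSum (r : ZMod M) f₁ f₂ = ∑ j, (octicWeight j : K) * ∑ a ∈ Finset.range 8,
      (∏ i, divValue 8 f₁ (((octicMonomial j).1 i + a) * M + 4 * r)) *
        ∏ i, divValue 4 f₂ (((octicMonomial j).2 i + a) * M) := by
  have hM' : (M : ℤ) ≠ 0 := by exact_mod_cast NeZero.ne M
  have h8 : ∀ G : ZMod M → K, ∑ n : ZMod M, (if 8 * n = 4 * (r : ZMod M) then G n else 0) =
      ∑ v ∈ Finset.range 8, divValue 8 G (v * M + 4 * r) := fun G => by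
    have := sum_ite_mul_eq 8 (by norm_num) (4 * r) G
    push_cast at this
    exact this
  have h4 : ∀ G : ZMod M → K, ∑ n : ZMod M, (if 4 * n = 0 then G n else 0) =
      ∑ v ∈ Finset.range 4, divValue 4 G (v * M) := fun G => by
    have := sum_ite_mul_eq 4 (by norm_num) 0 G
    push_cast at this
    simpa using this
  rw [← sum_monomials_eq (fun v => divValue 8 f₁ (v * M + 4 * r)) (fun v => divValue 4 f₂ (v * M)),
    octicSum_eq_nested, h8]
  · refine Finset.sum_congr rfl fun v₁ _ => ?_
    by_cases d1 : (8 : ℤ) ∣ v₁ * M + 4 * r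
    swap
    · simp [divValue, d1]
    rw [divValue, if_pos d1, h8]
    refine Finset.sum_congr rfl fun v₂ _ => ?_
    by_cases d2 : (8 : ℤ) ∣ v₂ * M + 4 * r
    swap
    · simp [divValue, d2]
    rw [divValue, if_pos d2, h4, cubicSum, Finset.mul_sum]
    refine Finset.sum_congr rfl fun v₃ _ => ?_
    by_cases d3 : (4 : ℤ) ∣ v₃ * M
    swap
    · simp [divValue, d3]
    rw [divValue, if_pos d3, h4, Finset.mul_sum]
    refine Finset.sum_congr rfl fun v₄ _ => ?_
    by_cases d4 : (4 : ℤ) ∣ v₄ * M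
    swap
    · simp [divValue, d4]
    rw [divValue, if_pos d4, h4, Finset.mul_sum]
    refine Finset.sum_congr rfl fun v₅ _ => ?_
    by_cases d5 : (4 : ℤ) ∣ v₅ * M
    swap
    · simp [divValue, d5]
    rw [divValue, if_pos d5, mul_ite, mul_zero]
    simp only [divValue, if_pos d1, if_pos d2, if_pos d3, if_pos d4, if_pos d5]
    refine if_congr ?_ rfl rfl
    obtain ⟨e1, he1⟩ := d1
    obtain ⟨e2, he2⟩ := d2
    obtain ⟨e3, he3⟩ := d3
    obtain ⟨e4, he4⟩ := d4
    obtain ⟨e5, he5⟩ := d5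
    rw [he1, he2, he3, he4, he5, Int.mul_ediv_cancel_left _ (by norm_num),
      Int.mul_ediv_cancel_left _ (by norm_num), Int.mul_ediv_cancel_left _ (by norm_num),
      Int.mul_ediv_cancel_left _ (by norm_num), Int.mul_ediv_cancel_left _ (by norm_num)]
    rw [← Int.cast_add, ← Int.cast_add, ← Int.cast_add, ← Int.cast_add, eq_comm,
      ZMod.intCast_eq_intCast_iff_dvd_sub, ← Int.natCast_dvd_natCast]
    -- Adding the defining equations of the five residues, the last three doubled, turns the
    -- relation ∑ nᵢ = ρ modulo M into the divisibility by 8 that defines monomials. The terms 4r of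
    -- the first two equations account exactly for ρ.
    have key : ((v₁ + v₂ + 2 * (v₃ + v₄ + v₅) : ℕ) : ℤ) * M = 8 * (e1 + e2 + e3 + e4 + e5 - r) := by
      push_cast
      linear_combination he1 + he2 + 2 * he3 + 2 * he4 + 2 * he5
    constructor
    · rintro ⟨k, hk⟩
      refine ⟨k, ?_⟩
      apply mul_right_cancel₀ hM'
      rw [key, hk]
      push_cast
      ring
    · rintro ⟨k, hk⟩
      refine ⟨k, ?_⟩
      rw [hk] at key
      push_cast at key
      linarith
  · intro v
    rw [← divValue_add_mul 8 (by norm_num) f₁ (v * M + 4 * r)]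
    congr 1
    ring
  · intro v
    rw [← divValue_add_mul 4 (by norm_num) f₂ (v * M)]
    congr 1
    ring

end Classes

/-! ### From the torus to all of affine space. -/

section AffineSums

variable {F : Type*} [Field F] [Fintype F] [DecidableEq F] {K : Type*} [Field K]
  {M : ℕ} [NeZero M]

/-- The sum `∑ θ(y P(x₁, …, x₅, 1))` over `y ≠ 0` and all `x₁, …, x₅`. -/
noncomputable def octicAffineSum (θ : AddChar F K) (φ ψ : F) : K :=
  ∑ y : Fˣ, ∑ x : Fin 5 → F, θ (y * octicPoly φ ψ ![x 0, x 1, x 2, x 3, x 4, 1])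

/-- The sum of `θ(y xᵈ)` over all `x`. -/
def powSum (θ : AddChar F K) (d : ℕ) (y : F) : K := ∑ x : F, θ (y * x ^ d)

/-- The sum of `θ(y xᵈ)` over the non-zero `x`. -/
def powUnitSum (θ : AddChar F K) (d : ℕ) (y : F) : K := ∑ x : Fˣ, θ (y * (x : F) ^ d)

theorem mul_sum_pow_three {ι R : Type*} [Fintype ι] [CommSemiring R] (c : R) (f : ι → R) :
    c * (∑ i, f i) ^ 3 = ∑ i, ∑ j, ∑ k, c * f i * f j * f k := by
  have h : c * (∑ i, f i) ^ 3 = (∑ i, c * f i) * (∑ j, f j) * ∑ k, f k := by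
    rw [← Finset.mul_sum]
    ring
  rw [h, Finset.sum_mul_sum, Finset.sum_mul]
  refine Finset.sum_congr rfl fun i _ => ?_
  rw [Finset.sum_mul_sum]

/-- The ψ-term is divisible by every coordinate, so the summands for ψ and for 0 agree off the
torus. -/
theorem octicAffineSum_sub (θ : AddChar F K) (φ ψ : F) :
    octicAffineSum θ φ ψ - octicAffineSum θ φ 0 =
      octicTorusSum θ φ ψ - octicTorusSum θ φ 0 := by
  simp only [octicAffineSum, octicTorusSum, ← Finset.sum_sub_distrib]
  refine Finset.sum_congr rfl fun y _ => ?_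
  rw [sum_eq_sum_units_of_forall]
  rintro x ⟨j, hj⟩
  rw [sub_eq_zero]
  congr 2
  fin_cases j <;> simp at hj <;> simp [octicPoly, hj]

theorem octicAffineSum_zero (θ : AddChar F K) (φ : F) :
    octicAffineSum θ φ 0 = ∑ y : Fˣ, (∑ x : Fin 2 → F,
      θ (y * (x 0 ^ 8 + x 1 ^ 8 + -(2 * φ) * x 0 ^ 4 * x 1 ^ 4))) * powSum θ 4 y ^ 3 := by
  refine Finset.sum_congr rfl fun y _ => ?_
  simp only [Fintype.sum_fin_succ_fun, Fintype.sum_fin_zero_fun, powSum]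
  simp only [Finset.sum_mul _ _ (_ ^ 3), mul_sum_pow_three]
  refine Finset.sum_congr rfl fun x₁ _ => Finset.sum_congr rfl fun x₂ _ =>
    Finset.sum_congr rfl fun x₃ _ => Finset.sum_congr rfl fun x₄ _ =>
    Finset.sum_congr rfl fun x₅ _ => ?_
  simp only [← AddChar.map_add_eq_mul]
  congr 1
  simp [octicPoly]
  ring

theorem octicTorusSum_zero_right (θ : AddChar F K) (φ : F) :
    octicTorusSum θ φ 0 = ∑ y : Fˣ, binaryUnitSum θ (-(2 * φ)) y * powUnitSum θ 4 y ^ 3 := by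
  refine Finset.sum_congr rfl fun y _ => ?_
  simp only [Fintype.sum_fin_succ_fun, Fintype.sum_fin_zero_fun, powUnitSum, binaryUnitSum,
    Finset.sum_mul _ _ (_ ^ 3), mul_sum_pow_three]
  refine Finset.sum_congr rfl fun x₁ _ => Finset.sum_congr rfl fun x₂ _ =>
    Finset.sum_congr rfl fun x₃ _ => Finset.sum_congr rfl fun x₄ _ =>
    Finset.sum_congr rfl fun x₅ _ => ?_
  simp only [← AddChar.map_add_eq_mul]
  congr 1
  simp [octicPoly]
  ring

/-- On the coordinate axes the mixed term vanishes and the form is diagonal. The sum over the axes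
is thus the full diagonal sum minus its torus part. -/
theorem binarySum_eq (θ : AddChar F K) (a y : F) :
    ∑ x : Fin 2 → F, θ (y * (x 0 ^ 8 + x 1 ^ 8 + a * x 0 ^ 4 * x 1 ^ 4)) =
      binaryUnitSum θ a y + powSum θ 8 y ^ 2 - powUnitSum θ 8 y ^ 2 := by
  have h := sum_eq_sum_units_of_forall (F := F) (J := Fin 2) (fun x =>
    θ (y * (x 0 ^ 8 + x 1 ^ 8 + a * x 0 ^ 4 * x 1 ^ 4)) - θ (y * (x 0 ^ 8)) * θ (y * x 1 ^ 8)) ?_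
  · rw [Finset.sum_sub_distrib, Finset.sum_sub_distrib, sub_eq_iff_eq_add] at h
    rw [h, binaryUnitSum, sub_add_eq_add_sub, add_sub_assoc, add_sub_assoc]
    simp only [Fintype.sum_fin_succ_fun, Fintype.sum_fin_zero_fun, powSum, powUnitSum, pow_two,
      Finset.sum_mul_sum]
    simp
  · rintro x ⟨j, hj⟩
    rw [sub_eq_zero, ← AddChar.map_add_eq_mul]
    congr 1
    fin_cases j <;> simp at hj <;> simp [hj]

theorem binaryUnitSum_zero (θ : AddChar F K) (y : F) :
    binaryUnitSum θ 0 y = powUnitSum θ 8 y ^ 2 := by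
  simp only [binaryUnitSum, Fintype.sum_fin_succ_fun, Fintype.sum_fin_zero_fun, powUnitSum, pow_two,
      Finset.sum_mul_sum]
  simp [mul_add, AddChar.map_add_eq_mul]

/-- The first line is the torus sum with its ψ = 0 value removed, the second restores that value
with x₃, x₄, x₅ allowed to vanish, and the last adds the locus x₁x₂ = 0. Each correction will become
a sum over classes with vanishing indices. -/
theorem octicAffineSum_eq (θ : AddChar F K) (φ ψ : F) :
    octicAffineSum θ φ ψ = octicTorusSum θ φ ψ
      - ∑ y : Fˣ, binaryUnitSum θ (-(2 * φ)) y * powUnitSum θ 4 y ^ 3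
      + ∑ y : Fˣ, binaryUnitSum θ (-(2 * φ)) y * powSum θ 4 y ^ 3
      + (∑ y : Fˣ, powSum θ 8 y ^ 2 * powSum θ 4 y ^ 3
        - ∑ y : Fˣ, powUnitSum θ 8 y ^ 2 * powSum θ 4 y ^ 3) := by
  have h := octicAffineSum_sub θ φ ψ
  rw [sub_eq_iff_eq_add] at h
  rw [h, octicAffineSum_zero, octicTorusSum_zero_right]
  simp only [binarySum_eq, add_mul, sub_mul, Finset.sum_add_distrib, Finset.sum_sub_distrib]
  ring

end AffineSums

/-! ### Translates of classes inside sums over characters. -/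

section ClassSums

variable {K : Type*} [Field K] {M : ℕ} [NeZero M] {J : Type*} [Fintype J]

/-- `octicSum ρ` is the sum over `A` translates, by multiples of `(c, c, 2c, 2c, 2c)`, of the
exponent vectors `(d₁, d₂)`, with weights `lam`. -/
def IsClassSum (K : Type*) [Field K] (ρ : ZMod M) (lam : J → ℕ) (A : ℕ) (d₁ : J → Fin 2 → ZMod M)
    (d₂ : J → Fin 3 → ZMod M) (c : ZMod M) : Prop :=
  ∀ f₁ f₂ : ZMod M → K, octicSum ρ f₁ f₂ = ∑ a ∈ Finset.range A, ∑ j,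
    (lam j : K) * (∏ i, f₁ (d₁ j i + a * c)) * ∏ i, f₂ (d₂ j i + 2 * a * c)

variable {ρ : ZMod M} {lam : J → ℕ} {A B : ℕ} {d₁ : J → Fin 2 → ZMod M}
    {d₂ : J → Fin 3 → ZMod M} {c : ZMod M}

/-- The translates of the exponent vectors contribute equally to a sum over all characters. -/
theorem IsClassSum.sum_mul_octicSum (h : IsClassSum K ρ lam A d₁ d₂ c) (f₁ f₂ X : ZMod M → K)
    (hX : ∀ (a : ℕ) w, X (w - a * c) = X w) :
    ∑ w, X w * octicSum ρ (fun n => f₁ (n + w)) (fun n => f₂ (n + 2 * w)) =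
      A * ∑ w, ∑ j, (lam j : K) * (∏ i, f₁ (d₁ j i + w)) * (∏ i, f₂ (d₂ j i + 2 * w)) * X w := by
  have key : ∀ a : ℕ, ∑ w, X w * ∑ j, (lam j : K) * (∏ i, f₁ (d₁ j i + a * c + w)) *
      ∏ i, f₂ (d₂ j i + 2 * a * c + 2 * w) =
      ∑ w, ∑ j, (lam j : K) * (∏ i, f₁ (d₁ j i + w)) * (∏ i, f₂ (d₂ j i + 2 * w)) * X w := by
    intro a
    refine Fintype.sum_equiv (Equiv.addRight (a * c)) _ _ fun w => ?_
    rw [Finset.mul_sum]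
    refine Finset.sum_congr rfl fun j _ => ?_
    rw [Equiv.coe_addRight, ← hX a (w + a * c), add_sub_cancel_right, mul_comm]
    congr 2
    · congr 1
      exact Finset.prod_congr rfl fun i _ => congrArg f₁ (by ring)
    · exact Finset.prod_congr rfl fun i _ => congrArg f₂ (by ring)
  simp_rw [h _ _, Finset.mul_sum (Finset.range A)]
  rw [Finset.sum_comm]
  simp_rw [key]
  rw [Finset.sum_const, Finset.card_range, nsmul_eq_mul]

theorem IsClassSum.sum_sum_mul_octicSum (h : IsClassSum K ρ lam A d₁ d₂ c) (f₁ f₂ : ZMod M → K)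
    (X : ZMod M → ZMod M → K) (hX : ∀ (a : ℕ) u t, X (u - a * c) (t - 2 * a * c) = X u t) :
    ∑ u, ∑ t, X u t * octicSum ρ (fun n => f₁ (n + u)) (fun n => f₂ (n + t)) =
      A * ∑ u, ∑ t, ∑ j, (lam j : K) * (∏ i, f₁ (d₁ j i + u)) * (∏ i, f₂ (d₂ j i + t)) *
        X u t := by
  have key : ∀ a : ℕ, ∑ w : ZMod M × ZMod M, X w.1 w.2 * ∑ j, (lam j : K) *
      (∏ i, f₁ (d₁ j i + a * c + w.1)) * ∏ i, f₂ (d₂ j i + 2 * a * c + w.2) =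
      ∑ w : ZMod M × ZMod M, ∑ j, (lam j : K) * (∏ i, f₁ (d₁ j i + w.1)) *
        (∏ i, f₂ (d₂ j i + w.2)) * X w.1 w.2 := by
    intro a
    refine Fintype.sum_equiv ((Equiv.addRight (a * c)).prodCongr (Equiv.addRight (2 * a * c))) _ _
      fun w => ?_
    rw [Finset.mul_sum]
    refine Finset.sum_congr rfl fun j _ => ?_
    simp only [Equiv.prodCongr_apply, Prod.map_fst, Prod.map_snd, Equiv.coe_addRight]
    rw [← hX a (w.1 + a * c), add_sub_cancel_right, add_sub_cancel_right, mul_comm]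
    congr 2
    · congr 1
      exact Finset.prod_congr rfl fun i _ => congrArg f₁ (by ring)
    · exact Finset.prod_congr rfl fun i _ => congrArg f₂ (by ring)
  simp_rw [h _ _, Finset.mul_sum (Finset.range A)]
  simp only [← Fintype.sum_prod_type']
  rw [Finset.sum_comm]
  simp_rw [key]
  rw [Finset.sum_const, Finset.card_range, nsmul_eq_mul]
  simp only [Fintype.sum_prod_type]

/-- Here u shifts only the first two indices, so a translate can be absorbed in u only when its
effect 2ac on the last three is zero. This identifies a with a + B, leaving B of the 2B translates,
each counted twice. -/
theorem IsClassSum.sum_mul_octicSum_left (h : IsClassSum K ρ lam (2 * B) d₁ d₂ c)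
    (hc : 2 * B * c = 0) (f₁ f₂ X : ZMod M → K) (hX : ∀ u, X (u - B * c) = X u) :
    ∑ u, X u * octicSum ρ (fun n => f₁ (n + u)) f₂ =
      2 * ∑ u, ∑ a ∈ Finset.range B, ∑ j, (lam j : K) * (∏ i, f₁ (d₁ j i + a * c + u)) *
        (∏ i, f₂ (d₂ j i + 2 * a * c)) * X u := by
  have key : ∀ a : ℕ, ∑ u, X u * ∑ j, (lam j : K) *
      (∏ i, f₁ (d₁ j i + (B + a : ℕ) * c + u)) * ∏ i, f₂ (d₂ j i + 2 * (B + a : ℕ) * c) =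
      ∑ u, X u * ∑ j, (lam j : K) *
        (∏ i, f₁ (d₁ j i + a * c + u)) * ∏ i, f₂ (d₂ j i + 2 * a * c) := by
    intro a
    refine Fintype.sum_equiv (Equiv.addRight (B * c)) _ _ fun u => ?_
    rw [Equiv.coe_addRight, ← hX (u + B * c), add_sub_cancel_right]
    congr 1
    refine Finset.sum_congr rfl fun j _ => ?_
    congr 2
    · exact Finset.prod_congr rfl fun i _ => congrArg f₁ (by push_cast; ring)
    · exact funext fun i => congrArg f₂ (by push_cast; linear_combination hc)
  simp_rw [h _ _, Finset.mul_sum (Finset.range _)]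
  rw [Finset.sum_comm, two_mul B, Finset.sum_range_add]
  simp_rw [key]
  rw [← two_mul, Finset.sum_comm]
  simp_rw [Finset.mul_sum Finset.univ, mul_comm (X _)]

theorem IsClassSum.octicSum_ite (h : IsClassSum K ρ lam A d₁ d₂ c) (f₁ f₂ : ZMod M → K) :
    octicSum ρ (fun n => if n = 0 then 0 else f₁ n) (fun n => if n = 0 then 0 else f₂ n) =
      ∑ a ∈ Finset.range A,
        ∑ j with (∀ i, ¬ d₁ j i + a * c = 0) ∧ ∀ i, ¬ d₂ j i + 2 * a * c = 0,
          (lam j : K) * (∏ i, f₁ (d₁ j i + a * c)) * ∏ i, f₂ (d₂ j i + 2 * a * c) := by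
  rw [h]
  refine Finset.sum_congr rfl fun a _ => ?_
  rw [Finset.sum_filter]
  refine Finset.sum_congr rfl fun j _ => ?_
  simp only [← ite_not (p := _ = (0 : ZMod M)), Finset.prod_ite_zero, Finset.mem_univ, true_imp_iff]
  split_ifs <;> simp_all

end ClassSums

section ClassSums

variable {K : Type*} [Field K] {M : ℕ} [NeZero M] {J : Type*} [Fintype J]
  {ρ : ZMod M} {lam : J → ℕ} {A B : ℕ} {d₁ : J → Fin 2 → ZMod M}
  {d₂ : J → Fin 3 → ZMod M} {c : ZMod M}

omit [NeZero M] in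
theorem prod_ite_eq_zero {ι : Type*} [Fintype ι] (f : ZMod M → K) (d : ι → ZMod M) :
    ∏ i, (if d i = 0 then 0 else f (d i)) = if ∀ i, ¬ d i = 0 then ∏ i, f (d i) else 0 := by
  simp only [← ite_not (p := _ = (0 : ZMod M)), Finset.prod_ite_zero, Finset.mem_univ, true_imp_iff]

/-- Restoring the trivial character in the first two slots adds exactly the vectors with a zero
among their first two indices. The last three still exclude zero. -/
theorem IsClassSum.octicSum_sub_ite_left (h : IsClassSum K ρ lam A d₁ d₂ c)
    (f₁ f₂ : ZMod M → K) :
    octicSum ρ f₁ (fun n => if n = 0 then 0 else f₂ n) -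
      octicSum ρ (fun n => if n = 0 then 0 else f₁ n) (fun n => if n = 0 then 0 else f₂ n) =
      ∑ a ∈ Finset.range A,
        ∑ j with (∃ i, d₁ j i + a * c = 0) ∧ ∀ i, ¬ d₂ j i + 2 * a * c = 0,
          (lam j : K) * (∏ i, f₁ (d₁ j i + a * c)) * ∏ i, f₂ (d₂ j i + 2 * a * c) := by
  rw [h, h, ← Finset.sum_sub_distrib]
  refine Finset.sum_congr rfl fun a _ => ?_
  rw [← Finset.sum_sub_distrib, Finset.sum_filter]
  refine Finset.sum_congr rfl fun j _ => ?_
  rw [prod_ite_eq_zero, prod_ite_eq_zero]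
  by_cases h1 : ∀ i, ¬ d₁ j i + a * c = 0
  · simp [h1]
  · have h1' := h1
    push Not at h1'
    simp [h1, h1']

theorem IsClassSum.octicSum_sub_ite (h : IsClassSum K ρ lam A d₁ d₂ c) (f₁ f₂ : ZMod M → K) :
    octicSum ρ f₁ f₂ -
      octicSum ρ (fun n => if n = 0 then 0 else f₁ n) (fun n => if n = 0 then 0 else f₂ n) =
      ∑ a ∈ Finset.range A,
        ∑ j with (∃ i, d₁ j i + a * c = 0) ∨ ∃ i, d₂ j i + 2 * a * c = 0,
          (lam j : K) * (∏ i, f₁ (d₁ j i + a * c)) * ∏ i, f₂ (d₂ j i + 2 * a * c) := by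
  rw [h, h, ← Finset.sum_sub_distrib]
  refine Finset.sum_congr rfl fun a _ => ?_
  rw [← Finset.sum_sub_distrib, Finset.sum_filter]
  refine Finset.sum_congr rfl fun j _ => ?_
  rw [prod_ite_eq_zero, prod_ite_eq_zero]
  by_cases h1 : ∀ i, ¬ d₁ j i + a * c = 0
  · by_cases h2 : ∀ i, ¬ d₂ j i + 2 * a * c = 0
    · simp [h1, h2]
    · have h2' := h2
      push Not at h2'
      simp [h2, h2']
  · have h1' := h1
    push Not at h1'
    simp [h1, h1']

theorem IsClassSum.sum_mul_octicSum_ite (h : IsClassSum K ρ lam (2 * B) d₁ d₂ c)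
    (hc : 2 * B * c = 0) (f₁ f₂ X : ZMod M → K) (hX : ∀ u, X (u - B * c) = X u) :
    ∑ u, X u * octicSum ρ (fun n => f₁ (n + u)) (fun n => if n = 0 then 0 else f₂ n) =
      2 * ∑ u, ∑ a ∈ Finset.range B, ∑ j with ∀ i, ¬ d₂ j i + 2 * a * c = 0,
        (lam j : K) * (∏ i, f₁ (d₁ j i + a * c + u)) * (∏ i, f₂ (d₂ j i + 2 * a * c)) * X u := by
  rw [h.sum_mul_octicSum_left hc f₁ _ X hX]
  simp only [prod_ite_eq_zero, Finset.sum_filter, mul_ite, mul_zero, ite_mul, zero_mul]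

theorem IsClassSum.sum_mul_octicSum_sub_ite (h : IsClassSum K ρ lam (2 * B) d₁ d₂ c)
    (hc : 2 * B * c = 0) (f₁ f₂ X : ZMod M → K) (hX : ∀ u, X (u - B * c) = X u) :
    ∑ u, X u * octicSum ρ (fun n => f₁ (n + u)) f₂ -
      ∑ u, X u * octicSum ρ (fun n => f₁ (n + u)) (fun n => if n = 0 then 0 else f₂ n) =
      2 * ∑ u, ∑ a ∈ Finset.range B, ∑ j with ∃ i, d₂ j i + 2 * a * c = 0,
        (lam j : K) * (∏ i, f₁ (d₁ j i + a * c + u)) * (∏ i, f₂ (d₂ j i + 2 * a * c)) * X u := by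
  rw [h.sum_mul_octicSum_left hc f₁ _ X hX, h.sum_mul_octicSum_ite hc f₁ _ X hX, ← mul_sub]
  simp only [← Finset.sum_sub_distrib, Finset.sum_filter]
  congr 1
  refine Finset.sum_congr rfl fun u _ => Finset.sum_congr rfl fun a _ =>
    Finset.sum_congr rfl fun j _ => ?_
  by_cases h2 : ∀ i, ¬ d₂ j i + 2 * a * c = 0
  · simp [h2]
  · have h2' := h2
    push Not at h2'
    simp [h2, h2']

theorem ZMod.sum_eq_sum_Ico {R : Type*} [AddCommMonoid R] (f : ZMod M → R) (s : ℕ) :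
    ∑ n, f n = ∑ u ∈ Finset.Ico s (s + M), f u := by
  rw [Finset.sum_Ico_eq_sum_range, add_tsub_cancel_left, ← Fintype.sum_equiv (Equiv.addLeft (s : ZMod M))
    (fun n => f (s + n)) f fun n => rfl, ZMod.sum_eq_sum_range]
  simp

/-- The interval from ⌈t/2⌉ to ⌊(2q - 3 + t)/2⌋, with q = M + 1, contains exactly M consecutive
integers. It is the range in which 2u - t runs between 0 and 2M - 1. -/
theorem ZMod.sum_eq_sum_Icc {R : Type*} [AddCommMonoid R] (f : ZMod M → R) (t : ℕ) :
    ∑ n, f n = ∑ u ∈ Finset.Icc ((t + 1) / 2) ((2 * (M + 1) - 3 + t) / 2), f u := by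
  have hM := NeZero.pos M
  rw [ZMod.sum_eq_sum_Ico f ((t + 1) / 2)]
  refine Finset.sum_congr ?_ fun _ _ => rfl
  ext x
  simp only [Finset.mem_Ico, Finset.mem_Icc]
  omega

variable {F : Type*} [Field F] [Fintype F] [DecidableEq F]
  (hM : Fintype.card Fˣ = M) {τ : F →*₀ K}
include hM

/-- The exponent is a multiple of 8, so the sign in b = -8ψ disappears. -/
theorem torusChar_neg_eight_mul (ψ : F) (b : Fˣ) (hb : -(8 * ψ) = b) (w : ℕ) :
    torusChar τ (-(8 * w) : ZMod M) b = τ (1 / (8 * ψ) ^ 8) ^ w := by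
  have h1 : (-(8 * w) : ZMod M) = ((-(8 * w) : ℤ) : ZMod M) := by push_cast; rfl
  rw [h1, torusChar_intCast hM, zpow_neg, ← hb, show (8 * w : ℤ) = ((8 * w : ℕ) : ℤ) by push_cast; rfl,
    zpow_natCast, pow_mul, one_div, map_inv₀, inv_pow, map_pow, ← map_pow, Even.neg_pow (by decide),
    map_pow]

theorem torusChar_neg_two_mul (φ : F) (a : Fˣ) (ha : -(2 * φ) = a) (u : ℕ) :
    torusChar τ (-(2 * u) : ZMod M) a = τ (1 / (2 * φ) ^ 2) ^ u := by
  have h1 : (-(2 * u) : ZMod M) = ((-(2 * u) : ℤ) : ZMod M) := by push_cast; rfl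
  rw [h1, torusChar_intCast hM, zpow_neg, ← ha, show (2 * u : ℤ) = ((2 * u : ℕ) : ℤ) by push_cast; rfl,
    zpow_natCast, pow_mul, one_div, map_inv₀, inv_pow, map_pow, ← map_pow, Even.neg_pow (by decide),
    map_pow]

theorem torusChar_neg_two_mul_add_one (φ : F) (a : Fˣ) (ha : -(2 * φ) = a) (u : ℕ) :
    torusChar τ (-(2 * u + 1) : ZMod M) a = τ (1 / (2 * φ) ^ 2) ^ u * (τ (-2 * φ))⁻¹ := by
  have h1 : torusChar τ (1 : ZMod M) a = τ a := by
    simpa using torusChar_natCast hM τ 1 a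
  rw [neg_add, torusChar_add hM, torusChar_neg_two_mul hM φ a ha, torusChar_neg hM, h1, ← ha,
    neg_mul]

/-- Regrouping a^(t-2u) b^(-4t) as (a⁻²)^u (a b⁻⁴)^t gives the parameters μ and Ψ; the sign of a
survives only in Ψ. -/
theorem torusChar_mul_torusChar (φ ψ : F) (a b : Fˣ) (ha : -(2 * φ) = a) (hb : -(8 * ψ) = b)
    (u t : ℕ) : torusChar τ (t - 2 * u : ZMod M) a * torusChar τ (-(4 * t) : ZMod M) b =
      τ (1 / (2 * φ) ^ 2) ^ u * τ (-2 * φ / (8 * ψ) ^ 4) ^ t := by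
  have h1 : (-(4 * t) : ZMod M) = ((-(4 * t) : ℤ) : ZMod M) := by push_cast; rfl
  have h2 : -2 * φ / (8 * ψ) ^ 4 = a * ((b : F) ^ 4)⁻¹ := by
    rw [← ha, ← hb, Even.neg_pow (by decide)]
    ring
  rw [sub_eq_add_neg, torusChar_add hM, torusChar_neg_two_mul hM φ a ha, torusChar_natCast hM,
    h1, torusChar_intCast hM, zpow_neg, show (4 * t : ℤ) = ((4 * t : ℕ) : ℤ) by push_cast; rfl,
    zpow_natCast, pow_mul, h2, map_mul, map_inv₀, mul_pow (τ a), inv_pow, map_pow _ (b : F),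
    mul_comm (τ a ^ t), mul_assoc]

end ClassSums

/-! ### The affine sum as a combination of class sums. -/

section MonomialFormulas

variable {K : Type*} [Field K] [CharZero K] {M : ℕ} [NeZero M] {J J' : Type*} [Fintype J]
  [Fintype J'] {lam : J → ℕ} {A B : ℕ} {d₁ : J → Fin 2 → ZMod M} {d₂ : J → Fin 3 → ZMod M}
  {lam' : J' → ℕ} {d₁' : J' → Fin 2 → ZMod M} {d₂' : J' → Fin 3 → ZMod M} {c c' : ZMod M}
  {F : Type*} [Field F] [Fintype F] [DecidableEq F]
  (hM : Fintype.card Fˣ = M) {θ : AddChar F K} (hθ : θ ≠ 1) {τ : F →*₀ K}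
  (hτ : Function.Injective τ)
include hM hτ

theorem powUnitSum_eq (θ : AddChar F K) (d : ℕ) (y : Fˣ) : powUnitSum θ d (y : F) =
    ∑ n : ZMod M, if d * n = 0 then gaussZ θ τ (-n) * torusChar τ n y else 0 :=
  sum_units_addChar_pow hM θ hτ d y

theorem sum_powUnitSum_mul_powUnitSum (θ : AddChar F K) :
    ∑ y : Fˣ, powUnitSum θ 8 (y : F) ^ 2 * powUnitSum θ 4 (y : F) ^ 3 =
      M * octicSum (0 : ZMod M) (fun n => gaussZ θ τ (-n)) (fun n => gaussZ θ τ (-n)) := by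
  rw [← sum_units_pow_mul_pow hM hτ]
  simp only [powUnitSum_eq hM hτ]
  rfl

theorem two_mul_sum_binaryUnitSum_mul_powUnitSum (θ : AddChar F K) (hMe : Even M)
    (a : Fˣ) :
    2 * ∑ y : Fˣ, binaryUnitSum θ (a : F) y * powUnitSum θ 4 (y : F) ^ 3 =
      ∑ u : ZMod M, (gaussZ θ τ (2 * u) * torusChar τ (-(2 * u)) a) *
          octicSum 0 (fun n => gaussZ θ τ (-(n + u))) (fun n => gaussZ θ τ (-n)) +
      ∑ u : ZMod M, (gaussZ θ τ (2 * u + 1) * torusChar τ (-(2 * u + 1)) a) *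
          octicSum 1 (fun n => gaussZ θ τ (-(n + u))) (fun n => gaussZ θ τ (-n)) := by
  rw [← Finset.sum_add_distrib, ← sum_binaryUnitSum_mul hM θ hτ hMe]
  simp only [powUnitSum_eq hM hτ]
  rfl

include hθ

theorem powSum_eq {d : ℕ} (hd : d ≠ 0) (y : Fˣ) : powSum θ d (y : F) =
    ∑ n : ZMod M, if d * n = 0 then
      (if n = 0 then 0 else gaussZ θ τ (-n)) * torusChar τ n y else 0 :=
  sum_addChar_pow hM θ hτ hθ hd y

theorem sum_powUnitSum_mul_powSum :
    ∑ y : Fˣ, powUnitSum θ 8 (y : F) ^ 2 * powSum θ 4 (y : F) ^ 3 =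
      M * octicSum (0 : ZMod M) (fun n => gaussZ θ τ (-n))
        (fun n => if n = 0 then 0 else gaussZ θ τ (-n)) := by
  rw [← sum_units_pow_mul_pow hM hτ]
  simp only [powUnitSum_eq hM hτ, powSum_eq hM hθ hτ (d := 4) (by norm_num)]
  rfl

theorem sum_powSum_mul_powSum :
    ∑ y : Fˣ, powSum θ 8 (y : F) ^ 2 * powSum θ 4 (y : F) ^ 3 =
      M * octicSum (0 : ZMod M) (fun n => if n = 0 then 0 else gaussZ θ τ (-n))
        (fun n => if n = 0 then 0 else gaussZ θ τ (-n)) := by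
  rw [← sum_units_pow_mul_pow hM hτ]
  simp only [powSum_eq hM hθ hτ (d := 4) (by norm_num), powSum_eq hM hθ hτ (d := 8) (by norm_num)]
  rfl

theorem octicAffineSum_zero_zero (h : IsClassSum K 0 lam A d₁ d₂ c) :
    octicAffineSum θ 0 0 = M * ∑ a ∈ Finset.range A,
      ∑ j with (∀ i, ¬ d₁ j i + a * c = 0) ∧ ∀ i, ¬ d₂ j i + 2 * a * c = 0,
        (lam j : K) * (∏ i, gaussZ (M := M) θ τ (-(d₁ j i + a * c))) *
          ∏ i, gaussZ (M := M) θ τ (-(d₂ j i + 2 * a * c)) := by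
  rw [octicAffineSum_eq, octicTorusSum_zero_right, ← h.octicSum_ite (fun n => gaussZ θ τ (-n))
    (fun n => gaussZ θ τ (-n)), ← sum_powSum_mul_powSum hM hθ hτ]
  simp only [mul_zero, neg_zero, binaryUnitSum_zero]
  ring

/-- The 2B translates contribute equally to the sum over w, because 8w only depends on w modulo
8-torsion. Their number cancels `torsionEight M`. The correction compares the full diagonal sum with
its torus part, so it subtracts every class with some zero index. -/
theorem octicAffineSum_zero_left (hB : B ≠ 0) (h : IsClassSum K 0 lam (2 * B) d₁ d₂ c)
    (hc : 8 * c = 0) (ht : torsionEight M = 2 * B) {ψ : F} (b : Fˣ) (hb : -(8 * ψ) = b) :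
    octicAffineSum θ 0 ψ = ∑ w ∈ Finset.range M, ∑ j, (lam j : K) *
        (∏ i, gaussZ (M := M) θ τ (-(d₁ j i + w))) * (∏ i, gaussZ (M := M) θ τ (-(d₂ j i + 2 * w))) *
        gaussZ θ τ (8 * w : ZMod M) * τ (1 / (8 * ψ) ^ 8) ^ w
      - M * ∑ a ∈ Finset.range (2 * B),
        ∑ j with (∃ i, d₁ j i + a * c = 0) ∨ ∃ i, d₂ j i + 2 * a * c = 0,
          (lam j : K) * (∏ i, gaussZ (M := M) θ τ (-(d₁ j i + a * c))) *
            ∏ i, gaussZ (M := M) θ τ (-(d₂ j i + 2 * a * c)) := by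
  have hB0 : ((2 * B : ℕ) : K) ≠ 0 := by exact_mod_cast (by omega : 2 * B ≠ 0)
  have h1 := torsionEight_mul_octicTorusSum_zero hM θ hτ ψ b hb
  rw [h.sum_mul_octicSum (fun n => gaussZ θ τ (-n)) (fun n => gaussZ θ τ (-n))
    (fun w => gaussZ θ τ (8 * w) * torusChar τ (-(8 * w)) b), ht] at h1
  swap
  · intro a w
    have : 8 * (w - a * c) = 8 * w := by linear_combination -a * hc
    simp only [this]
  rw [octicAffineSum_eq, mul_left_cancel₀ hB0 h1, ← h.octicSum_sub_ite (fun n => gaussZ θ τ (-n))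
    (fun n => gaussZ θ τ (-n)), mul_sub, ← sum_powSum_mul_powSum hM hθ hτ,
    ← sum_powUnitSum_mul_powUnitSum hM hτ, ZMod.sum_eq_sum_range]
  simp only [mul_zero, neg_zero, binaryUnitSum_zero, torusChar_neg_eight_mul hM ψ b hb, mul_assoc]
  ring

theorem two_mul_sum_binaryUnitSum_mul_powSum (hMe : Even M) (a : Fˣ) :
    2 * ∑ y : Fˣ, binaryUnitSum θ (a : F) y * powSum θ 4 (y : F) ^ 3 =
      ∑ u : ZMod M, (gaussZ θ τ (2 * u) * torusChar τ (-(2 * u)) a) *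
          octicSum 0 (fun n => gaussZ θ τ (-(n + u)))
            (fun n => if n = 0 then 0 else gaussZ θ τ (-n)) +
      ∑ u : ZMod M, (gaussZ θ τ (2 * u + 1) * torusChar τ (-(2 * u + 1)) a) *
          octicSum 1 (fun n => gaussZ θ τ (-(n + u)))
            (fun n => if n = 0 then 0 else gaussZ θ τ (-n)) := by
  rw [← Finset.sum_add_distrib, ← sum_binaryUnitSum_mul hM θ hτ hMe]
  simp only [powSum_eq hM hθ hτ (d := 4) (by norm_num)]
  rfl

/-- The full sums in x₃, x₄, x₅ exclude the zero index there throughout. The factor 2 from splitting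
r by parity cancels the factor 2 from the repeated translates. The subtracted term is the locus x₁x₂
= 0. -/
theorem octicAffineSum_zero_right (hMe : Even M) (h : IsClassSum K 0 lam (2 * B) d₁ d₂ c)
    (h' : IsClassSum K 1 lam' (2 * B) d₁' d₂' c)
    (hc : 2 * B * c = 0) {φ : F} (a : Fˣ) (ha : -(2 * φ) = a) :
    octicAffineSum θ φ 0 =
      ∑ u ∈ Finset.range M, ∑ a ∈ Finset.range B, ∑ j with ∀ i, ¬ d₂ j i + 2 * a * c = 0,
        (lam j : K) * (∏ i, gaussZ (M := M) θ τ (-(d₁ j i + a * c + u))) *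
          (∏ i, gaussZ (M := M) θ τ (-(d₂ j i + 2 * a * c))) * gaussZ θ τ (2 * u : ZMod M) *
          τ (1 / (2 * φ) ^ 2) ^ u
      + ∑ u ∈ Finset.range M, ∑ a ∈ Finset.range B, ∑ j with ∀ i, ¬ d₂' j i + 2 * a * c = 0,
        (lam' j : K) * (∏ i, gaussZ (M := M) θ τ (-(d₁' j i + a * c + u))) *
          (∏ i, gaussZ (M := M) θ τ (-(d₂' j i + 2 * a * c))) * gaussZ θ τ (2 * u + 1 : ZMod M) *
          τ (1 / (2 * φ) ^ 2) ^ u * (τ (-2 * φ))⁻¹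
      - M * ∑ a ∈ Finset.range (2 * B),
        ∑ j with (∃ i, d₁ j i + a * c = 0) ∧ ∀ i, ¬ d₂ j i + 2 * a * c = 0,
          (lam j : K) * (∏ i, gaussZ (M := M) θ τ (-(d₁ j i + a * c))) *
            ∏ i, gaussZ (M := M) θ τ (-(d₂ j i + 2 * a * c)) := by
  have h1 := two_mul_sum_binaryUnitSum_mul_powSum hM hθ hτ hMe a
  rw [h.sum_mul_octicSum_ite hc (fun n => gaussZ θ τ (-n)) (fun n => gaussZ θ τ (-n))
    (fun u => gaussZ θ τ (2 * u) * torusChar τ (-(2 * u)) a),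
    h'.sum_mul_octicSum_ite hc (fun n => gaussZ θ τ (-n)) (fun n => gaussZ θ τ (-n))
    (fun u => gaussZ θ τ (2 * u + 1) * torusChar τ (-(2 * u + 1)) a), ← mul_add] at h1
  · rw [octicAffineSum_eq, octicTorusSum_zero_right, ha, mul_left_cancel₀ two_ne_zero h1,
      ← h.octicSum_sub_ite_left (fun n => gaussZ θ τ (-n)) (fun n => gaussZ θ τ (-n)), mul_sub,
      ← sum_powSum_mul_powSum hM hθ hτ, ← sum_powUnitSum_mul_powSum hM hθ hτ,
      ZMod.sum_eq_sum_range, ZMod.sum_eq_sum_range]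
    simp only [torusChar_neg_two_mul hM φ a ha, torusChar_neg_two_mul_add_one hM φ a ha, mul_assoc]
    ring
  · intro u
    have : 2 * (u - B * c) = 2 * u := by linear_combination -hc
    simp only [this]
  · intro u
    have : 2 * (u - B * c) = 2 * u := by linear_combination -hc
    simp only [this]

/-- The double sum is the torus part. The next two subtracted sums exchange torus for affine sums in
x₃, x₄, x₅, so they retain classes with a zero among the last three indices, for even and odd
exponent of the φ-monomial. The last one is the locus x₁x₂ = 0. -/
theorem octicAffineSum_eq_sum_classes (hMe : Even M) (hB : B ≠ 0)
    (h : IsClassSum K 0 lam (2 * B) d₁ d₂ c) (h' : IsClassSum K 1 lam' (2 * B) d₁' d₂' c)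
    (hc : 2 * B * c = 0) (hc8 : 8 * c = 0) (ht : torsionEight M = 2 * B) {φ ψ : F} (a b : Fˣ)
    (ha : -(2 * φ) = a) (hb : -(8 * ψ) = b) :
    M * octicAffineSum θ φ ψ =
      ∑ t ∈ Finset.range M, ∑ u ∈ Finset.Icc ((t + 1) / 2) ((2 * (M + 1) - 3 + t) / 2),
        ∑ j, (lam j : K) * (∏ i, gaussZ (M := M) θ τ (-(d₁ j i + u))) *
          (∏ i, gaussZ (M := M) θ τ (-(d₂ j i + t))) * gaussZ θ τ (2 * u - t : ZMod M) *
          gaussZ θ τ (4 * t : ZMod M) * τ (1 / (2 * φ) ^ 2) ^ u *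
          τ (-2 * φ / (8 * ψ) ^ 4) ^ t
      - M * (∑ u ∈ Finset.range M, ∑ a ∈ Finset.range B, ∑ j with ∃ i, d₂ j i + 2 * a * c = 0,
        (lam j : K) * (∏ i, gaussZ (M := M) θ τ (-(d₁ j i + a * c + u))) *
          (∏ i, gaussZ (M := M) θ τ (-(d₂ j i + 2 * a * c))) * gaussZ θ τ (2 * u : ZMod M) *
          τ (1 / (2 * φ) ^ 2) ^ u)
      - M * (∑ u ∈ Finset.range M, ∑ a ∈ Finset.range B, ∑ j with ∃ i, d₂' j i + 2 * a * c = 0,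
        (lam' j : K) * (∏ i, gaussZ (M := M) θ τ (-(d₁' j i + a * c + u))) *
          (∏ i, gaussZ (M := M) θ τ (-(d₂' j i + 2 * a * c))) * gaussZ θ τ (2 * u + 1 : ZMod M) *
          τ (1 / (2 * φ) ^ 2) ^ u * (τ (-2 * φ))⁻¹)
      - M * (M * ∑ a ∈ Finset.range (2 * B),
        ∑ j with (∃ i, d₁ j i + a * c = 0) ∧ ∀ i, ¬ d₂ j i + 2 * a * c = 0,
          (lam j : K) * (∏ i, gaussZ (M := M) θ τ (-(d₁ j i + a * c))) *
            ∏ i, gaussZ (M := M) θ τ (-(d₂ j i + 2 * a * c))) := by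
  have hB0 : ((2 * B : ℕ) : K) ≠ 0 := by exact_mod_cast (by omega : 2 * B ≠ 0)
  have h1 := two_mul_sum_binaryUnitSum_mul_powUnitSum hM hτ θ hMe a
  have h2 := two_mul_sum_binaryUnitSum_mul_powSum hM hθ hτ hMe a
  have hX : ∀ u : ZMod M, 2 * (u - B * c) = 2 * u := fun u => by linear_combination -hc
  have e1 := h.sum_mul_octicSum_sub_ite hc (fun n => gaussZ θ τ (-n)) (fun n => gaussZ θ τ (-n))
    (fun u => gaussZ θ τ (2 * u) * torusChar τ (-(2 * u)) a) (fun u => by simp only [hX])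
  have e2 := h'.sum_mul_octicSum_sub_ite hc (fun n => gaussZ θ τ (-n)) (fun n => gaussZ θ τ (-n))
    (fun u => gaussZ θ τ (2 * u + 1) * torusChar τ (-(2 * u + 1)) a) (fun u => by simp only [hX])
  have h3 := torsionEight_mul_octicTorusSum hM θ hτ φ ψ a b ha hb
  rw [h.sum_sum_mul_octicSum (fun n => gaussZ θ τ (-n)) (fun n => gaussZ θ τ (-n))
    (fun u t => gaussZ θ τ (2 * u - t) * torusChar τ (t - 2 * u) a *
        (gaussZ θ τ (4 * t) * torusChar τ (-(4 * t)) b)), ht] at h3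
  swap
  · intro a u t
    have h4 : 2 * (u - a * c) - (t - 2 * a * c) = 2 * u - t := by ring
    have h5 : (t - 2 * a * c) - 2 * (u - a * c) = t - 2 * u := by ring
    have h6 : 4 * (t - 2 * a * c) = 4 * t := by linear_combination -a * hc8
    simp only [h4, h5, h6]
  have h7 := mul_left_cancel₀ hB0 h3
  rw [Finset.sum_comm, ZMod.sum_eq_sum_range] at h7
  rw [Finset.sum_congr rfl fun t _ => ZMod.sum_eq_sum_Icc _ t] at h7
  simp only [torusChar_neg_two_mul hM φ a ha, torusChar_neg_two_mul_add_one hM φ a ha,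
    ZMod.sum_eq_sum_range] at e1 e2 h1 h2
  have h8 : ∀ u t : ℕ, gaussZ θ τ (2 * u - t : ZMod M) * torusChar τ (t - 2 * u : ZMod M) a *
      (gaussZ θ τ (4 * t : ZMod M) * torusChar τ (-(4 * t) : ZMod M) b) =
      gaussZ θ τ (2 * u - t : ZMod M) * (gaussZ θ τ (4 * t : ZMod M) *
        (τ (1 / (2 * φ) ^ 2) ^ u * τ (-2 * φ / (8 * ψ) ^ 4) ^ t)) := fun u t => by
    rw [← torusChar_mul_torusChar hM φ ψ a b ha hb]
    ring
  simp only [h8] at h7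
  rw [octicAffineSum_eq, ha, mul_add, mul_add, mul_sub, h7,
    sum_powSum_mul_powSum hM hθ hτ, sum_powUnitSum_mul_powSum hM hθ hτ,
    ← h.octicSum_sub_ite_left (fun n => gaussZ θ τ (-n)) (fun n => gaussZ θ τ (-n))]
  simp only [mul_assoc] at e1 e2 h1 h2 ⊢
  -- The halves remove the factors 2 present in all four identities.
  linear_combination -(M : K) / 2 * h1 + (M : K) / 2 * h2 - (M : K) / 2 * e1 - (M : K) / 2 * e2

end MonomialFormulas

/-! ### The surviving translates, according to q - 1 modulo 8. -/

section Classes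

variable {K : Type*} [Field K] {M : ℕ} [NeZero M]

omit [NeZero M] in
theorem divValue_mul {d : ℤ} (hd : d ≠ 0) (f : ZMod M → K) {x y : ℤ} (h : x = d * y) :
    divValue d f x = f y := by
  rw [divValue, if_pos ⟨y, h⟩, h, Int.mul_ediv_cancel_left _ hd]

omit [NeZero M] in
theorem divValue_of_not_dvd {d : ℤ} (f : ZMod M → K) {x : ℤ} (h : ¬ d ∣ x) :
    divValue d f x = 0 := if_neg h

theorem even_octicMonomial (j : Fin 15) (i : Fin 2) : ∃ e, (octicMonomial j).1 i = 2 * e := by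
  have h : ∀ j i, (octicMonomial j).1 i = 2 * ((octicMonomial j).1 i / 2) := by decide
  exact ⟨_, h j i⟩

/-- The indices among the 15 classes of the four classes of `octicMonomialFour`. -/
def octicIndexFour : Fin 4 → Fin 15 := ![0, 2, 3, 5]

theorem octicMonomial_indexFour (j : Fin 4) :
    octicMonomial (octicIndexFour j) = octicMonomialFour j := by
  fin_cases j <;> rfl

theorem octicWeight_indexFour (j : Fin 4) :
    octicWeight (octicIndexFour j) = octicWeightFour j := by
  fin_cases j <;> rfl

theorem octicMonomialFour_left (j : Fin 4) (i : Fin 2) :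
    ∃ e, (octicMonomialFour j).1 i = 4 * e := by
  have h : ∀ j i, (octicMonomialFour j).1 i = 4 * ((octicMonomialFour j).1 i / 4) := by decide
  exact ⟨_, h j i⟩

theorem octicMonomialFour_right (j : Fin 4) (i : Fin 3) :
    ∃ e, (octicMonomialFour j).2 i = 2 * e := by
  have h : ∀ j i, (octicMonomialFour j).2 i = 2 * ((octicMonomialFour j).2 i / 2) := by decide
  exact ⟨_, h j i⟩

theorem exists_odd_of_notMem_range (j : Fin 15) (h : j ∉ Set.range octicIndexFour) :
    ∃ i, (octicMonomial j).2 i % 2 = 1 := by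
  have : ∀ j : Fin 15, (∀ j', octicIndexFour j' ≠ j) → ∃ i, (octicMonomial j).2 i % 2 = 1 := by
    decide
  exact this j fun j' hj => h ⟨j', hj⟩

theorem isClassSum_zero_of_eight {k : ℤ} (hk : (M : ℤ) = 8 * k) :
    IsClassSum K (0 : ZMod M) octicWeight (2 * 4)
      (fun j i => (((octicMonomial j).1 i * k : ℤ) : ZMod M))
      (fun j i => ((2 * (octicMonomial j).2 i * k : ℤ) : ZMod M)) (k : ZMod M) := by
  intro f₁ f₂
  have h := octicSum_eq_sum_classes (M := M) 0 f₁ f₂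
  rw [Int.cast_zero] at h
  simp_rw [h, Finset.mul_sum]
  rw [Finset.sum_comm]
  refine Finset.sum_congr rfl fun a _ => Finset.sum_congr rfl fun j _ => ?_
  rw [← mul_assoc]
  congr 1
  · congr 1
    refine Finset.prod_congr rfl fun i _ => ?_
    rw [divValue_mul (y := ((octicMonomial j).1 i + a) * k) (by norm_num) f₁ (by rw [hk]; ring)]
    congr 1
    push_cast
    ring
  · refine Finset.prod_congr rfl fun i _ => ?_
    rw [divValue_mul (y := 2 * ((octicMonomial j).2 i + a) * k) (by norm_num) f₂
      (by rw [hk]; ring)]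
    congr 1
    push_cast
    ring

/-- When 8 divides M, the congruence 8n = 4 modulo M has no solution; hence the empty index type. -/
theorem isClassSum_one_of_eight {k : ℤ} (hk : (M : ℤ) = 8 * k) :
    IsClassSum K (1 : ZMod M) (fun _ : Fin 0 => 0) (2 * 4) (fun _ _ => 0) (fun _ _ => 0)
      (k : ZMod M) := by
  intro f₁ f₂
  have h := octicSum_eq_sum_classes (M := M) 1 f₁ f₂
  rw [Int.cast_one] at h
  rw [h]
  simp only [Finset.univ_eq_empty, Finset.sum_empty, Finset.sum_const_zero]
  refine Finset.sum_eq_zero fun j _ => mul_eq_zero_of_right _ <| Finset.sum_eq_zero fun a _ =>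
    mul_eq_zero_of_left (Finset.prod_eq_zero (Finset.mem_univ 0) (divValue_of_not_dvd _ ?_)) _
  rw [hk, show ((octicMonomial j).1 0 + a) * (8 * k) + 4 * 1 =
    8 * (((octicMonomial j).1 0 + a) * k) + 4 by ring]
  omega

/-- With M = 4l and l odd, (v₁ + a)M is divisible by 8 only for v₁ + a even. The representatives
have even first entries, so exactly the even translates survive. -/
theorem isClassSum_zero_of_four {l : ℤ} (hl : (M : ℤ) = 4 * l) (hl2 : l % 2 = 1) :
    IsClassSum K (0 : ZMod M) octicWeight (2 * 2)
      (fun j i => (((octicMonomial j).1 i / 2 * l : ℤ) : ZMod M))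
      (fun j i => (((octicMonomial j).2 i * l : ℤ) : ZMod M)) (l : ZMod M) := by
  intro f₁ f₂
  have h := octicSum_eq_sum_classes (M := M) 0 f₁ f₂
  rw [Int.cast_zero] at h
  simp_rw [h, Finset.mul_sum]
  rw [Finset.sum_comm, show 8 = 2 * 4 by norm_num, Finset.sum_range_two_mul]
  refine Finset.sum_congr rfl fun a _ => ?_
  rw [← Finset.sum_add_distrib]
  refine Finset.sum_congr rfl fun j _ => ?_
  have hodd : ∏ i, divValue 8 f₁ (((octicMonomial j).1 i + (2 * a + 1 : ℕ)) * M + 4 * 0) = 0 := by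
    refine Finset.prod_eq_zero (Finset.mem_univ 0) (divValue_of_not_dvd _ ?_)
    obtain ⟨e, he⟩ := even_octicMonomial j 0
    obtain ⟨l', hl'⟩ : ∃ l', l = 2 * l' + 1 := ⟨l / 2, by omega⟩
    rw [hl, he, hl', show (2 * e + (2 * a + 1 : ℕ)) * (4 * (2 * l' + 1)) + 4 * 0 =
      8 * ((2 * e + (2 * a + 1 : ℕ)) * l' + e + a) + 4 by push_cast; ring]
    omega
  rw [hodd, zero_mul, mul_zero (octicWeight j : K), add_zero (octicWeight j * _ : K), ← mul_assoc]
  congr 1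
  · congr 1
    refine Finset.prod_congr rfl fun i _ => ?_
    have he : (octicMonomial j).1 i = 2 * ((octicMonomial j).1 i / 2) := by
      obtain ⟨e, he⟩ := even_octicMonomial j i
      omega
    rw [divValue_mul (y := (octicMonomial j).1 i / 2 * l + a * l) (by norm_num) f₁
      (by rw [hl]; push_cast; linear_combination 4 * l * he)]
    congr 1
    push_cast
    ring
  · refine Finset.prod_congr rfl fun i _ => ?_
    rw [divValue_mul (y := ((octicMonomial j).2 i + 2 * a) * l) (by norm_num) f₂
      (by rw [hl]; push_cast; ring)]
    congr 1
    push_cast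
    ring

/-- Now (v₁ + a)4l + 4 must be divisible by 8, so the odd translates survive. Since (v₁ + 1)l + 1 is
even, the quotient by 2 is exact. -/
theorem isClassSum_one_of_four {l : ℤ} (hl : (M : ℤ) = 4 * l) (hl2 : l % 2 = 1) :
    IsClassSum K (1 : ZMod M) octicWeight (2 * 2)
      (fun j i => (((((octicMonomial j).1 i + 1) * l + 1) / 2 : ℤ) : ZMod M))
      (fun j i => ((((octicMonomial j).2 i + 1) * l : ℤ) : ZMod M)) (l : ZMod M) := by
  intro f₁ f₂
  have h := octicSum_eq_sum_classes (M := M) 1 f₁ f₂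
  rw [Int.cast_one] at h
  simp_rw [h, Finset.mul_sum]
  rw [Finset.sum_comm, show 8 = 2 * 4 by norm_num, Finset.sum_range_two_mul]
  refine Finset.sum_congr rfl fun a _ => ?_
  rw [← Finset.sum_add_distrib]
  refine Finset.sum_congr rfl fun j _ => ?_
  obtain ⟨l', hl'⟩ : ∃ l', l = 2 * l' + 1 := ⟨l / 2, by omega⟩
  have heven : ∏ i, divValue 8 f₁ (((octicMonomial j).1 i + (2 * a : ℕ)) * M + 4 * 1) = 0 := by
    refine Finset.prod_eq_zero (Finset.mem_univ 0) (divValue_of_not_dvd _ ?_)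
    obtain ⟨e, he⟩ := even_octicMonomial j 0
    rw [hl, he, hl', show (2 * e + (2 * a : ℕ)) * (4 * (2 * l' + 1)) + 4 * 1 =
      8 * ((e + a) * (2 * l' + 1)) + 4 by push_cast; ring]
    omega
  rw [heven, zero_mul, mul_zero, zero_add, ← mul_assoc]
  congr 1
  · congr 1
    refine Finset.prod_congr rfl fun i _ => ?_
    obtain ⟨e, he⟩ := even_octicMonomial j i
    have he' : ((octicMonomial j).1 i + 1) * l + 1 = 2 * (e * l + l' + 1) := by
      rw [he, hl']; ring
    rw [divValue_mul (y := (((octicMonomial j).1 i + 1) * l + 1) / 2 + a * l) (by norm_num) f₁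
      (by rw [he', Int.mul_ediv_cancel_left _ (by norm_num), hl, he, hl']; push_cast; ring)]
    congr 1
    push_cast
    ring
  · refine Finset.prod_congr rfl fun i _ => ?_
    rw [divValue_mul (y := ((octicMonomial j).2 i + (2 * a + 1)) * l) (by norm_num) f₂
      (by rw [hl]; push_cast; ring)]
    congr 1
    push_cast
    ring

/-- When `M` is not divisible by 4, only the four classes contribute. -/
theorem octicSum_eq_sum_classes_four {m : ℤ} (hm : (M : ℤ) = 2 * m) (hm2 : m % 2 = 1) (r : ℤ)
    (hr : r = 0 ∨ r = 1) (f₁ f₂ : ZMod M → K) :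
    octicSum (r : ZMod M) f₁ f₂ = ∑ j, (octicWeightFour j : K) * ∑ a ∈ Finset.range 2,
      (∏ i, divValue 8 f₁ (((octicMonomialFour j).1 i + 2 * r + 4 * a) * M + 4 * r)) *
        ∏ i, divValue 4 f₂ (((octicMonomialFour j).2 i + 2 * r + 4 * a) * M) := by
  obtain ⟨m', rfl⟩ : ∃ m', m = 2 * m' + 1 := ⟨m / 2, by omega⟩
  rw [octicSum_eq_sum_classes]
  symm
  have hinj : Function.Injective octicIndexFour := by decide
  -- Each of the other eleven classes has an odd entry among the last three, while its first two are
  -- even. An even translate leaves that odd entry and an odd translate makes the first entry odd;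
  -- either way some index is not integral.
  refine Fintype.sum_of_injective _ hinj _ _ (fun j hj => ?_) fun j => ?_
  · obtain ⟨i, hi⟩ := exists_odd_of_notMem_range j hj
    refine mul_eq_zero_of_right _ (Finset.sum_eq_zero fun a _ => ?_)
    obtain ⟨n, hn | hn⟩ := Nat.even_or_odd' a
    · refine mul_eq_zero_of_right _
        (Finset.prod_eq_zero (Finset.mem_univ i) (divValue_of_not_dvd _ ?_))
      obtain ⟨e, he⟩ : ∃ e, (octicMonomial j).2 i = 2 * e + 1 :=
        ⟨(octicMonomial j).2 i / 2, by omega⟩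
      rw [hm, he, hn, show (2 * e + 1 + (2 * n : ℕ)) * (2 * (2 * m' + 1)) =
        4 * ((e + n) * (2 * m' + 1) + m') + 2 by push_cast; ring]
      omega
    · refine mul_eq_zero_of_left
        (Finset.prod_eq_zero (Finset.mem_univ 0) (divValue_of_not_dvd _ ?_)) _
      obtain ⟨e, he⟩ := even_octicMonomial j 0
      rw [hm, he, hn, show (2 * e + (2 * n + 1 : ℕ)) * (2 * (2 * m' + 1)) + 4 * r =
        4 * ((e + n) * (2 * m' + 1) + m' + r) + 2 by push_cast; ring]
      omega
  · rw [octicWeight_indexFour, octicMonomial_indexFour]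
    congr 1
    -- For the four classes the first index is integral only if a ≡ 2r modulo 4: translates 0 and 4
    -- when r = 0, translates 2 and 6 when r = 1.
    have hz : ∀ a : ℕ, ¬ (4 : ℤ) ∣ a - 2 * r →
        ∏ i, divValue 8 f₁ (((octicMonomialFour j).1 i + a) * M + 4 * r) = 0 := fun a ha => by
      refine Finset.prod_eq_zero (Finset.mem_univ 0) (divValue_of_not_dvd _ fun h => ha ?_)
      obtain ⟨e, he⟩ := octicMonomialFour_left j 0
      rw [hm, he, show (4 * e + a) * (2 * (2 * m' + 1)) + 4 * r =
        8 * (e * (2 * m' + 1)) + 4 * (a * m') + 2 * a + 4 * r by ring] at h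
      obtain ⟨a', ha'⟩ : ∃ a' : ℤ, (a : ℤ) = 2 * a' := ⟨(a : ℤ) / 2, by omega⟩
      rw [ha', mul_assoc] at h
      omega
    obtain rfl | rfl := hr
    · simp only [Finset.sum_range_succ, Finset.sum_range_zero]
      rw [hz 1 (by norm_num), hz 2 (by norm_num), hz 3 (by norm_num), hz 5 (by norm_num),
        hz 6 (by norm_num), hz 7 (by norm_num)]
      simp
    · simp only [Finset.sum_range_succ, Finset.sum_range_zero]
      rw [hz 0 (by norm_num), hz 1 (by norm_num), hz 3 (by norm_num), hz 4 (by norm_num),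
        hz 5 (by norm_num), hz 7 (by norm_num)]
      simp [add_assoc]

theorem isClassSum_zero_of_two {m : ℤ} (hm : (M : ℤ) = 2 * m) (hm2 : m % 2 = 1) :
    IsClassSum K (0 : ZMod M) octicWeightFour (2 * 1)
      (fun j i => (((octicMonomialFour j).1 i / 4 * m : ℤ) : ZMod M))
      (fun j i => (((octicMonomialFour j).2 i / 2 * m : ℤ) : ZMod M)) (m : ZMod M) := by
  intro f₁ f₂
  have h := octicSum_eq_sum_classes_four hm hm2 0 (Or.inl rfl) f₁ f₂
  rw [Int.cast_zero] at h
  simp_rw [h, Finset.mul_sum]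
  rw [Finset.sum_comm]
  refine Finset.sum_congr rfl fun a _ => Finset.sum_congr rfl fun j _ => ?_
  rw [← mul_assoc]
  congr 1
  · congr 1
    refine Finset.prod_congr rfl fun i _ => ?_
    obtain ⟨e, he⟩ := octicMonomialFour_left j i
    rw [divValue_mul (y := (octicMonomialFour j).1 i / 4 * m + a * m) (by norm_num) f₁
      (by rw [he, Int.mul_ediv_cancel_left _ (by norm_num), hm]; ring)]
    congr 1
    push_cast
    ring
  · refine Finset.prod_congr rfl fun i _ => ?_
    obtain ⟨e, he⟩ := octicMonomialFour_right j i
    rw [divValue_mul (y := (octicMonomialFour j).2 i / 2 * m + 2 * a * m) (by norm_num) f₂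
      (by rw [he, Int.mul_ediv_cancel_left _ (by norm_num), hm]; ring)]
    congr 1
    push_cast
    ring

theorem isClassSum_one_of_two {m : ℤ} (hm : (M : ℤ) = 2 * m) (hm2 : m % 2 = 1) :
    IsClassSum K (1 : ZMod M) octicWeightFour (2 * 1)
      (fun j i => (((((octicMonomialFour j).1 i + 2) * m + 2) / 4 : ℤ) : ZMod M))
      (fun j i => ((((octicMonomialFour j).2 i + 2) / 2 * m : ℤ) : ZMod M)) (m : ZMod M) := by
  intro f₁ f₂
  have h := octicSum_eq_sum_classes_four hm hm2 1 (Or.inr rfl) f₁ f₂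
  rw [Int.cast_one] at h
  simp_rw [h, Finset.mul_sum]
  rw [Finset.sum_comm]
  refine Finset.sum_congr rfl fun a _ => Finset.sum_congr rfl fun j _ => ?_
  obtain ⟨m', hm'⟩ : ∃ m', m = 2 * m' + 1 := ⟨m / 2, by omega⟩
  rw [← mul_assoc]
  congr 1
  · congr 1
    refine Finset.prod_congr rfl fun i _ => ?_
    obtain ⟨e, he⟩ := octicMonomialFour_left j i
    have he' : ((octicMonomialFour j).1 i + 2) * m + 2 = 4 * (e * m + m' + 1) := by
      rw [he, hm']; ring
    rw [divValue_mul (y := (((octicMonomialFour j).1 i + 2) * m + 2) / 4 + a * m)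
      (by norm_num) f₁
      (by rw [he', Int.mul_ediv_cancel_left _ (by norm_num), hm, he, hm']; ring)]
    congr 1
    push_cast
    ring
  · refine Finset.prod_congr rfl fun i _ => ?_
    obtain ⟨e, he⟩ := octicMonomialFour_right j i
    rw [divValue_mul (y := ((octicMonomialFour j).2 i + 2) / 2 * m + 2 * a * m) (by norm_num) f₂
      (by rw [he, show 2 * e + 2 = 2 * (e + 1) by ring,
        Int.mul_ediv_cancel_left _ (by norm_num), hm]; ring)]
    congr 1
    push_cast
    ring

variable (M) in
theorem torsionEight_eq : torsionEight M =
    ∑ v ∈ Finset.range 8, if (8 : ℤ) ∣ v * M then 1 else 0 := by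
  have h := sum_ite_mul_eq (M := M) (K := ℚ) 8 (by norm_num) 0 (fun _ => 1)
  rw [Finset.sum_boole] at h
  rw [torsionEight]
  simp only [divValue] at h
  push_cast at h
  simp only [add_zero] at h
  exact_mod_cast h

theorem torsionEight_of_eight {k : ℤ} (hk : (M : ℤ) = 8 * k) : torsionEight M = 2 * 4 := by
  rw [torsionEight_eq, hk]
  simp only [Finset.sum_range_succ, Finset.sum_range_zero]
  repeat rw [if_pos (by push_cast; omega)]

theorem torsionEight_of_four {l : ℤ} (hl : (M : ℤ) = 4 * l) (hl2 : l % 2 = 1) :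
    torsionEight M = 2 * 2 := by
  rw [torsionEight_eq, hl]
  simp only [Finset.sum_range_succ, Finset.sum_range_zero]
  push_cast
  split_ifs <;> omega

theorem torsionEight_of_two {m : ℤ} (hm : (M : ℤ) = 2 * m) (hm2 : m % 2 = 1) :
    torsionEight M = 2 * 1 := by
  rw [torsionEight_eq, hm]
  simp only [Finset.sum_range_succ, Finset.sum_range_zero]
  push_cast
  split_ifs <;> omega

end Classes

/-! ### Explicit formulas with integer indices. -/

section Assembly

theorem Finset.sum_range_two_mul_eq {R : Type*} [AddCommMonoid R] (B : ℕ) (f : ℕ → R) :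
    ∑ a ∈ Finset.range (2 * B), f a =
      ∑ b ∈ Finset.range 2, ∑ a ∈ Finset.range B, f (a + B * b) := by
  rw [two_mul, Finset.sum_range_add, Finset.sum_range_succ, Finset.sum_range_one]
  simp [add_comm]

variable {K : Type*} [Field K] [CharZero K] {M : ℕ} [NeZero M] {q : ℕ}

section Solve

theorem eq_of_mul_eq (hq : q = M + 1) {N S : K} (h : q * M * N = M * S) : N = 1 / (q : K) * S := by
  have hM : (M : K) ≠ 0 := by exact_mod_cast NeZero.ne M
  have hq0 : (q : K) ≠ 0 := by rw [hq]; exact_mod_cast M.succ_ne_zero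
  field_simp
  apply mul_left_cancel₀ hM
  linear_combination h

theorem eq_of_mul_eq_sub (hq : q = M + 1) {N X S : K} (h : q * M * N = X - M * S) :
    N = 1 / ((q : K) * (q - 1)) * X - 1 / (q : K) * S := by
  have hM : (M : K) ≠ 0 := by exact_mod_cast NeZero.ne M
  have hq0 : (q : K) ≠ 0 := by rw [hq]; exact_mod_cast M.succ_ne_zero
  have hq1 : (q : K) - 1 = M := by rw [hq]; push_cast; ring
  rw [hq1]
  field_simp
  linear_combination h

theorem eq_of_mul_eq_add_sub (hq : q = M + 1) {N X Y S : K} (h : q * M * N = X + Y - M * S) :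
    N = 1 / ((q : K) * (q - 1)) * X + 1 / ((q : K) * (q - 1)) * Y - 1 / (q : K) * S := by
  rw [eq_of_mul_eq_sub hq h, mul_add]

theorem eq_of_mul_eq_sub_sub_sub (hq : q = M + 1) {N N' X Y Z S : K} (hN : q * M * N = N')
    (h : M * N' = X - M * Y - M * Z - M * (M * S)) :
    N = 1 / ((q : K) * (q - 1) ^ 2) * X - 1 / ((q : K) * (q - 1)) * Y
      - 1 / ((q : K) * (q - 1)) * Z - 1 / (q : K) * S := by
  have hM : (M : K) ≠ 0 := by exact_mod_cast NeZero.ne M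
  have hq0 : (q : K) ≠ 0 := by rw [hq]; exact_mod_cast M.succ_ne_zero
  have hq1 : (q : K) - 1 = M := by rw [hq]; push_cast; ring
  rw [hq1]
  field_simp
  linear_combination h + M * hN

theorem Int.add_two_mul_add_four_mul_ediv (v a b : ℤ) :
    (v + 2 * a + 4 * b) / 2 = v / 2 + a + 2 * b := by
  omega

theorem Int.add_two_mul_add_one_mul_ediv (v a l : ℤ) :
    ((v + 2 * a + 1) * l + 1) / 2 = ((v + 1) * l + 1) / 2 + a * l := by
  rw [← Int.add_mul_ediv_left _ _ two_ne_zero]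
  congr 1
  ring

/-- This turns the vanishing of a character index modulo q - 1 into the conditions Z₂ and Z₅ on the
monomial. -/
theorem ZMod.eq_zero_iff_dvd {d k x : ℤ} (hM : (M : ℤ) = d * k) {z : ZMod M}
    (hz : z = ((x * k : ℤ) : ZMod M)) : z = 0 ↔ d ∣ x := by
  have hM0 : (M : ℤ) ≠ 0 := by exact_mod_cast NeZero.ne M
  have hk : k ≠ 0 := by rintro rfl; simp at hM; omega
  rw [hz, ZMod.intCast_zmod_eq_zero_iff_dvd, hM, mul_dvd_mul_iff_right hk]

end Solve

variable {F : Type*} [Field F] [Fintype F] [DecidableEq F]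
  (hM : Fintype.card Fˣ = M) {θ : AddChar F K} (hθ : θ ≠ 1) {τ : F →*₀ K}
  (hτ : Function.Injective τ) (hq : q = M + 1) {G : ℤ → K}
  (hG : ∀ n : ℤ, G n = gaussZ θ τ (n : ZMod M))

include hG in
omit [CharZero K] [NeZero M] in
theorem mul_prod_gaussZ_eq (w : K) {x₁ : Fin 2 → ZMod M} {y₁ : Fin 2 → ℤ} {x₂ : Fin 3 → ZMod M}
    {y₂ : Fin 3 → ℤ} (h₁ : ∀ i, x₁ i = (y₁ i : ZMod M)) (h₂ : ∀ i, x₂ i = (y₂ i : ZMod M)) :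
    w * (∏ i, gaussZ θ τ (x₁ i)) * ∏ i, gaussZ θ τ (x₂ i) =
      w * (∏ i, G (y₁ i)) * ∏ i, G (y₂ i) := by
  simp only [hG, h₁, h₂]

include hM hθ hτ hq hG

/-- The eight translates are written a + 4b. The part 4b drops out of the last three indices because
it changes them by 8bk, which is zero modulo q - 1. -/
theorem eq_of_affineSum_zero_zero_of_eight {N : K}
    (hN : q * M * N = octicAffineSum θ 0 0) {k : ℤ} (hk : (q : ℤ) - 1 = 8 * k) :
    N = 1 / (q : K) * ∑ b ∈ Finset.range 2, ∑ a ∈ Finset.range 4,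
          ∑ j with (∀ i, ¬ 8 ∣ (octicMonomial j).1 i + a + 4 * b) ∧ (∀ i, ¬ 4 ∣ (octicMonomial j).2 i + a),
          (octicWeight j : K) * (∏ i, G (-(((octicMonomial j).1 i + a + 4 * b) * k))) *
          ∏ i, G (-(2 * ((octicMonomial j).2 i + a) * k)) := by
  have hM8 : (M : ℤ) = 8 * k := by rw [hq] at hk; push_cast at hk; linarith
  have h0 : (8 * k : ZMod M) = 0 := by
    have := congrArg (fun z : ℤ => (z : ZMod M)) hM8
    push_cast at this
    rw [← this, ZMod.natCast_self]
  have hM4 : (M : ℤ) = 4 * (2 * k) := by rw [hM8]; ring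
  rw [octicAffineSum_zero_zero hM hθ hτ (isClassSum_zero_of_eight hM8)] at hN
  rw [eq_of_mul_eq hq hN, Finset.sum_range_two_mul_eq]
  congr 1
  refine Finset.sum_congr rfl fun b _ => Finset.sum_congr rfl fun a _ =>
    Finset.sum_congr (Finset.filter_congr fun j _ => ?_) fun j _ => ?_
  · refine and_congr (forall_congr' fun i => not_congr ?_) (forall_congr' fun i => not_congr ?_)
    · exact ZMod.eq_zero_iff_dvd hM8 (by push_cast; ring)
    · exact ZMod.eq_zero_iff_dvd hM4 (by push_cast; linear_combination b * h0)
  · exact mul_prod_gaussZ_eq hG _ (fun i => by push_cast; ring)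
      fun i => by push_cast; linear_combination -b * h0

theorem eq_of_affineSum_zero_zero_of_four {N : K}
    (hN : q * M * N = octicAffineSum θ 0 0) {l : ℤ} (hl : (q : ℤ) - 1 = 4 * l) (hl8 : ¬ (8 : ℤ) ∣ (q : ℤ) - 1) :
    N = 1 / (q : K) * ∑ a ∈ Finset.range 4,
          ∑ j with (∀ i, ¬ 8 ∣ (octicMonomial j).1 i + 2 * a) ∧ (∀ i, ¬ 4 ∣ (octicMonomial j).2 i + 2 * a),
          (octicWeight j : K) * (∏ i, G (-(((octicMonomial j).1 i + 2 * a) / 2 * l))) *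
          ∏ i, G (-(((octicMonomial j).2 i + 2 * a) * l)) := by
  have hM4 : (M : ℤ) = 4 * l := by rw [hq] at hl; push_cast at hl; linarith
  have hl2 : l % 2 = 1 := by omega
  rw [octicAffineSum_zero_zero hM hθ hτ (isClassSum_zero_of_four hM4 hl2)] at hN
  rw [eq_of_mul_eq hq hN]
  congr 1
  refine Finset.sum_congr rfl fun a _ =>
    Finset.sum_congr (Finset.filter_congr fun j _ => ?_) fun j _ => ?_
  · refine and_congr (forall_congr' fun i => not_congr ?_) (forall_congr' fun i => not_congr ?_)
    · refine (ZMod.eq_zero_iff_dvd (x := (octicMonomial j).1 i / 2 + a) hM4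
        (by push_cast; ring)).trans ?_
      obtain ⟨e, he⟩ := even_octicMonomial j i
      omega
    · exact ZMod.eq_zero_iff_dvd hM4 (by push_cast; ring)
  · exact mul_prod_gaussZ_eq hG _
      (fun i => by rw [Int.add_mul_ediv_left _ _ two_ne_zero]; push_cast; ring)
      fun i => by push_cast; ring

theorem eq_of_affineSum_zero_zero_of_two {N : K}
    (hN : q * M * N = octicAffineSum θ 0 0) {m : ℤ} (hm : (q : ℤ) - 1 = 2 * m) (hm4 : ¬ (4 : ℤ) ∣ (q : ℤ) - 1) :
    N = 1 / (q : K) * ∑ b ∈ Finset.range 2,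
          ∑ j with (∀ i, ¬ 8 ∣ (octicMonomialFour j).1 i + 4 * b) ∧ (∀ i, ¬ 4 ∣ (octicMonomialFour j).2 i),
          (octicWeightFour j : K) * (∏ i, G (-(((octicMonomialFour j).1 i + 4 * b) / 4 * m))) *
          ∏ i, G (-((octicMonomialFour j).2 i / 2 * m)) := by
  have hM2 : (M : ℤ) = 2 * m := by rw [hq] at hm; push_cast at hm; linarith
  have hm2 : m % 2 = 1 := by omega
  have h0 : (2 * m : ZMod M) = 0 := by
    have := congrArg (fun z : ℤ => (z : ZMod M)) hM2
    push_cast at this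
    rw [← this, ZMod.natCast_self]
  rw [octicAffineSum_zero_zero hM hθ hτ (isClassSum_zero_of_two hM2 hm2)] at hN
  rw [eq_of_mul_eq hq hN]
  congr 1
  refine Finset.sum_congr rfl fun a _ =>
    Finset.sum_congr (Finset.filter_congr fun j _ => ?_) fun j _ => ?_
  · refine and_congr (forall_congr' fun i => not_congr ?_) (forall_congr' fun i => not_congr ?_)
    · refine (ZMod.eq_zero_iff_dvd (x := (octicMonomialFour j).1 i / 4 + a) hM2
        (by push_cast; ring)).trans ?_
      obtain ⟨e, he⟩ := octicMonomialFour_left j i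
      omega
    · refine (ZMod.eq_zero_iff_dvd (x := (octicMonomialFour j).2 i / 2) hM2
        (by push_cast; linear_combination a * h0)).trans ?_
      obtain ⟨e, he⟩ := octicMonomialFour_right j i
      omega
  · exact mul_prod_gaussZ_eq hG _
      (fun i => by rw [Int.add_mul_ediv_left _ _ four_ne_zero]; push_cast; ring)
      fun i => by push_cast; linear_combination -a * h0

theorem eq_of_affineSum_zero_left_of_eight {ψ : F} (hψ : -(8 * ψ) ≠ 0) {N : K}
    (hN : q * M * N = octicAffineSum θ 0 ψ) {k : ℤ} (hk : (q : ℤ) - 1 = 8 * k) :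
    N = 1 / ((q : K) * (q - 1)) * ∑ w ∈ Finset.range (q - 1), ∑ j,
          (octicWeight j : K) * (∏ i, G (-((octicMonomial j).1 i * k + w))) *
          (∏ i, G (-(2 * (octicMonomial j).2 i * k + 2 * w))) * G (8 * w) * τ (1 / (8 * ψ) ^ 8) ^ w
        - 1 / (q : K) * ∑ b ∈ Finset.range 2, ∑ a ∈ Finset.range 4,
          ∑ j with (∃ i, 8 ∣ (octicMonomial j).1 i + a + 4 * b) ∨ (∃ i, 4 ∣ (octicMonomial j).2 i + a),
          (octicWeight j : K) * (∏ i, G (-(((octicMonomial j).1 i + a + 4 * b) * k))) *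
          ∏ i, G (-(2 * ((octicMonomial j).2 i + a) * k)) := by
  have hM8 : (M : ℤ) = 8 * k := by rw [hq] at hk; push_cast at hk; linarith
  have hqM : q - 1 = M := by omega
  have h0 : (8 * k : ZMod M) = 0 := by
    have := congrArg (fun z : ℤ => (z : ZMod M)) hM8
    push_cast at this
    rw [← this, ZMod.natCast_self]
  have hM4 : (M : ℤ) = 4 * (2 * k) := by rw [hM8]; ring
  rw [octicAffineSum_zero_left hM hθ hτ (by norm_num) (isClassSum_zero_of_eight hM8)
    h0 (torsionEight_of_eight hM8) (Units.mk0 _ hψ) rfl] at hN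
  rw [eq_of_mul_eq_sub hq hN]
  refine congrArg₂ (· - ·) (congrArg (HMul.hMul _) ?_) (congrArg (HMul.hMul _) ?_)
  · rw [hqM]
    refine Finset.sum_congr rfl fun w _ => Finset.sum_congr rfl fun j _ => ?_
    congr 2
    · exact mul_prod_gaussZ_eq hG _ (fun i => by push_cast; ring) (fun i => by push_cast; ring)
    · rw [hG]; push_cast; rfl
  · rw [Finset.sum_range_two_mul_eq]
    refine Finset.sum_congr rfl fun b _ => Finset.sum_congr rfl fun a _ =>
      Finset.sum_congr (Finset.filter_congr fun j _ => ?_) fun j _ => ?_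
    · refine or_congr (exists_congr fun i => ?_) (exists_congr fun i => ?_)
      · exact ZMod.eq_zero_iff_dvd hM8 (by push_cast; ring)
      · exact ZMod.eq_zero_iff_dvd hM4 (by push_cast; linear_combination b * h0)
    · exact mul_prod_gaussZ_eq hG _ (fun i => by push_cast; ring)
        fun i => by push_cast; linear_combination -b * h0

theorem eq_of_affineSum_zero_left_of_four {ψ : F} (hψ : -(8 * ψ) ≠ 0) {N : K}
    (hN : q * M * N = octicAffineSum θ 0 ψ) {l : ℤ} (hl : (q : ℤ) - 1 = 4 * l) (hl8 : ¬ (8 : ℤ) ∣ (q : ℤ) - 1) :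
    N = 1 / ((q : K) * (q - 1)) * ∑ w ∈ Finset.range (q - 1), ∑ j,
          (octicWeight j : K) * (∏ i, G (-((octicMonomial j).1 i / 2 * l + w))) *
          (∏ i, G (-((octicMonomial j).2 i * l + 2 * w))) * G (8 * w) * τ (1 / (8 * ψ) ^ 8) ^ w
        - 1 / (q : K) * ∑ a ∈ Finset.range 4,
          ∑ j with (∃ i, 8 ∣ (octicMonomial j).1 i + 2 * a) ∨ (∃ i, 4 ∣ (octicMonomial j).2 i + 2 * a),
          (octicWeight j : K) * (∏ i, G (-(((octicMonomial j).1 i + 2 * a) / 2 * l))) *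
          ∏ i, G (-(((octicMonomial j).2 i + 2 * a) * l)) := by
  have hM4 : (M : ℤ) = 4 * l := by rw [hq] at hl; push_cast at hl; linarith
  have hl2 : l % 2 = 1 := by omega
  have hqM : q - 1 = M := by omega
  have h0 : (4 * l : ZMod M) = 0 := by
    have := congrArg (fun z : ℤ => (z : ZMod M)) hM4
    push_cast at this
    rw [← this, ZMod.natCast_self]
  rw [octicAffineSum_zero_left hM hθ hτ (by norm_num) (isClassSum_zero_of_four hM4 hl2)
    (by linear_combination 2 * h0) (torsionEight_of_four hM4 hl2) (Units.mk0 _ hψ) rfl] at hN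
  rw [eq_of_mul_eq_sub hq hN]
  refine congrArg₂ (· - ·) (congrArg (HMul.hMul _) ?_) (congrArg (HMul.hMul _) ?_)
  · rw [hqM]
    refine Finset.sum_congr rfl fun w _ => Finset.sum_congr rfl fun j _ => ?_
    congr 2
    · exact mul_prod_gaussZ_eq hG _ (fun i => by push_cast; ring) (fun i => by push_cast; ring)
    · rw [hG]; push_cast; rfl
  · refine Finset.sum_congr rfl fun a _ =>
      Finset.sum_congr (Finset.filter_congr fun j _ => ?_) fun j _ => ?_
    · refine or_congr (exists_congr fun i => ?_) (exists_congr fun i => ?_)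
      · refine (ZMod.eq_zero_iff_dvd (x := (octicMonomial j).1 i / 2 + a) hM4
          (by push_cast; ring)).trans ?_
        obtain ⟨e, he⟩ := even_octicMonomial j i
        omega
      · exact ZMod.eq_zero_iff_dvd hM4 (by push_cast; ring)
    · exact mul_prod_gaussZ_eq hG _
        (fun i => by rw [Int.add_mul_ediv_left _ _ two_ne_zero]; push_cast; ring)
        fun i => by push_cast; ring

theorem eq_of_affineSum_zero_left_of_two {ψ : F} (hψ : -(8 * ψ) ≠ 0) {N : K}
    (hN : q * M * N = octicAffineSum θ 0 ψ) {m : ℤ} (hm : (q : ℤ) - 1 = 2 * m) (hm4 : ¬ (4 : ℤ) ∣ (q : ℤ) - 1) :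
    N = 1 / ((q : K) * (q - 1)) * ∑ w ∈ Finset.range (q - 1), ∑ j,
          (octicWeightFour j : K) * (∏ i, G (-((octicMonomialFour j).1 i / 4 * m + w))) *
          (∏ i, G (-((octicMonomialFour j).2 i / 2 * m + 2 * w))) * G (8 * w) * τ (1 / (8 * ψ) ^ 8) ^ w
        - 1 / (q : K) * ∑ b ∈ Finset.range 2,
          ∑ j with (∃ i, 8 ∣ (octicMonomialFour j).1 i + 4 * b) ∨ (∃ i, 4 ∣ (octicMonomialFour j).2 i),
          (octicWeightFour j : K) * (∏ i, G (-(((octicMonomialFour j).1 i + 4 * b) / 4 * m))) *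
          ∏ i, G (-((octicMonomialFour j).2 i / 2 * m)) := by
  have hM2 : (M : ℤ) = 2 * m := by rw [hq] at hm; push_cast at hm; linarith
  have hm2 : m % 2 = 1 := by omega
  have hqM : q - 1 = M := by omega
  have h0 : (2 * m : ZMod M) = 0 := by
    have := congrArg (fun z : ℤ => (z : ZMod M)) hM2
    push_cast at this
    rw [← this, ZMod.natCast_self]
  rw [octicAffineSum_zero_left hM hθ hτ (by norm_num) (isClassSum_zero_of_two hM2 hm2)
    (by linear_combination 4 * h0) (torsionEight_of_two hM2 hm2) (Units.mk0 _ hψ) rfl] at hN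
  rw [eq_of_mul_eq_sub hq hN]
  refine congrArg₂ (· - ·) (congrArg (HMul.hMul _) ?_) (congrArg (HMul.hMul _) ?_)
  · rw [hqM]
    refine Finset.sum_congr rfl fun w _ => Finset.sum_congr rfl fun j _ => ?_
    congr 2
    · exact mul_prod_gaussZ_eq hG _ (fun i => by push_cast; ring) (fun i => by push_cast; ring)
    · rw [hG]; push_cast; rfl
  · refine Finset.sum_congr rfl fun a _ =>
      Finset.sum_congr (Finset.filter_congr fun j _ => ?_) fun j _ => ?_
    · refine or_congr (exists_congr fun i => ?_) (exists_congr fun i => ?_)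
      · refine (ZMod.eq_zero_iff_dvd (x := (octicMonomialFour j).1 i / 4 + a) hM2
          (by push_cast; ring)).trans ?_
        obtain ⟨e, he⟩ := octicMonomialFour_left j i
        omega
      · refine (ZMod.eq_zero_iff_dvd (x := (octicMonomialFour j).2 i / 2) hM2
          (by push_cast; linear_combination a * h0)).trans ?_
        obtain ⟨e, he⟩ := octicMonomialFour_right j i
        omega
    · exact mul_prod_gaussZ_eq hG _
        (fun i => by rw [Int.add_mul_ediv_left _ _ four_ne_zero]; push_cast; ring)
        fun i => by push_cast; linear_combination -a * h0

theorem eq_of_affineSum_zero_right_of_eight {φ : F} (hφ : -(2 * φ) ≠ 0) {N : K}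
    (hN : q * M * N = octicAffineSum θ φ 0) {k : ℤ} (hk : (q : ℤ) - 1 = 8 * k) :
    N = 1 / ((q : K) * (q - 1)) * ∑ u ∈ Finset.range (q - 1), ∑ a ∈ Finset.range 4,
          ∑ j with (∀ i, ¬ 4 ∣ (octicMonomial j).2 i + a),
          (octicWeight j : K) * (∏ i, G (-(((octicMonomial j).1 i + a) * k + u))) *
          (∏ i, G (-(2 * ((octicMonomial j).2 i + a) * k))) * G (2 * u) * τ (1 / (2 * φ) ^ 2) ^ u
        - 1 / (q : K) * ∑ b ∈ Finset.range 2, ∑ a ∈ Finset.range 4,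
          ∑ j with (∃ i, 8 ∣ (octicMonomial j).1 i + a + 4 * b) ∧ (∀ i, ¬ 4 ∣ (octicMonomial j).2 i + a),
          (octicWeight j : K) * (∏ i, G (-(((octicMonomial j).1 i + a + 4 * b) * k))) *
          ∏ i, G (-(2 * ((octicMonomial j).2 i + a) * k)) := by
  have hM8 : (M : ℤ) = 8 * k := by rw [hq] at hk; push_cast at hk; linarith
  have hqM : q - 1 = M := by omega
  have h0 : (8 * k : ZMod M) = 0 := by
    have := congrArg (fun z : ℤ => (z : ZMod M)) hM8
    push_cast at this
    rw [← this, ZMod.natCast_self]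
  have hM4 : (M : ℤ) = 4 * (2 * k) := by rw [hM8]; ring
  have hMe : Even M := ⟨4 * k.toNat, by omega⟩
  rw [octicAffineSum_zero_right hM hθ hτ hMe (isClassSum_zero_of_eight hM8)
    (isClassSum_one_of_eight hM8) (by push_cast; linear_combination h0) (Units.mk0 _ hφ) rfl] at hN
  -- For 8 dividing q - 1 odd exponents of the φ-monomial do not occur.
  simp only [Finset.univ_eq_empty, Finset.filter_empty, Finset.sum_empty, Finset.sum_const_zero, add_zero] at hN
  rw [eq_of_mul_eq_sub hq hN]
  refine congrArg₂ (· - ·) (congrArg (HMul.hMul _) ?_) (congrArg (HMul.hMul _) ?_)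
  · rw [hqM]
    refine Finset.sum_congr rfl fun u _ => Finset.sum_congr rfl fun a _ =>
      Finset.sum_congr (Finset.filter_congr fun j _ => ?_) fun j _ => ?_
    · refine forall_congr' fun i => not_congr ?_
      exact ZMod.eq_zero_iff_dvd hM4 (by push_cast; ring)
    · congr 2
      · exact mul_prod_gaussZ_eq hG _
          (fun i => by push_cast; ring)
          fun i => by push_cast; ring
      · rw [hG]; push_cast; rfl
  · rw [Finset.sum_range_two_mul_eq]
    refine Finset.sum_congr rfl fun b _ => Finset.sum_congr rfl fun a _ =>
      Finset.sum_congr (Finset.filter_congr fun j _ => ?_) fun j _ => ?_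
    · refine and_congr (exists_congr fun i => ?_) (forall_congr' fun i => not_congr ?_)
      · exact ZMod.eq_zero_iff_dvd hM8 (by push_cast; ring)
      · exact ZMod.eq_zero_iff_dvd hM4 (by push_cast; linear_combination b * h0)
    · exact mul_prod_gaussZ_eq hG _ (fun i => by push_cast; ring)
        fun i => by push_cast; linear_combination -b * h0

/-- The second sum comes from odd exponents of the φ-monomial. Its half-integral terms combine to
((v + 2a + 1)l + 1)/2, an integer because v is even and l is odd. -/
theorem eq_of_affineSum_zero_right_of_four {φ : F} (hφ : -(2 * φ) ≠ 0) {N : K}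
    (hN : q * M * N = octicAffineSum θ φ 0) {l : ℤ} (hl : (q : ℤ) - 1 = 4 * l) (hl8 : ¬ (8 : ℤ) ∣ (q : ℤ) - 1) :
    N = 1 / ((q : K) * (q - 1)) * ∑ u ∈ Finset.range (q - 1), ∑ a ∈ Finset.range 2,
          ∑ j with (∀ i, ¬ 4 ∣ (octicMonomial j).2 i + 2 * a),
          (octicWeight j : K) * (∏ i, G (-(((octicMonomial j).1 i + 2 * a) / 2 * l + u))) *
          (∏ i, G (-(((octicMonomial j).2 i + 2 * a) * l))) * G (2 * u) * τ (1 / (2 * φ) ^ 2) ^ u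
        + 1 / ((q : K) * (q - 1)) * ∑ u ∈ Finset.range (q - 1), ∑ a ∈ Finset.range 2,
          ∑ j with (∀ i, ¬ 4 ∣ (octicMonomial j).2 i + 2 * a + 1),
          (octicWeight j : K) * (∏ i, G (-((((octicMonomial j).1 i + 2 * a + 1) * l + 1) / 2 + u))) *
          (∏ i, G (-(((octicMonomial j).2 i + 2 * a + 1) * l))) * G (2 * u + 1) *
          τ (1 / (2 * φ) ^ 2) ^ u * (τ (-2 * φ))⁻¹
        - 1 / (q : K) * ∑ b ∈ Finset.range 2, ∑ a ∈ Finset.range 2,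
          ∑ j with (∃ i, 8 ∣ (octicMonomial j).1 i + 2 * a + 4 * b) ∧ (∀ i, ¬ 4 ∣ (octicMonomial j).2 i + 2 * a),
          (octicWeight j : K) * (∏ i, G (-(((octicMonomial j).1 i + 2 * a + 4 * b) / 2 * l))) *
          ∏ i, G (-(((octicMonomial j).2 i + 2 * a) * l)) := by
  have hM4 : (M : ℤ) = 4 * l := by rw [hq] at hl; push_cast at hl; linarith
  have hl2 : l % 2 = 1 := by omega
  have hqM : q - 1 = M := by omega
  have h0 : (4 * l : ZMod M) = 0 := by
    have := congrArg (fun z : ℤ => (z : ZMod M)) hM4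
    push_cast at this
    rw [← this, ZMod.natCast_self]
  have hMe : Even M := ⟨2 * l.toNat, by omega⟩
  rw [octicAffineSum_zero_right hM hθ hτ hMe (isClassSum_zero_of_four hM4 hl2)
    (isClassSum_one_of_four hM4 hl2) (by push_cast; linear_combination h0) (Units.mk0 _ hφ) rfl] at hN
  rw [eq_of_mul_eq_add_sub hq hN]
  refine congrArg₂ (· - ·) (congrArg₂ (· + ·) (congrArg (HMul.hMul _) ?_) (congrArg (HMul.hMul _) ?_))
    (congrArg (HMul.hMul _) ?_)
  · rw [hqM]
    refine Finset.sum_congr rfl fun u _ => Finset.sum_congr rfl fun a _ =>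
      Finset.sum_congr (Finset.filter_congr fun j _ => ?_) fun j _ => ?_
    · refine forall_congr' fun i => not_congr ?_
      exact ZMod.eq_zero_iff_dvd hM4 (by push_cast; ring)
    · congr 2
      · exact mul_prod_gaussZ_eq hG _
          (fun i => by rw [Int.add_mul_ediv_left _ _ two_ne_zero]; push_cast; ring)
          fun i => by push_cast; ring
      · rw [hG]; push_cast; rfl
  · rw [hqM]
    refine Finset.sum_congr rfl fun u _ => Finset.sum_congr rfl fun a _ =>
      Finset.sum_congr (Finset.filter_congr fun j _ => ?_) fun j _ => ?_
    · refine forall_congr' fun i => not_congr ?_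
      exact ZMod.eq_zero_iff_dvd hM4 (by push_cast; ring)
    · congr 3
      · exact mul_prod_gaussZ_eq hG _
          (fun i => by rw [Int.add_two_mul_add_one_mul_ediv]; push_cast; ring)
          fun i => by push_cast; ring
      · rw [hG]; push_cast; rfl
  · rw [Finset.sum_range_two_mul_eq]
    refine Finset.sum_congr rfl fun b _ => Finset.sum_congr rfl fun a _ =>
      Finset.sum_congr (Finset.filter_congr fun j _ => ?_) fun j _ => ?_
    · refine and_congr (exists_congr fun i => ?_) (forall_congr' fun i => not_congr ?_)
      · refine (ZMod.eq_zero_iff_dvd (x := (octicMonomial j).1 i / 2 + a + 2 * b) hM4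
          (by push_cast; ring)).trans ?_
        obtain ⟨e, he⟩ := even_octicMonomial j i
        omega
      · exact ZMod.eq_zero_iff_dvd hM4 (by push_cast; linear_combination b * h0)
    · exact mul_prod_gaussZ_eq hG _ (fun i => by rw [Int.add_two_mul_add_four_mul_ediv]; push_cast; ring)
        fun i => by push_cast; linear_combination -b * h0

/-- Since 4 divides the first entries v and m is odd, (v + 2)m + 2 is divisible by 4, so the index
of the odd part is integral. -/
theorem eq_of_affineSum_zero_right_of_two {φ : F} (hφ : -(2 * φ) ≠ 0) {N : K}
    (hN : q * M * N = octicAffineSum θ φ 0) {m : ℤ} (hm : (q : ℤ) - 1 = 2 * m) (hm4 : ¬ (4 : ℤ) ∣ (q : ℤ) - 1) :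
    N = 1 / ((q : K) * (q - 1)) * ∑ u ∈ Finset.range (q - 1),
          ∑ j with (∀ i, ¬ 4 ∣ (octicMonomialFour j).2 i),
          (octicWeightFour j : K) * (∏ i, G (-((octicMonomialFour j).1 i / 4 * m + u))) *
          (∏ i, G (-((octicMonomialFour j).2 i / 2 * m))) * G (2 * u) * τ (1 / (2 * φ) ^ 2) ^ u
        + 1 / ((q : K) * (q - 1)) * ∑ u ∈ Finset.range (q - 1),
          ∑ j with (∀ i, ¬ 4 ∣ (octicMonomialFour j).2 i + 2),
          (octicWeightFour j : K) * (∏ i, G (-((((octicMonomialFour j).1 i + 2) * m + 2) / 4 + u))) *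
          (∏ i, G (-(((octicMonomialFour j).2 i + 2) / 2 * m))) * G (2 * u + 1) *
          τ (1 / (2 * φ) ^ 2) ^ u * (τ (-2 * φ))⁻¹
        - 1 / (q : K) * ∑ b ∈ Finset.range 2,
          ∑ j with (∃ i, 8 ∣ (octicMonomialFour j).1 i + 4 * b) ∧ (∀ i, ¬ 4 ∣ (octicMonomialFour j).2 i),
          (octicWeightFour j : K) * (∏ i, G (-(((octicMonomialFour j).1 i + 4 * b) / 4 * m))) *
          ∏ i, G (-((octicMonomialFour j).2 i / 2 * m)) := by
  have hM2 : (M : ℤ) = 2 * m := by rw [hq] at hm; push_cast at hm; linarith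
  have hm2 : m % 2 = 1 := by omega
  have hqM : q - 1 = M := by omega
  have h0 : (2 * m : ZMod M) = 0 := by
    have := congrArg (fun z : ℤ => (z : ZMod M)) hM2
    push_cast at this
    rw [← this, ZMod.natCast_self]
  have hMe : Even M := ⟨m.toNat, by omega⟩
  rw [octicAffineSum_zero_right hM hθ hτ hMe (isClassSum_zero_of_two hM2 hm2)
    (isClassSum_one_of_two hM2 hm2) (by push_cast; linear_combination h0) (Units.mk0 _ hφ) rfl] at hN
  rw [eq_of_mul_eq_add_sub hq hN]
  refine congrArg₂ (· - ·) (congrArg₂ (· + ·) (congrArg (HMul.hMul _) ?_) (congrArg (HMul.hMul _) ?_))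
    (congrArg (HMul.hMul _) ?_)
  · rw [hqM]
    refine Finset.sum_congr rfl fun u _ => ?_
    rw [Finset.sum_range_one]
    refine Finset.sum_congr (Finset.filter_congr fun j _ => ?_) fun j _ => ?_
    · refine forall_congr' fun i => not_congr ?_
      refine (ZMod.eq_zero_iff_dvd (x := (octicMonomialFour j).2 i / 2) hM2
        (by push_cast; ring)).trans ?_
      obtain ⟨e, he⟩ := octicMonomialFour_right j i
      omega
    · congr 2
      · exact mul_prod_gaussZ_eq hG _
          (fun i => by push_cast; ring)
          fun i => by push_cast; ring
      · rw [hG]; push_cast; rfl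
  · rw [hqM]
    refine Finset.sum_congr rfl fun u _ => ?_
    rw [Finset.sum_range_one]
    refine Finset.sum_congr (Finset.filter_congr fun j _ => ?_) fun j _ => ?_
    · refine forall_congr' fun i => not_congr ?_
      refine (ZMod.eq_zero_iff_dvd (x := ((octicMonomialFour j).2 i + 2) / 2) hM2
        (by push_cast; ring)).trans ?_
      obtain ⟨e, he⟩ := octicMonomialFour_right j i
      omega
    · congr 3
      · exact mul_prod_gaussZ_eq hG _
          (fun i => by push_cast; ring)
          fun i => by push_cast; ring
      · rw [hG]; push_cast; rfl
  · refine Finset.sum_congr rfl fun a _ =>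
      Finset.sum_congr (Finset.filter_congr fun j _ => ?_) fun j _ => ?_
    · refine and_congr (exists_congr fun i => ?_) (forall_congr' fun i => not_congr ?_)
      · refine (ZMod.eq_zero_iff_dvd (x := (octicMonomialFour j).1 i / 4 + a) hM2
          (by push_cast; ring)).trans ?_
        obtain ⟨e, he⟩ := octicMonomialFour_left j i
        omega
      · refine (ZMod.eq_zero_iff_dvd (x := (octicMonomialFour j).2 i / 2) hM2
          (by push_cast; linear_combination a * h0)).trans ?_
        obtain ⟨e, he⟩ := octicMonomialFour_right j i
        omega
    · exact mul_prod_gaussZ_eq hG _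
        (fun i => by rw [Int.add_mul_ediv_left _ _ four_ne_zero]; push_cast; ring)
        fun i => by push_cast; linear_combination -a * h0

theorem eq_of_affineSum_ne_zero_of_eight {φ ψ : F} (hφ : -(2 * φ) ≠ 0) (hψ : -(8 * ψ) ≠ 0) {N : K}
    (hN : q * M * N = octicAffineSum θ φ ψ) {k : ℤ} (hk : (q : ℤ) - 1 = 8 * k) :
    N = 1 / ((q : K) * (q - 1) ^ 2) * ∑ t ∈ Finset.range (q - 1),
          ∑ u ∈ Finset.Icc ((t + 1) / 2) ((2 * q - 3 + t) / 2), ∑ j,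
          (octicWeight j : K) * (∏ i, G (-((octicMonomial j).1 i * k + u))) *
          (∏ i, G (-(2 * (octicMonomial j).2 i * k + t))) * G (2 * u - t) * G (4 * t) *
          τ (1 / (2 * φ) ^ 2) ^ u * τ (-2 * φ / (8 * ψ) ^ 4) ^ t
        - 1 / ((q : K) * (q - 1)) * ∑ u ∈ Finset.range (q - 1), ∑ a ∈ Finset.range 4,
          ∑ j with (∃ i, 4 ∣ (octicMonomial j).2 i + a),
          (octicWeight j : K) * (∏ i, G (-(((octicMonomial j).1 i + a) * k + u))) *
          (∏ i, G (-(2 * ((octicMonomial j).2 i + a) * k))) * G (2 * u) * τ (1 / (2 * φ) ^ 2) ^ u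
        - 1 / (q : K) * ∑ b ∈ Finset.range 2, ∑ a ∈ Finset.range 4,
          ∑ j with (∃ i, 8 ∣ (octicMonomial j).1 i + a + 4 * b) ∧ (∀ i, ¬ 4 ∣ (octicMonomial j).2 i + a),
          (octicWeight j : K) * (∏ i, G (-(((octicMonomial j).1 i + a + 4 * b) * k))) *
          ∏ i, G (-(2 * ((octicMonomial j).2 i + a) * k)) := by
  have hM8 : (M : ℤ) = 8 * k := by rw [hq] at hk; push_cast at hk; linarith
  have hqM : q - 1 = M := by omega
  have h0 : (8 * k : ZMod M) = 0 := by
    have := congrArg (fun z : ℤ => (z : ZMod M)) hM8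
    push_cast at this
    rw [← this, ZMod.natCast_self]
  have hM4 : (M : ℤ) = 4 * (2 * k) := by rw [hM8]; ring
  have hMe : Even M := ⟨4 * k.toNat, by omega⟩
  have h := octicAffineSum_eq_sum_classes hM hθ hτ hMe (by norm_num)
    (isClassSum_zero_of_eight hM8) (isClassSum_one_of_eight hM8)
    (by push_cast; linear_combination h0) h0 (torsionEight_of_eight hM8)
    (Units.mk0 _ hφ) (Units.mk0 _ hψ) rfl rfl
  rw [eq_of_mul_eq_sub_sub_sub hq hN h]
  simp only [Finset.univ_eq_empty, Finset.filter_empty, Finset.sum_empty, Finset.sum_const_zero, mul_zero,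
    sub_zero]
  refine congrArg₂ (· - ·) (congrArg₂ (· - ·) (congrArg (HMul.hMul _) ?_) (congrArg (HMul.hMul _) ?_))
    (congrArg (HMul.hMul _) ?_)
  · rw [hqM]
    refine Finset.sum_congr rfl fun t _ => Finset.sum_congr (by rw [hq]) fun u _ =>
      Finset.sum_congr rfl fun j _ => ?_
    congr 4
    · exact mul_prod_gaussZ_eq hG _ (fun i => by push_cast; ring) (fun i => by push_cast; ring)
    · rw [hG]; push_cast; rfl
    · rw [hG]; push_cast; rfl
  · rw [hqM]
    refine Finset.sum_congr rfl fun u _ => Finset.sum_congr rfl fun a _ =>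
      Finset.sum_congr (Finset.filter_congr fun j _ => ?_) fun j _ => ?_
    · refine exists_congr fun i => ?_
      exact ZMod.eq_zero_iff_dvd hM4 (by push_cast; ring)
    · congr 2
      · exact mul_prod_gaussZ_eq hG _
          (fun i => by push_cast; ring)
          fun i => by push_cast; ring
      · rw [hG]; push_cast; rfl
  · rw [Finset.sum_range_two_mul_eq]
    refine Finset.sum_congr rfl fun b _ => Finset.sum_congr rfl fun a _ =>
      Finset.sum_congr (Finset.filter_congr fun j _ => ?_) fun j _ => ?_
    · refine and_congr (exists_congr fun i => ?_) (forall_congr' fun i => not_congr ?_)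
      · exact ZMod.eq_zero_iff_dvd hM8 (by push_cast; ring)
      · exact ZMod.eq_zero_iff_dvd hM4 (by push_cast; linear_combination b * h0)
    · exact mul_prod_gaussZ_eq hG _ (fun i => by push_cast; ring)
        fun i => by push_cast; linear_combination -b * h0

theorem eq_of_affineSum_ne_zero_of_four {φ ψ : F} (hφ : -(2 * φ) ≠ 0) (hψ : -(8 * ψ) ≠ 0) {N : K}
    (hN : q * M * N = octicAffineSum θ φ ψ) {l : ℤ} (hl : (q : ℤ) - 1 = 4 * l) (hl8 : ¬ (8 : ℤ) ∣ (q : ℤ) - 1) :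
    N = 1 / ((q : K) * (q - 1) ^ 2) * ∑ t ∈ Finset.range (q - 1),
          ∑ u ∈ Finset.Icc ((t + 1) / 2) ((2 * q - 3 + t) / 2), ∑ j,
          (octicWeight j : K) * (∏ i, G (-((octicMonomial j).1 i / 2 * l + u))) *
          (∏ i, G (-((octicMonomial j).2 i * l + t))) * G (2 * u - t) * G (4 * t) *
          τ (1 / (2 * φ) ^ 2) ^ u * τ (-2 * φ / (8 * ψ) ^ 4) ^ t
        - 1 / ((q : K) * (q - 1)) * ∑ u ∈ Finset.range (q - 1), ∑ a ∈ Finset.range 2,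
          ∑ j with (∃ i, 4 ∣ (octicMonomial j).2 i + 2 * a),
          (octicWeight j : K) * (∏ i, G (-(((octicMonomial j).1 i + 2 * a) / 2 * l + u))) *
          (∏ i, G (-(((octicMonomial j).2 i + 2 * a) * l))) * G (2 * u) * τ (1 / (2 * φ) ^ 2) ^ u
        - 1 / ((q : K) * (q - 1)) * ∑ u ∈ Finset.range (q - 1), ∑ a ∈ Finset.range 2,
          ∑ j with (∃ i, 4 ∣ (octicMonomial j).2 i + 2 * a + 1),
          (octicWeight j : K) * (∏ i, G (-((((octicMonomial j).1 i + 2 * a + 1) * l + 1) / 2 + u))) *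
          (∏ i, G (-(((octicMonomial j).2 i + 2 * a + 1) * l))) * G (2 * u + 1) *
          τ (1 / (2 * φ) ^ 2) ^ u * (τ (-2 * φ))⁻¹
        - 1 / (q : K) * ∑ b ∈ Finset.range 2, ∑ a ∈ Finset.range 2,
          ∑ j with (∃ i, 8 ∣ (octicMonomial j).1 i + 2 * a + 4 * b) ∧ (∀ i, ¬ 4 ∣ (octicMonomial j).2 i + 2 * a),
          (octicWeight j : K) * (∏ i, G (-(((octicMonomial j).1 i + 2 * a + 4 * b) / 2 * l))) *
          ∏ i, G (-(((octicMonomial j).2 i + 2 * a) * l)) := by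
  have hM4 : (M : ℤ) = 4 * l := by rw [hq] at hl; push_cast at hl; linarith
  have hl2 : l % 2 = 1 := by omega
  have hqM : q - 1 = M := by omega
  have h0 : (4 * l : ZMod M) = 0 := by
    have := congrArg (fun z : ℤ => (z : ZMod M)) hM4
    push_cast at this
    rw [← this, ZMod.natCast_self]
  have hMe : Even M := ⟨2 * l.toNat, by omega⟩
  have h := octicAffineSum_eq_sum_classes hM hθ hτ hMe (by norm_num)
    (isClassSum_zero_of_four hM4 hl2) (isClassSum_one_of_four hM4 hl2)
    (by push_cast; linear_combination h0) (by linear_combination 2 * h0) (torsionEight_of_four hM4 hl2)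
    (Units.mk0 _ hφ) (Units.mk0 _ hψ) rfl rfl
  rw [eq_of_mul_eq_sub_sub_sub hq hN h]
  refine congrArg₂ (· - ·) (congrArg₂ (· - ·) (congrArg₂ (· - ·) (congrArg (HMul.hMul _) ?_)
    (congrArg (HMul.hMul _) ?_)) (congrArg (HMul.hMul _) ?_)) (congrArg (HMul.hMul _) ?_)
  · rw [hqM]
    refine Finset.sum_congr rfl fun t _ => Finset.sum_congr (by rw [hq]) fun u _ =>
      Finset.sum_congr rfl fun j _ => ?_
    congr 4
    · exact mul_prod_gaussZ_eq hG _ (fun i => by push_cast; ring) (fun i => by push_cast; ring)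
    · rw [hG]; push_cast; rfl
    · rw [hG]; push_cast; rfl
  · rw [hqM]
    refine Finset.sum_congr rfl fun u _ => Finset.sum_congr rfl fun a _ =>
      Finset.sum_congr (Finset.filter_congr fun j _ => ?_) fun j _ => ?_
    · refine exists_congr fun i => ?_
      exact ZMod.eq_zero_iff_dvd hM4 (by push_cast; ring)
    · congr 2
      · exact mul_prod_gaussZ_eq hG _
          (fun i => by rw [Int.add_mul_ediv_left _ _ two_ne_zero]; push_cast; ring)
          fun i => by push_cast; ring
      · rw [hG]; push_cast; rfl
  · rw [hqM]
    refine Finset.sum_congr rfl fun u _ => Finset.sum_congr rfl fun a _ =>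
      Finset.sum_congr (Finset.filter_congr fun j _ => ?_) fun j _ => ?_
    · refine exists_congr fun i => ?_
      exact ZMod.eq_zero_iff_dvd hM4 (by push_cast; ring)
    · congr 3
      · exact mul_prod_gaussZ_eq hG _
          (fun i => by rw [Int.add_two_mul_add_one_mul_ediv]; push_cast; ring)
          fun i => by push_cast; ring
      · rw [hG]; push_cast; rfl
  · rw [Finset.sum_range_two_mul_eq]
    refine Finset.sum_congr rfl fun b _ => Finset.sum_congr rfl fun a _ =>
      Finset.sum_congr (Finset.filter_congr fun j _ => ?_) fun j _ => ?_
    · refine and_congr (exists_congr fun i => ?_) (forall_congr' fun i => not_congr ?_)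
      · refine (ZMod.eq_zero_iff_dvd (x := (octicMonomial j).1 i / 2 + a + 2 * b) hM4
          (by push_cast; ring)).trans ?_
        obtain ⟨e, he⟩ := even_octicMonomial j i
        omega
      · exact ZMod.eq_zero_iff_dvd hM4 (by push_cast; linear_combination b * h0)
    · exact mul_prod_gaussZ_eq hG _ (fun i => by rw [Int.add_two_mul_add_four_mul_ediv]; push_cast; ring)
        fun i => by push_cast; linear_combination -b * h0

theorem eq_of_affineSum_ne_zero_of_two {φ ψ : F} (hφ : -(2 * φ) ≠ 0) (hψ : -(8 * ψ) ≠ 0) {N : K}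
    (hN : q * M * N = octicAffineSum θ φ ψ) {m : ℤ} (hm : (q : ℤ) - 1 = 2 * m) (hm4 : ¬ (4 : ℤ) ∣ (q : ℤ) - 1) :
    N = 1 / ((q : K) * (q - 1) ^ 2) * ∑ t ∈ Finset.range (q - 1),
          ∑ u ∈ Finset.Icc ((t + 1) / 2) ((2 * q - 3 + t) / 2), ∑ j,
          (octicWeightFour j : K) * (∏ i, G (-((octicMonomialFour j).1 i / 4 * m + u))) *
          (∏ i, G (-((octicMonomialFour j).2 i / 2 * m + t))) * G (2 * u - t) * G (4 * t) *
          τ (1 / (2 * φ) ^ 2) ^ u * τ (-2 * φ / (8 * ψ) ^ 4) ^ t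
        - 1 / ((q : K) * (q - 1)) * ∑ u ∈ Finset.range (q - 1),
          ∑ j with (∃ i, 4 ∣ (octicMonomialFour j).2 i),
          (octicWeightFour j : K) * (∏ i, G (-((octicMonomialFour j).1 i / 4 * m + u))) *
          (∏ i, G (-((octicMonomialFour j).2 i / 2 * m))) * G (2 * u) * τ (1 / (2 * φ) ^ 2) ^ u
        - 1 / ((q : K) * (q - 1)) * ∑ u ∈ Finset.range (q - 1),
          ∑ j with (∃ i, 4 ∣ (octicMonomialFour j).2 i + 2),
          (octicWeightFour j : K) * (∏ i, G (-((((octicMonomialFour j).1 i + 2) * m + 2) / 4 + u))) *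
          (∏ i, G (-(((octicMonomialFour j).2 i + 2) / 2 * m))) * G (2 * u + 1) *
          τ (1 / (2 * φ) ^ 2) ^ u * (τ (-2 * φ))⁻¹
        - 1 / (q : K) * ∑ b ∈ Finset.range 2,
          ∑ j with (∃ i, 8 ∣ (octicMonomialFour j).1 i + 4 * b) ∧ (∀ i, ¬ 4 ∣ (octicMonomialFour j).2 i),
          (octicWeightFour j : K) * (∏ i, G (-(((octicMonomialFour j).1 i + 4 * b) / 4 * m))) *
          ∏ i, G (-((octicMonomialFour j).2 i / 2 * m)) := by
  have hM2 : (M : ℤ) = 2 * m := by rw [hq] at hm; push_cast at hm; linarith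
  have hm2 : m % 2 = 1 := by omega
  have hqM : q - 1 = M := by omega
  have h0 : (2 * m : ZMod M) = 0 := by
    have := congrArg (fun z : ℤ => (z : ZMod M)) hM2
    push_cast at this
    rw [← this, ZMod.natCast_self]
  have hMe : Even M := ⟨m.toNat, by omega⟩
  have h := octicAffineSum_eq_sum_classes hM hθ hτ hMe (by norm_num)
    (isClassSum_zero_of_two hM2 hm2) (isClassSum_one_of_two hM2 hm2)
    (by push_cast; linear_combination h0) (by linear_combination 4 * h0) (torsionEight_of_two hM2 hm2)
    (Units.mk0 _ hφ) (Units.mk0 _ hψ) rfl rfl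
  rw [eq_of_mul_eq_sub_sub_sub hq hN h]
  refine congrArg₂ (· - ·) (congrArg₂ (· - ·) (congrArg₂ (· - ·) (congrArg (HMul.hMul _) ?_)
    (congrArg (HMul.hMul _) ?_)) (congrArg (HMul.hMul _) ?_)) (congrArg (HMul.hMul _) ?_)
  · rw [hqM]
    refine Finset.sum_congr rfl fun t _ => Finset.sum_congr (by rw [hq]) fun u _ =>
      Finset.sum_congr rfl fun j _ => ?_
    congr 4
    · exact mul_prod_gaussZ_eq hG _ (fun i => by push_cast; ring) (fun i => by push_cast; ring)
    · rw [hG]; push_cast; rfl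
    · rw [hG]; push_cast; rfl
  · rw [hqM]
    refine Finset.sum_congr rfl fun u _ => ?_
    rw [Finset.sum_range_one]
    refine Finset.sum_congr (Finset.filter_congr fun j _ => ?_) fun j _ => ?_
    · refine exists_congr fun i => ?_
      refine (ZMod.eq_zero_iff_dvd (x := (octicMonomialFour j).2 i / 2) hM2
        (by push_cast; ring)).trans ?_
      obtain ⟨e, he⟩ := octicMonomialFour_right j i
      omega
    · congr 2
      · exact mul_prod_gaussZ_eq hG _
          (fun i => by push_cast; ring)
          fun i => by push_cast; ring
      · rw [hG]; push_cast; rfl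
  · rw [hqM]
    refine Finset.sum_congr rfl fun u _ => ?_
    rw [Finset.sum_range_one]
    refine Finset.sum_congr (Finset.filter_congr fun j _ => ?_) fun j _ => ?_
    · refine exists_congr fun i => ?_
      refine (ZMod.eq_zero_iff_dvd (x := ((octicMonomialFour j).2 i + 2) / 2) hM2
        (by push_cast; ring)).trans ?_
      obtain ⟨e, he⟩ := octicMonomialFour_right j i
      omega
    · congr 3
      · exact mul_prod_gaussZ_eq hG _
          (fun i => by push_cast; ring)
          fun i => by push_cast; ring
      · rw [hG]; push_cast; rfl
  · refine Finset.sum_congr rfl fun a _ =>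
      Finset.sum_congr (Finset.filter_congr fun j _ => ?_) fun j _ => ?_
    · refine and_congr (exists_congr fun i => ?_) (forall_congr' fun i => not_congr ?_)
      · refine (ZMod.eq_zero_iff_dvd (x := (octicMonomialFour j).1 i / 4 + a) hM2
          (by push_cast; ring)).trans ?_
        obtain ⟨e, he⟩ := octicMonomialFour_left j i
        omega
      · refine (ZMod.eq_zero_iff_dvd (x := (octicMonomialFour j).2 i / 2) hM2
          (by push_cast; linear_combination a * h0)).trans ?_
        obtain ⟨e, he⟩ := octicMonomialFour_right j i
        omega
    · exact mul_prod_gaussZ_eq hG _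
        (fun i => by rw [Int.add_mul_ediv_left _ _ four_ne_zero]; push_cast; ring)
        fun i => by push_cast; linear_combination -a * h0

end Assembly

/-! ### Orbits of the torus and points of the quartic. -/

section Counting

theorem Nat.card_eq_card_mul_of_fibers {α β : Type*} [Finite α] [Finite β] (f : α → β) (n : ℕ)
    (h : ∀ b, Nat.card {a // f a = b} = n) : Nat.card α = Nat.card β * n := by
  have := Fintype.ofFinite β
  rw [← Nat.card_congr (Equiv.sigmaFiberEquiv f), Nat.card_sigma]
  simp [h, Nat.card_eq_fintype_card]

variable {F : Type*} [Field F]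

theorem octicPoly_octicScale (φ ψ : F) (a b : Fˣ) (x : Fin 6 → F) :
    octicPoly φ ψ (octicScale a b x) = (b : F) ^ 4 * octicPoly φ ψ x := by
  have ha : (a : F) * (a : F)⁻¹ = 1 := mul_inv_cancel₀ a.ne_zero
  have h8 : (a : F) ^ 8 * (a : F)⁻¹ ^ 8 = 1 := by rw [← mul_pow, ha, one_pow]
  have h2 : (a : F) ^ 2 * (a : F)⁻¹ ^ 2 = 1 := by rw [← mul_pow, ha, one_pow]
  simp only [octicPoly, octicScale, Matrix.cons_val]
  linear_combination (b : F) ^ 4 * (x 0 ^ 8 * x 5 ^ 4 + x 1 ^ 8 * x 5 ^ 4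
      - 2 * φ * x 0 ^ 4 * x 1 ^ 4 * x 5 ^ 4) * h8
    - (b : F) ^ 4 * 8 * ψ * x 0 * x 1 * x 2 * x 3 * x 4 * x 5 * h2

theorem octicScale_mem (φ ψ : F) (a b : Fˣ) (x : OcticCoords φ ψ) :
    ¬ (octicScale a b x.1 0 = 0 ∧ octicScale a b x.1 1 = 0) ∧
    ¬ (octicScale a b x.1 2 = 0 ∧ octicScale a b x.1 3 = 0 ∧ octicScale a b x.1 4 = 0 ∧
      octicScale a b x.1 5 = 0) ∧ octicPoly φ ψ (octicScale a b x.1) = 0 := by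
  refine ⟨?_, ?_, ?_⟩
  · simpa [octicScale] using x.2.1
  · simpa [octicScale] using x.2.2.1
  · rw [octicPoly_octicScale, x.2.2.2, mul_zero]

/-- The action is free: a nonzero one of x₁, x₂ determines a, after which a nonzero one of x₃, …, x₆
determines b. These are exactly the two excluded loci. -/
theorem octicScale_injective (φ ψ : F) (x : OcticCoords φ ψ) {a b a' b' : Fˣ}
    (h : octicScale a b x.1 = octicScale a' b' x.1) : a = a' ∧ b = b' := by
  have h0 := congrFun h 0
  have h1 := congrFun h 1
  have h2 := congrFun h 2
  have h3 := congrFun h 3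
  have h4 := congrFun h 4
  have h5 := congrFun h 5
  simp only [octicScale, Matrix.cons_val] at h0 h1 h2 h3 h4 h5
  have ha : a = a' := by
    by_contra hne
    have hne' : (a : F) ≠ a' := fun e => hne (Units.ext e)
    exact x.2.1 ⟨(mul_eq_mul_right_iff.1 h0).resolve_left hne',
      (mul_eq_mul_right_iff.1 h1).resolve_left hne'⟩
  subst ha
  refine ⟨rfl, ?_⟩
  by_contra hne
  have hne' : (b : F) ≠ b' := fun e => hne (Units.ext e)
  refine x.2.2.1 ⟨(mul_eq_mul_right_iff.1 h2).resolve_left hne',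
    (mul_eq_mul_right_iff.1 h3).resolve_left hne', (mul_eq_mul_right_iff.1 h4).resolve_left hne',
    (mul_eq_mul_right_iff.1 h5).resolve_left fun e => hne' ?_⟩
  exact mul_right_cancel₀ (pow_ne_zero 2 (inv_ne_zero a.ne_zero)) e

/-- An orbit is a torsor under the torus. -/
noncomputable def octicOrbitEquiv (φ ψ : F) (x : OcticCoords φ ψ) :
    Fˣ × Fˣ ≃ {y : OcticCoords φ ψ // (Quotient.mk (octicSetoid φ ψ) y) = Quotient.mk _ x} :=
  Equiv.ofBijective (fun g => ⟨⟨octicScale g.1 g.2 x.1, octicScale_mem φ ψ g.1 g.2 x⟩,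
    Quotient.sound (s := octicSetoid φ ψ) ((octicSetoid φ ψ).symm ⟨g.1, g.2, rfl⟩)⟩)
    ⟨fun g g' h => by
      have := octicScale_injective φ ψ x (congrArg (fun y => y.1.1) h)
      exact Prod.ext this.1 this.2,
    fun y => by
      obtain ⟨a, b, h⟩ := (octicSetoid φ ψ).symm (Quotient.exact (s := octicSetoid φ ψ) y.2)
      exact ⟨(a, b), Subtype.ext (Subtype.ext h.symm)⟩⟩

theorem card_octicCoords [Fintype F] (φ ψ : F) :
    Nat.card (OcticCoords φ ψ) = octicCount φ ψ * (Nat.card Fˣ) ^ 2 := by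
  have : Finite (OcticCoords φ ψ) := Subtype.finite
  have : Finite (Quotient (octicSetoid φ ψ)) := Quotient.finite _
  refine Nat.card_eq_card_mul_of_fibers (Quotient.mk (octicSetoid φ ψ)) _ fun b => ?_
  obtain ⟨x, rfl⟩ := Quotient.exists_rep b
  rw [← Nat.card_congr (octicOrbitEquiv φ ψ x), Nat.card_prod, pow_two]

/-- The punctured cone maps to the projective quartic with every fibre a torsor under the units; the
equation, being homogeneous, does not depend on the chosen representative. -/
theorem card_quartic_cone [Fintype F] :
    Nat.card {x : Fin 3 → F // x ≠ 0 ∧ x 0 ^ 4 + x 1 ^ 4 + x 2 ^ 4 = 0} =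
      quarticCount F * Nat.card Fˣ := by
  have : Finite (Projectivization F (Fin 3 → F)) := Quotient.finite _
  have hsmul : ∀ (a : Fˣ) (x : Fin 3 → F), (a • x) 0 ^ 4 + (a • x) 1 ^ 4 + (a • x) 2 ^ 4 = 0 ↔
      x 0 ^ 4 + x 1 ^ 4 + x 2 ^ 4 = 0 := by
    intro a x
    have : (a • x) 0 ^ 4 + (a • x) 1 ^ 4 + (a • x) 2 ^ 4 =
        (a : F) ^ 4 * (x 0 ^ 4 + x 1 ^ 4 + x 2 ^ 4) := by
      simp only [Pi.smul_apply, Units.smul_def, smul_eq_mul]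
      ring
    rw [this, mul_eq_zero, or_iff_right (pow_ne_zero 4 a.ne_zero)]
  have hrep : ∀ (x : Fin 3 → F) (hx : x ≠ 0), ∃ a : Fˣ, a • x = (Projectivization.mk F x hx).rep :=
    fun x hx => Projectivization.exists_smul_eq_mk_rep F x hx
  refine Nat.card_eq_card_mul_of_fibers
    (fun x : {x : Fin 3 → F // x ≠ 0 ∧ x 0 ^ 4 + x 1 ^ 4 + x 2 ^ 4 = 0} =>
      (⟨Projectivization.mk F x.1 x.2.1, ?_⟩ : {P : Projectivization F (Fin 3 → F) //
        P.rep 0 ^ 4 + P.rep 1 ^ 4 + P.rep 2 ^ 4 = 0})) _ ?_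
  · obtain ⟨a, ha⟩ := hrep x.1 x.2.1
    rw [← ha, hsmul]
    exact x.2.2
  · rintro ⟨P, hP⟩
    have hne : ∀ a : Fˣ, a • P.rep ≠ 0 := fun a => (smul_ne_zero_iff_ne a).2 P.rep_nonzero
    have hmk : ∀ a : Fˣ, Projectivization.mk F (a • P.rep) (hne a) = P := fun a => by
      conv_rhs => rw [← P.mk_rep]
      exact (Projectivization.mk_eq_mk_iff F _ _ _ _).2 ⟨a, rfl⟩
    refine (Nat.card_congr (Equiv.ofBijective (fun a : Fˣ =>
      ⟨⟨a • P.rep, hne a, (hsmul a _).2 hP⟩, Subtype.ext (hmk a)⟩) ⟨?_, ?_⟩)).symm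
    · intro a b h
      have h' : (a : F) • P.rep = (b : F) • P.rep := congrArg (fun y => y.1.1) h
      exact Units.ext (smul_left_injective F P.rep_nonzero h')
    · rintro ⟨⟨x, hx, hx'⟩, h⟩
      obtain ⟨a, ha⟩ := hrep x hx
      refine ⟨a⁻¹, Subtype.ext (Subtype.ext ?_)⟩
      have h' : Projectivization.mk F x hx = P := congrArg Subtype.val h
      show a⁻¹ • P.rep = x
      rw [← h', ← ha, inv_smul_smul]

end Counting

/-! ### The point count as a character sum. -/

section CountSums

variable {F : Type*} [Field F] [Fintype F] [DecidableEq F] {K : Type*} [Field K]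

theorem sum_addChar_mul {θ : AddChar F K} (hθ : θ ≠ 1) (c : F) :
    ∑ y : F, θ (y * c) = if c = 0 then (Fintype.card F : K) else 0 := by
  have := AddChar.sum_mulShift c (AddChar.IsPrimitive.of_ne_one hθ)
  rw [this]
  split_ifs <;> simp

/-- Grouping of the Cox variables as `(x₁, x₂)`, `(x₃, x₄, x₅)`, `x₆`. -/
def coxEquiv (F : Type*) : (F × F) × (Fin 3 → F) × F ≃ (Fin 6 → F) where
  toFun a := ![a.1.1, a.1.2, a.2.1 0, a.2.1 1, a.2.1 2, a.2.2]
  invFun x := ((x 0, x 1), ![x 2, x 3, x 4], x 5)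
  left_inv a := by
    obtain ⟨⟨_, _⟩, z, _⟩ := a
    simp only [Matrix.cons_val, Prod.mk.injEq, true_and, and_true]
    ext i
    fin_cases i <;> rfl
  right_inv x := by
    ext i
    fin_cases i <;> rfl

theorem sum_ne_zero_eq_sub {V : Type*} [AddCommGroup V] [Fintype V] [DecidableEq V] (f : V → K) :
    ∑ v with v ≠ 0, f v = ∑ v, f v - f 0 := by
  rw [← Finset.sum_erase_eq_sub (Finset.mem_univ 0)]
  refine Finset.sum_congr ?_ fun _ _ => rfl
  ext
  simp

/-- For x₆ = 0 the second excluded locus reduces to x₃ = x₄ = x₅ = 0, and for x₆ ≠ 0 it is empty.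
The condition on (x₁, x₂) is kept when x₆ = 0 and written as a subtraction otherwise. -/
theorem sum_coxDomain (f : (Fin 6 → F) → K) :
    ∑ x : Fin 6 → F with ¬ (x 0 = 0 ∧ x 1 = 0) ∧ ¬ (x 2 = 0 ∧ x 3 = 0 ∧ x 4 = 0 ∧ x 5 = 0), f x =
      ∑ w : F × F with w ≠ (0, 0), ∑ z, f (coxEquiv F (w, z, 0))
      - ∑ w : F × F with w ≠ (0, 0), f (coxEquiv F (w, 0, 0))
      + ∑ u : Fˣ, ∑ w, ∑ z, f (coxEquiv F (w, z, u))
      - ∑ u : Fˣ, ∑ z, f (coxEquiv F ((0, 0), z, u)) := by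
  have h1 : ∑ x : Fin 6 → F with
      ¬ (x 0 = 0 ∧ x 1 = 0) ∧ ¬ (x 2 = 0 ∧ x 3 = 0 ∧ x 4 = 0 ∧ x 5 = 0), f x =
      ∑ w : F × F with w ≠ (0, 0), ∑ z : Fin 3 → F, ((if z ≠ 0 then f (coxEquiv F (w, z, 0)) else 0)
        + ∑ u : Fˣ, f (coxEquiv F (w, z, u))) := by
    rw [Finset.sum_filter, ← (coxEquiv F).sum_comp, Fintype.sum_prod_type, Finset.sum_filter]
    refine Finset.sum_congr rfl fun w _ => ?_
    by_cases h : w = (0, 0)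
    · rw [if_neg (not_not.2 h)]
      refine Finset.sum_eq_zero fun z _ => if_neg ?_
      simp [coxEquiv, h]
    · have h' : ¬ (w.1 = 0 ∧ w.2 = 0) := fun e => h (Prod.ext e.1 e.2)
      rw [if_pos h, Fintype.sum_prod_type]
      refine Finset.sum_congr rfl fun z _ => ?_
      rw [sum_eq_zero_add_sum_units]
      congr 1
      · refine if_congr ?_ rfl rfl
        simp [coxEquiv, h', funext_iff, Fin.forall_fin_succ]
      · refine Finset.sum_congr rfl fun u _ => if_pos ?_
        simp [coxEquiv, h']
  rw [h1]
  simp only [Finset.sum_add_distrib, ← Finset.sum_filter, sum_ne_zero_eq_sub,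
    Finset.sum_sub_distrib]
  have h2 : ∑ w : F × F with w ≠ (0, 0), ∑ z : Fin 3 → F, ∑ u : Fˣ, f (coxEquiv F (w, z, u)) =
      ∑ u : Fˣ, ∑ w, ∑ z, f (coxEquiv F (w, z, u)) -
        ∑ u : Fˣ, ∑ z, f (coxEquiv F ((0, 0), z, u)) := by
    have := sum_ne_zero_eq_sub (V := F × F)
      (fun w => ∑ z : Fin 3 → F, ∑ u : Fˣ, f (coxEquiv F (w, z, u)))
    refine this.trans ?_
    congr 1
    · rw [Finset.sum_congr rfl fun w _ => Finset.sum_comm, Finset.sum_comm]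
    · exact Finset.sum_comm
  rw [h2]
  ring

omit [Field F] [DecidableEq F] in
theorem sum_fin_five_eq (f : (Fin 6 → F) → K) (u : F) :
    ∑ x : Fin 5 → F, f ![x 0, x 1, x 2, x 3, x 4, u] = ∑ w, ∑ z, f (coxEquiv F (w, z, u)) := by
  simp only [Fintype.sum_fin_succ_fun, Fintype.sum_fin_zero_fun, Fintype.sum_prod_type]
  rfl

/-- The sum of `θ(y (x₃⁴ + x₄⁴ + x₅⁴))` over `y ≠ 0` and all `x₃, x₄, x₅`. -/
def quarticSum (θ : AddChar F K) : K :=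
  ∑ y : Fˣ, ∑ x : Fin 3 → F, θ (y * (x 0 ^ 4 + x 1 ^ 4 + x 2 ^ 4))

/-- The sum of `θ(y P)` over `y ≠ 0`, `x₆ ≠ 0` and all `x₁, …, x₅`. -/
def octicOpenSum (θ : AddChar F K) (φ ψ : F) : K :=
  ∑ y : Fˣ, ∑ x₆ : Fˣ, ∑ x : Fin 5 → F,
    θ (y * octicPoly φ ψ ![x 0, x 1, x 2, x 3, x 4, (x₆ : F)])

omit [Fintype F] [DecidableEq F] in
theorem octicPoly_coxEquiv_left (φ ψ : F) (z : Fin 3 → F) (u : F) :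
    octicPoly φ ψ (coxEquiv F ((0, 0), z, u)) = z 0 ^ 4 + z 1 ^ 4 + z 2 ^ 4 := by
  simp [octicPoly, coxEquiv]

omit [Fintype F] [DecidableEq F] in
theorem octicPoly_coxEquiv_right (φ ψ : F) (w : F × F) (z : Fin 3 → F) :
    octicPoly φ ψ (coxEquiv F (w, z, 0)) = z 0 ^ 4 + z 1 ^ 4 + z 2 ^ 4 := by
  simp [octicPoly, coxEquiv]

variable (F) in
theorem card_filter_ne_zero (q : ℕ) (hq : Fintype.card F = q) :
    ((Finset.univ.filter fun w : F × F => w ≠ (0, 0)).card : K) = q ^ 2 - 1 := by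
  have h := sum_ne_zero_eq_sub (K := K) (V := F × F) (fun _ => 1)
  simp only [Finset.sum_const, nsmul_eq_mul, mul_one] at h
  refine h.trans ?_
  simp [hq, pow_two]

variable {θ : AddChar F K} (hθ : θ ≠ 1) {M q : ℕ} (hM : Fintype.card Fˣ = M)
  (hq : q = M + 1)
include hM hq

theorem card_eq_of_card_units : Fintype.card F = q := by
  rw [hq, ← hM, Fintype.card_units]
  have := Fintype.card_pos (α := F)
  omega

include hθ

/-- The terms with y = 0 count the domain, (q² - 1)(q⁴ - 1). For y ≠ 0 the polynomial is x₃⁴ + x₄⁴ +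
x₅⁴ both when x₆ = 0 and when x₁ = x₂ = 0, which gives the two multiples of `quarticSum θ`. The term
-M(q² - 1) removes x₃ = x₄ = x₅ = x₆ = 0. -/
theorem mul_card_octicCoords (φ ψ : F) : (q : K) * (Nat.card (OcticCoords φ ψ) : K) =
    ((q : K) ^ 2 - 1) * (q ^ 4 - 1) - M * (q ^ 2 - 1) +
      ((q ^ 2 - 1) * quarticSum θ - M * quarticSum θ) + octicOpenSum θ φ ψ := by
  have hqF := card_eq_of_card_units hM hq
  have h1 : (q : K) * (Nat.card (OcticCoords φ ψ) : K) = ∑ y : F, ∑ x : Fin 6 → F with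
      ¬ (x 0 = 0 ∧ x 1 = 0) ∧ ¬ (x 2 = 0 ∧ x 3 = 0 ∧ x 4 = 0 ∧ x 5 = 0),
      θ (y * octicPoly φ ψ x) := by
    rw [Finset.sum_comm]
    simp only [sum_addChar_mul hθ]
    rw [← Finset.sum_filter, Finset.filter_filter, Finset.sum_const, nsmul_eq_mul, hqF, mul_comm]
    congr 2
    rw [OcticCoords, Nat.card_eq_fintype_card, Fintype.card_subtype]
    congr 1
    ext x
    simp [and_assoc]
  have hM' : (M : K) = q - 1 := by rw [hq]; push_cast; ring
  have hO : octicOpenSum θ φ ψ = ∑ y : Fˣ, ∑ u : Fˣ, ∑ w, ∑ z : Fin 3 → F,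
      θ (y * octicPoly φ ψ (coxEquiv F (w, z, u))) :=
    Finset.sum_congr rfl fun y _ => Finset.sum_congr rfl fun u _ =>
      sum_fin_five_eq (fun x => θ (y * octicPoly φ ψ x)) u
  rw [h1, sum_eq_zero_add_sum_units, sum_coxDomain, hO, quarticSum]
  simp only [sum_coxDomain, octicPoly_coxEquiv_left, octicPoly_coxEquiv_right, zero_mul,
    AddChar.map_zero_eq_one, Finset.sum_const, nsmul_eq_mul, card_filter_ne_zero F q hqF,
    Finset.card_univ, hM, Finset.sum_add_distrib, Finset.sum_sub_distrib, ← Finset.mul_sum]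
  simp [hM', hM, hqF]
  ring

end CountSums

/-! ### Elimination of x₆ and the exceptional contribution. -/

section CountFormulas

variable {F : Type*} [Field F] [Fintype F] [DecidableEq F] {K : Type*} [Field K] {M q : ℕ}

/-- Replacing y by y x₆⁴ and x₃, x₄, x₅ by their quotients by x₆ sets x₆ to 1, so all values of x₆
contribute equally. -/
theorem octicOpenSum_eq (hM : Fintype.card Fˣ = M) (θ : AddChar F K) (φ ψ : F) :
    octicOpenSum θ φ ψ = M * octicAffineSum θ φ ψ := by
  rw [octicOpenSum, Finset.sum_comm, ← hM, ← Finset.card_univ, ← nsmul_eq_mul, ← Finset.sum_const]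
  refine Finset.sum_congr rfl fun u _ => ?_
  refine Fintype.sum_equiv (Equiv.mulRight (u ^ 4)) _ _ fun y => ?_
  refine Fintype.sum_equiv (Equiv.piCongrRight fun i =>
    (Units.mulLeft ((![1, 1, u⁻¹, u⁻¹, u⁻¹] : Fin 5 → Fˣ) i) : F ≃ F)) _ _ fun x => ?_
  congr 1
  have h1 : (u : F) ^ 4 * (u : F)⁻¹ ^ 4 = 1 := by
    rw [← mul_pow, mul_inv_cancel₀ u.ne_zero, one_pow]
  have h2 : (u : F) ^ 4 * (u : F)⁻¹ ^ 3 = u := by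
    have := mul_inv_cancel₀ u.ne_zero
    linear_combination (u : F) * ((u : F) ^ 2 * (u : F)⁻¹ ^ 2 + u * (u : F)⁻¹ + 1) * this
  simp only [octicPoly, Equiv.coe_mulRight, Equiv.piCongrRight_apply, Pi.map_apply,
    Units.mulLeft_apply, Matrix.cons_val, Units.val_mul, Units.val_pow_eq_pow_val, Units.val_one,
    Units.val_inv_eq_inv_val]
  linear_combination -(y : F) * (x 2 ^ 4 + x 3 ^ 4 + x 4 ^ 4) * h1
    + (y : F) * 8 * ψ * x 0 * x 1 * x 2 * x 3 * x 4 * h2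

theorem quarticSum_eq_sum_powSum (θ : AddChar F K) :
    quarticSum θ = ∑ y : Fˣ, powSum θ 4 (y : F) ^ 3 := by
  refine Finset.sum_congr rfl fun y _ => ?_
  rw [← one_mul (powSum _ _ _ ^ 3), powSum, mul_sum_pow_three]
  simp only [Fintype.sum_fin_succ_fun, Fintype.sum_fin_zero_fun, one_mul,
    ← AddChar.map_add_eq_mul]
  simp [mul_add]

/-- Completed by its q³ terms with y = 0, the sum is q times the number of points of the affine
cone, the vertex included. -/
theorem quarticSum_eq {θ : AddChar F K} (hθ : θ ≠ 1) (hM : Fintype.card Fˣ = M) (hq : q = M + 1) :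
    quarticSum θ = q * (1 + quarticCount F * M) - q ^ 3 := by
  have hqF := card_eq_of_card_units hM hq
  have h1 : ∑ x : Fin 3 → F, ∑ y : F, θ (y * (x 0 ^ 4 + x 1 ^ 4 + x 2 ^ 4)) =
      q * (1 + quarticCount F * M) := by
    simp only [sum_addChar_mul hθ]
    rw [← Finset.sum_filter, Finset.sum_const, nsmul_eq_mul, hqF, mul_comm]
    congr 1
    have h := card_quartic_cone (F := F)
    rw [Nat.card_eq_fintype_card, Nat.card_eq_fintype_card, Fintype.card_subtype, hM] at h
    rw [← Nat.cast_mul, ← h, ← Nat.cast_one, ← Nat.cast_add]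
    congr 1
    rw [← Finset.filter_filter, ← Finset.card_singleton (0 : Fin 3 → F), ← Finset.card_union_of_disjoint]
    · congr 1
      ext x
      by_cases hx : x = 0 <;> simp [hx]
    · simp
  rw [Finset.sum_comm, sum_eq_zero_add_sum_units] at h1
  rw [← h1, quarticSum]
  simp [hqF]

/-- The terms without character values add up to (q² - 1)(q⁴ - q). Divided by q(q - 1)² this is (q +
1)(q² + q + 1), the polynomial part of the count. -/
theorem octicCount_eq [CharZero K] {θ : AddChar F K} (hθ : θ ≠ 1) (hM : Fintype.card Fˣ = M)
    (hM0 : M ≠ 0) (hq : q = M + 1) (φ ψ : F) : (octicCount φ ψ : K) = 1 + 2 * q + 2 * q ^ 2 + q ^ 3 +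
      1 / ((q : K) * (q - 1) ^ 2) * ((q ^ 2 - 1) * quarticSum θ - M * quarticSum θ) +
      1 / ((q : K) * (q - 1) ^ 2) * octicOpenSum θ φ ψ := by
  have h := mul_card_octicCoords hθ hM hq φ ψ
  rw [card_octicCoords, Nat.card_eq_fintype_card, hM] at h
  have hM0' : (M : K) ≠ 0 := by exact_mod_cast hM0
  have hq0 : (q : K) ≠ 0 := by rw [hq]; exact_mod_cast M.succ_ne_zero
  have hq1 : (q : K) = M + 1 := by rw [hq]; push_cast; rfl
  have hq2 : (q : K) - 1 = M := by rw [hq]; push_cast; ring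
  rw [hq2]
  field_simp
  push_cast at h
  rw [hq1] at h ⊢
  linear_combination h

section Exceptional

variable [CharZero K] [NeZero M] {θ : AddChar F K} (hθ : θ ≠ 1) (hM : Fintype.card Fˣ = M)
  {τ : F →*₀ K} (hτ : Function.Injective τ)
include hθ hM hτ

theorem powSum_four_eq (y : Fˣ) : powSum θ 4 (y : F) = ∑ v ∈ Finset.range 4,
    divValue 4 (fun n : ZMod M =>
      (if n = 0 then 0 else gaussZ θ τ (-n)) * torusChar τ n y) (v * M) := by
  rw [powSum_eq hM hθ hτ (by norm_num)]
  have h := sum_ite_mul_eq (M := M) 4 (by norm_num) 0 (fun n : ZMod M =>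
      (if n = 0 then 0 else gaussZ θ τ (-n)) * torusChar τ n y)
  simpa using h

/-- With χ of order 4, the one-variable sum is g₁χ + g₂χ² + g₃χ³. Summing its cube over y keeps only
χ⁴ and χ⁸, with coefficients 3g₁²g₂ and 3g₂g₃². -/
theorem quarticSum_eq_of_four {l : ℤ} (hl : (M : ℤ) = 4 * l) : quarticSum θ = M *
    (3 * (gaussZ θ τ ((-(2 * l) : ℤ) : ZMod M) * gaussZ θ τ ((-l : ℤ) : ZMod M) *
        gaussZ θ τ ((-l : ℤ) : ZMod M)) +
      3 * (gaussZ θ τ ((-(3 * l) : ℤ) : ZMod M) * gaussZ θ τ ((-(3 * l) : ℤ) : ZMod M) *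
        gaussZ θ τ ((-(2 * l) : ℤ) : ZMod M))) := by
  have hz : ∀ k : ℤ, ((k * l : ℤ) : ZMod M) = 0 ↔ 4 ∣ k := fun k => ZMod.eq_zero_iff_dvd hl rfl
  have hs : ∀ k : ℤ, ∑ y : Fˣ, torusChar τ ((k * l : ℤ) : ZMod M) y = if 4 ∣ k then (M : K) else 0 :=
    fun k => by rw [sum_units_torusChar hM hτ]; exact if_congr (hz k) rfl rfl
  have hpow : ∀ (y : Fˣ) (k : ℕ), torusChar τ ((k * l : ℤ) : ZMod M) y =
      torusChar τ ((l : ℤ) : ZMod M) y ^ k := fun y k => by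
    rw [torusChar_intCast hM, torusChar_intCast hM, mul_comm, zpow_mul, zpow_natCast]
  set g₁ := gaussZ θ τ ((-l : ℤ) : ZMod M)
  set g₂ := gaussZ θ τ ((-(2 * l) : ℤ) : ZMod M)
  set g₃ := gaussZ θ τ ((-(3 * l) : ℤ) : ZMod M)
  have hp : ∀ y : Fˣ, powSum θ 4 (y : F) = g₁ * torusChar τ ((l : ℤ) : ZMod M) y +
      g₂ * torusChar τ ((l : ℤ) : ZMod M) y ^ 2 + g₃ * torusChar τ ((l : ℤ) : ZMod M) y ^ 3 := by
    intro y
    have hd : ∀ v : ℕ, divValue 4 (fun n : ZMod M =>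
        (if n = 0 then 0 else gaussZ θ τ (-n)) * torusChar τ n y) (v * M) =
        (if (4 : ℤ) ∣ v then 0 else gaussZ θ τ ((-(v * l) : ℤ) : ZMod M)) *
          torusChar τ ((l : ℤ) : ZMod M) y ^ v := fun v => by
      rw [divValue_mul (y := v * l) (by norm_num) _ (by rw [hl]; ring), hpow]
      congr 1
      rw [Int.cast_neg]
      exact if_congr (hz v) rfl rfl
    rw [powSum_four_eq hθ hM hτ]
    simp only [hd, Finset.sum_range_succ, Finset.sum_range_zero]
    norm_num [g₁, g₂, g₃]
  have hc : ∀ y : Fˣ, powSum θ 4 (y : F) ^ 3 =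
      g₁ ^ 3 * torusChar τ ((3 * l : ℤ) : ZMod M) y
      + 3 * g₁ ^ 2 * g₂ * torusChar τ ((4 * l : ℤ) : ZMod M) y
      + (3 * g₁ ^ 2 * g₃ + 3 * g₁ * g₂ ^ 2) * torusChar τ ((5 * l : ℤ) : ZMod M) y
      + (6 * g₁ * g₂ * g₃ + g₂ ^ 3) * torusChar τ ((6 * l : ℤ) : ZMod M) y
      + (3 * g₁ * g₃ ^ 2 + 3 * g₂ ^ 2 * g₃) * torusChar τ ((7 * l : ℤ) : ZMod M) y
      + 3 * g₂ * g₃ ^ 2 * torusChar τ ((8 * l : ℤ) : ZMod M) y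
      + g₃ ^ 3 * torusChar τ ((9 * l : ℤ) : ZMod M) y := by
    intro y
    have h3 := hpow y 3
    have h4 := hpow y 4
    have h5 := hpow y 5
    have h6 := hpow y 6
    have h7 := hpow y 7
    have h8 := hpow y 8
    have h9 := hpow y 9
    push_cast at h3 h4 h5 h6 h7 h8 h9
    push_cast
    rw [hp, h3, h4, h5, h6, h7, h8, h9]
    ring
  rw [quarticSum_eq_sum_powSum]
  simp only [hc, Finset.sum_add_distrib, ← Finset.mul_sum, hs]
  norm_num
  ring

/-- Only the quadratic character survives in the one-variable sum, and its cube is nontrivial, so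
the sum over y vanishes. -/
theorem quarticSum_eq_of_two {m : ℤ} (hm : (M : ℤ) = 2 * m) (hm2 : m % 2 = 1) :
    quarticSum θ = 0 := by
  have hp : ∀ y : Fˣ, powSum θ 4 (y : F) =
      (if ((m : ℤ) : ZMod M) = 0 then 0 else gaussZ θ τ (-((m : ℤ) : ZMod M))) *
        torusChar τ ((m : ℤ) : ZMod M) y := by
    intro y
    rw [powSum_four_eq hθ hM hτ]
    simp only [Finset.sum_range_succ, Finset.sum_range_zero]
    rw [divValue_mul (y := 0) (by norm_num) _ (by simp),
      divValue_of_not_dvd _ (by rw [hm]; push_cast; omega),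
      divValue_mul (y := m) (by norm_num) _ (by rw [hm]; push_cast; ring),
      divValue_of_not_dvd _ (by rw [hm]; push_cast; omega)]
    simp
  have h3 : ∀ y : Fˣ, torusChar τ ((m : ℤ) : ZMod M) y ^ 3 =
      torusChar τ ((3 * m : ℤ) : ZMod M) y := fun y => by
    rw [torusChar_intCast hM, torusChar_intCast hM, mul_comm, zpow_mul]
    norm_cast
  rw [quarticSum_eq_sum_powSum]
  simp only [hp, mul_pow, h3, ← Finset.mul_sum]
  have h0 : ¬ ((3 * m : ℤ) : ZMod M) = 0 := by
    rw [ZMod.eq_zero_iff_dvd hm rfl]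
    norm_num
  rw [sum_units_torusChar hM hτ, if_neg h0, mul_zero]

end Exceptional

end CountFormulas

/-! ### The main theorem. -/

theorem mainTheorem3 (p : ℕ) [Fact p.Prime] (hp : p ≠ 2) (s : ℕ)
    {F : Type*} [Field F] [Fintype F] [DecidableEq F] (q : ℕ) (hq : q = p ^ s)
    (hF : Fintype.card F = q) (π : ℂ_[p]) (hπ : π ^ (p - 1) = -(p : ℂ_[p]))
    (ι : WittVector p F →+* 𝓞_ℂ_[p]) (φ ψ : F) :
    let G : ℤ → ℂ_[p] := dworkGauss s π ι
    let T : F → ℂ_[p] := teichChar ι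
    let Nexc : ℂ_[p] := octicExc s π ι
    let Nmon : ℂ_[p] := octicMon s π ι φ ψ
    let v := octicMonomial
    let lam := octicWeight
    let v' := octicMonomialFour
    let lam' := octicWeightFour
    -- the number of points
    ((octicCount φ ψ : ℂ_[p]) = 1 + 2 * q + 2 * q ^ 2 + q ^ 3 + Nexc + Nmon) ∧
    -- the exceptional contribution
    (Nexc = q * ((quarticCount F : ℂ_[p]) - (q + 1))) ∧
    (∀ l : ℤ, (q : ℤ) - 1 = 4 * l →
      Nexc = 3 * (G (-(2 * l)) * G (-l) * G (-l)) + 3 * (G (-(3 * l)) * G (-(3 * l)) * G (-(2 * l)))) ∧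
    (¬ (4 : ℤ) ∣ (q : ℤ) - 1 → Nexc = 0) ∧
    -- the case `φ = ψ = 0`
    (φ = 0 → ψ = 0 →
      (∀ k : ℤ, (q : ℤ) - 1 = 8 * k →
        Nmon = 1 / (q : ℂ_[p]) * ∑ b ∈ Finset.range 2, ∑ a ∈ Finset.range 4,
          ∑ j with (∀ i, ¬ 8 ∣ (v j).1 i + a + 4 * b) ∧ (∀ i, ¬ 4 ∣ (v j).2 i + a),
            (lam j : ℂ_[p]) * (∏ i, G (-(((v j).1 i + a + 4 * b) * k))) *
              ∏ i, G (-(2 * ((v j).2 i + a) * k))) ∧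
      (∀ l : ℤ, (q : ℤ) - 1 = 4 * l → ¬ (8 : ℤ) ∣ (q : ℤ) - 1 →
        Nmon = 1 / (q : ℂ_[p]) * ∑ a ∈ Finset.range 4,
          ∑ j with (∀ i, ¬ 8 ∣ (v j).1 i + 2 * a) ∧ (∀ i, ¬ 4 ∣ (v j).2 i + 2 * a),
            (lam j : ℂ_[p]) * (∏ i, G (-(((v j).1 i + 2 * a) / 2 * l))) *
              ∏ i, G (-(((v j).2 i + 2 * a) * l))) ∧
      (∀ m : ℤ, (q : ℤ) - 1 = 2 * m → ¬ (4 : ℤ) ∣ (q : ℤ) - 1 →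
        Nmon = 1 / (q : ℂ_[p]) * ∑ b ∈ Finset.range 2,
          ∑ j with (∀ i, ¬ 8 ∣ (v' j).1 i + 4 * b) ∧ (∀ i, ¬ 4 ∣ (v' j).2 i),
            (lam' j : ℂ_[p]) * (∏ i, G (-(((v' j).1 i + 4 * b) / 4 * m))) *
              ∏ i, G (-((v' j).2 i / 2 * m)))) ∧
    -- the case `φ = 0`, `ψ ≠ 0`
    (φ = 0 → ψ ≠ 0 →
      (∀ k : ℤ, (q : ℤ) - 1 = 8 * k →
        Nmon = 1 / ((q : ℂ_[p]) * (q - 1)) * ∑ w ∈ Finset.range (q - 1), ∑ j,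
            (lam j : ℂ_[p]) * (∏ i, G (-((v j).1 i * k + w))) *
              (∏ i, G (-(2 * (v j).2 i * k + 2 * w))) * G (8 * w) * T (1 / (8 * ψ) ^ 8) ^ w
          - 1 / (q : ℂ_[p]) * ∑ b ∈ Finset.range 2, ∑ a ∈ Finset.range 4,
            ∑ j with (∃ i, 8 ∣ (v j).1 i + a + 4 * b) ∨ (∃ i, 4 ∣ (v j).2 i + a),
              (lam j : ℂ_[p]) * (∏ i, G (-(((v j).1 i + a + 4 * b) * k))) *
                ∏ i, G (-(2 * ((v j).2 i + a) * k))) ∧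
      (∀ l : ℤ, (q : ℤ) - 1 = 4 * l → ¬ (8 : ℤ) ∣ (q : ℤ) - 1 →
        Nmon = 1 / ((q : ℂ_[p]) * (q - 1)) * ∑ w ∈ Finset.range (q - 1), ∑ j,
            (lam j : ℂ_[p]) * (∏ i, G (-((v j).1 i / 2 * l + w))) *
              (∏ i, G (-((v j).2 i * l + 2 * w))) * G (8 * w) * T (1 / (8 * ψ) ^ 8) ^ w
          - 1 / (q : ℂ_[p]) * ∑ a ∈ Finset.range 4,
            ∑ j with (∃ i, 8 ∣ (v j).1 i + 2 * a) ∨ (∃ i, 4 ∣ (v j).2 i + 2 * a),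
              (lam j : ℂ_[p]) * (∏ i, G (-(((v j).1 i + 2 * a) / 2 * l))) *
                ∏ i, G (-(((v j).2 i + 2 * a) * l))) ∧
      (∀ m : ℤ, (q : ℤ) - 1 = 2 * m → ¬ (4 : ℤ) ∣ (q : ℤ) - 1 →
        Nmon = 1 / ((q : ℂ_[p]) * (q - 1)) * ∑ w ∈ Finset.range (q - 1), ∑ j,
            (lam' j : ℂ_[p]) * (∏ i, G (-((v' j).1 i / 4 * m + w))) *
              (∏ i, G (-((v' j).2 i / 2 * m + 2 * w))) * G (8 * w) * T (1 / (8 * ψ) ^ 8) ^ w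
          - 1 / (q : ℂ_[p]) * ∑ b ∈ Finset.range 2,
            ∑ j with (∃ i, 8 ∣ (v' j).1 i + 4 * b) ∨ (∃ i, 4 ∣ (v' j).2 i),
              (lam' j : ℂ_[p]) * (∏ i, G (-(((v' j).1 i + 4 * b) / 4 * m))) *
                ∏ i, G (-((v' j).2 i / 2 * m)))) ∧
    -- the case `ψ = 0`, `φ ≠ 0`
    (φ ≠ 0 → ψ = 0 →
      (∀ k : ℤ, (q : ℤ) - 1 = 8 * k →
        Nmon = 1 / ((q : ℂ_[p]) * (q - 1)) * ∑ u ∈ Finset.range (q - 1), ∑ a ∈ Finset.range 4,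
            ∑ j with (∀ i, ¬ 4 ∣ (v j).2 i + a),
              (lam j : ℂ_[p]) * (∏ i, G (-(((v j).1 i + a) * k + u))) *
                (∏ i, G (-(2 * ((v j).2 i + a) * k))) * G (2 * u) * T (1 / (2 * φ) ^ 2) ^ u
          - 1 / (q : ℂ_[p]) * ∑ b ∈ Finset.range 2, ∑ a ∈ Finset.range 4,
            ∑ j with (∃ i, 8 ∣ (v j).1 i + a + 4 * b) ∧ (∀ i, ¬ 4 ∣ (v j).2 i + a),
              (lam j : ℂ_[p]) * (∏ i, G (-(((v j).1 i + a + 4 * b) * k))) *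
                ∏ i, G (-(2 * ((v j).2 i + a) * k))) ∧
      (∀ l : ℤ, (q : ℤ) - 1 = 4 * l → ¬ (8 : ℤ) ∣ (q : ℤ) - 1 →
        Nmon = 1 / ((q : ℂ_[p]) * (q - 1)) * ∑ u ∈ Finset.range (q - 1), ∑ a ∈ Finset.range 2,
            ∑ j with (∀ i, ¬ 4 ∣ (v j).2 i + 2 * a),
              (lam j : ℂ_[p]) * (∏ i, G (-(((v j).1 i + 2 * a) / 2 * l + u))) *
                (∏ i, G (-(((v j).2 i + 2 * a) * l))) * G (2 * u) * T (1 / (2 * φ) ^ 2) ^ u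
          + 1 / ((q : ℂ_[p]) * (q - 1)) * ∑ u ∈ Finset.range (q - 1), ∑ a ∈ Finset.range 2,
            ∑ j with (∀ i, ¬ 4 ∣ (v j).2 i + 2 * a + 1),
              (lam j : ℂ_[p]) * (∏ i, G (-((((v j).1 i + 2 * a + 1) * l + 1) / 2 + u))) *
                (∏ i, G (-(((v j).2 i + 2 * a + 1) * l))) * G (2 * u + 1) *
                T (1 / (2 * φ) ^ 2) ^ u * (T (-2 * φ))⁻¹
          - 1 / (q : ℂ_[p]) * ∑ b ∈ Finset.range 2, ∑ a ∈ Finset.range 2,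
            ∑ j with (∃ i, 8 ∣ (v j).1 i + 2 * a + 4 * b) ∧ (∀ i, ¬ 4 ∣ (v j).2 i + 2 * a),
              (lam j : ℂ_[p]) * (∏ i, G (-(((v j).1 i + 2 * a + 4 * b) / 2 * l))) *
                ∏ i, G (-(((v j).2 i + 2 * a) * l))) ∧
      (∀ m : ℤ, (q : ℤ) - 1 = 2 * m → ¬ (4 : ℤ) ∣ (q : ℤ) - 1 →
        Nmon = 1 / ((q : ℂ_[p]) * (q - 1)) * ∑ u ∈ Finset.range (q - 1),
            ∑ j with (∀ i, ¬ 4 ∣ (v' j).2 i),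
              (lam' j : ℂ_[p]) * (∏ i, G (-((v' j).1 i / 4 * m + u))) *
                (∏ i, G (-((v' j).2 i / 2 * m))) * G (2 * u) * T (1 / (2 * φ) ^ 2) ^ u
          + 1 / ((q : ℂ_[p]) * (q - 1)) * ∑ u ∈ Finset.range (q - 1),
            ∑ j with (∀ i, ¬ 4 ∣ (v' j).2 i + 2),
              (lam' j : ℂ_[p]) * (∏ i, G (-((((v' j).1 i + 2) * m + 2) / 4 + u))) *
                (∏ i, G (-(((v' j).2 i + 2) / 2 * m))) * G (2 * u + 1) *
                T (1 / (2 * φ) ^ 2) ^ u * (T (-2 * φ))⁻¹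
          - 1 / (q : ℂ_[p]) * ∑ b ∈ Finset.range 2,
            ∑ j with (∃ i, 8 ∣ (v' j).1 i + 4 * b) ∧ (∀ i, ¬ 4 ∣ (v' j).2 i),
              (lam' j : ℂ_[p]) * (∏ i, G (-(((v' j).1 i + 4 * b) / 4 * m))) *
                ∏ i, G (-((v' j).2 i / 2 * m)))) ∧
    -- the case `φ ψ ≠ 0`
    (φ ≠ 0 → ψ ≠ 0 →
      (∀ k : ℤ, (q : ℤ) - 1 = 8 * k →
        Nmon = 1 / ((q : ℂ_[p]) * (q - 1) ^ 2) * ∑ t ∈ Finset.range (q - 1),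
            ∑ u ∈ Finset.Icc ((t + 1) / 2) ((2 * q - 3 + t) / 2), ∑ j,
              (lam j : ℂ_[p]) * (∏ i, G (-((v j).1 i * k + u))) *
                (∏ i, G (-(2 * (v j).2 i * k + t))) * G (2 * u - t) * G (4 * t) *
                T (1 / (2 * φ) ^ 2) ^ u * T (-2 * φ / (8 * ψ) ^ 4) ^ t
          - 1 / ((q : ℂ_[p]) * (q - 1)) * ∑ u ∈ Finset.range (q - 1), ∑ a ∈ Finset.range 4,
            ∑ j with (∃ i, 4 ∣ (v j).2 i + a),
              (lam j : ℂ_[p]) * (∏ i, G (-(((v j).1 i + a) * k + u))) *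
                (∏ i, G (-(2 * ((v j).2 i + a) * k))) * G (2 * u) * T (1 / (2 * φ) ^ 2) ^ u
          - 1 / (q : ℂ_[p]) * ∑ b ∈ Finset.range 2, ∑ a ∈ Finset.range 4,
            ∑ j with (∃ i, 8 ∣ (v j).1 i + a + 4 * b) ∧ (∀ i, ¬ 4 ∣ (v j).2 i + a),
              (lam j : ℂ_[p]) * (∏ i, G (-(((v j).1 i + a + 4 * b) * k))) *
                ∏ i, G (-(2 * ((v j).2 i + a) * k))) ∧
      (∀ l : ℤ, (q : ℤ) - 1 = 4 * l → ¬ (8 : ℤ) ∣ (q : ℤ) - 1 →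
        Nmon = 1 / ((q : ℂ_[p]) * (q - 1) ^ 2) * ∑ t ∈ Finset.range (q - 1),
            ∑ u ∈ Finset.Icc ((t + 1) / 2) ((2 * q - 3 + t) / 2), ∑ j,
              (lam j : ℂ_[p]) * (∏ i, G (-((v j).1 i / 2 * l + u))) *
                (∏ i, G (-((v j).2 i * l + t))) * G (2 * u - t) * G (4 * t) *
                T (1 / (2 * φ) ^ 2) ^ u * T (-2 * φ / (8 * ψ) ^ 4) ^ t
          - 1 / ((q : ℂ_[p]) * (q - 1)) * ∑ u ∈ Finset.range (q - 1), ∑ a ∈ Finset.range 2,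
            ∑ j with (∃ i, 4 ∣ (v j).2 i + 2 * a),
              (lam j : ℂ_[p]) * (∏ i, G (-(((v j).1 i + 2 * a) / 2 * l + u))) *
                (∏ i, G (-(((v j).2 i + 2 * a) * l))) * G (2 * u) * T (1 / (2 * φ) ^ 2) ^ u
          - 1 / ((q : ℂ_[p]) * (q - 1)) * ∑ u ∈ Finset.range (q - 1), ∑ a ∈ Finset.range 2,
            ∑ j with (∃ i, 4 ∣ (v j).2 i + 2 * a + 1),
              (lam j : ℂ_[p]) * (∏ i, G (-((((v j).1 i + 2 * a + 1) * l + 1) / 2 + u))) *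
                (∏ i, G (-(((v j).2 i + 2 * a + 1) * l))) * G (2 * u + 1) *
                T (1 / (2 * φ) ^ 2) ^ u * (T (-2 * φ))⁻¹
          - 1 / (q : ℂ_[p]) * ∑ b ∈ Finset.range 2, ∑ a ∈ Finset.range 2,
            ∑ j with (∃ i, 8 ∣ (v j).1 i + 2 * a + 4 * b) ∧ (∀ i, ¬ 4 ∣ (v j).2 i + 2 * a),
              (lam j : ℂ_[p]) * (∏ i, G (-(((v j).1 i + 2 * a + 4 * b) / 2 * l))) *
                ∏ i, G (-(((v j).2 i + 2 * a) * l))) ∧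
      (∀ m : ℤ, (q : ℤ) - 1 = 2 * m → ¬ (4 : ℤ) ∣ (q : ℤ) - 1 →
        Nmon = 1 / ((q : ℂ_[p]) * (q - 1) ^ 2) * ∑ t ∈ Finset.range (q - 1),
            ∑ u ∈ Finset.Icc ((t + 1) / 2) ((2 * q - 3 + t) / 2), ∑ j,
              (lam' j : ℂ_[p]) * (∏ i, G (-((v' j).1 i / 4 * m + u))) *
                (∏ i, G (-((v' j).2 i / 2 * m + t))) * G (2 * u - t) * G (4 * t) *
                T (1 / (2 * φ) ^ 2) ^ u * T (-2 * φ / (8 * ψ) ^ 4) ^ t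
          - 1 / ((q : ℂ_[p]) * (q - 1)) * ∑ u ∈ Finset.range (q - 1),
            ∑ j with (∃ i, 4 ∣ (v' j).2 i),
              (lam' j : ℂ_[p]) * (∏ i, G (-((v' j).1 i / 4 * m + u))) *
                (∏ i, G (-((v' j).2 i / 2 * m))) * G (2 * u) * T (1 / (2 * φ) ^ 2) ^ u
          - 1 / ((q : ℂ_[p]) * (q - 1)) * ∑ u ∈ Finset.range (q - 1),
            ∑ j with (∃ i, 4 ∣ (v' j).2 i + 2),
              (lam' j : ℂ_[p]) * (∏ i, G (-((((v' j).1 i + 2) * m + 2) / 4 + u))) *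
                (∏ i, G (-(((v' j).2 i + 2) / 2 * m))) * G (2 * u + 1) *
                T (1 / (2 * φ) ^ 2) ^ u * (T (-2 * φ))⁻¹
          - 1 / (q : ℂ_[p]) * ∑ b ∈ Finset.range 2,
            ∑ j with (∃ i, 8 ∣ (v' j).1 i + 4 * b) ∧ (∀ i, ¬ 4 ∣ (v' j).2 i),
              (lam' j : ℂ_[p]) * (∏ i, G (-(((v' j).1 i + 4 * b) / 4 * m))) *
                ∏ i, G (-((v' j).2 i / 2 * m)))) := by
  intro G T Nexc Nmon v lam v' lam'
  have hF' : Fintype.card F = p ^ s := hF.trans hq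
  have hchar : CharP F p := charP_of_card_eq_prime_pow hF'
  obtain ⟨M, hM⟩ : ∃ M, Fintype.card Fˣ = M := ⟨_, rfl⟩
  have hqM : q = M + 1 := by
    have := Fintype.card_pos (α := F)
    rw [Fintype.card_units] at hM
    omega
  have hM0 : M ≠ 0 := by
    rw [← hM]
    exact Fintype.card_ne_zero
  have : NeZero M := ⟨hM0⟩
  have hq0 : (q : ℂ_[p]) ≠ 0 := by rw [hqM]; exact_mod_cast M.succ_ne_zero
  have hM0' : (M : ℂ_[p]) ≠ 0 := by exact_mod_cast hM0
  have hq1 : (q : ℂ_[p]) = M + 1 := by rw [hqM]; push_cast; rfl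
  have hq2 : (q : ℂ_[p]) - 1 = M := by rw [hq1]; ring
  have hodd : q % 2 = 1 := by
    rw [hq]
    exact Nat.odd_iff.1 (((Fact.out : p.Prime).odd_of_ne_two hp).pow)
  have h2 : (2 : F) ≠ 0 := by
    intro h
    have : (p : ℕ) ∣ 2 := (CharP.cast_eq_zero_iff F p 2).1 (by exact_mod_cast h)
    exact hp ((Nat.prime_dvd_prime_iff_eq Fact.out Nat.prime_two).1 this)
  set θ : AddChar F ℂ_[p] := dworkAddChar ι hp hF' hπ
  have hθ : θ ≠ 1 := dworkAddChar_ne_one ι hp hF' hπ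
  have hτ : Function.Injective (teichHom ι : F →*₀ ℂ_[p]) := teichHom_injective ι
  have hG : ∀ n : ℤ, G n = gaussZ θ (teichHom ι) (n : ZMod M) := fun n =>
    (gaussZ_intCast hM θ (teichHom ι) n).symm
  have hmon : ∀ φ ψ : F, octicMon s π ι φ ψ =
      1 / ((q : ℂ_[p]) * (q - 1) ^ 2) * octicOpenSum θ φ ψ := fun φ ψ => by
    rw [← hF]
    rfl
  have hN : ∀ φ ψ : F, q * M * octicMon s π ι φ ψ = octicAffineSum θ φ ψ := fun φ ψ => by
    rw [hmon, octicOpenSum_eq hM, hq2]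
    field_simp
  have hexc : Nexc = 1 / ((q : ℂ_[p]) * (q - 1) ^ 2) *
      ((q ^ 2 - 1) * quarticSum θ - M * quarticSum θ) := by
    have h1 : Nexc = 1 / ((q : ℂ_[p]) * (q - 1) ^ 2) *
        (∑ y : Fˣ, ∑ w : F × F with w ≠ (0, 0), ∑ x : Fin 3 → F,
          θ (y * (x 0 ^ 4 + x 1 ^ 4 + x 2 ^ 4)) - ∑ y : Fˣ, ∑ _x₆ : Fˣ, ∑ x : Fin 3 → F,
          θ (y * (x 0 ^ 4 + x 1 ^ 4 + x 2 ^ 4))) := by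
      rw [← hF]
      rfl
    rw [h1, quarticSum]
    simp only [Finset.sum_const, nsmul_eq_mul, card_filter_ne_zero F q hF, Finset.card_univ, hM,
      ← Finset.mul_sum]
  -- The multiplicity is (q² - 1) - (q - 1) = q(q - 1), which cancels all but one factor q - 1 of
  -- the denominator.
  have hexc' : Nexc = quarticSum θ / M := by
    rw [hexc, hq2, hq1]
    field_simp
    ring
  have h8 : ∀ x : F, x ≠ 0 → -(2 * x) ≠ 0 := fun x hx => neg_ne_zero.2 (mul_ne_zero h2 hx)
  have h8' : ∀ x : F, x ≠ 0 → -(8 * x) ≠ 0 := fun x hx => neg_ne_zero.2 (mul_ne_zero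
    (by rw [show (8 : F) = 2 ^ 3 by norm_num]; exact pow_ne_zero 3 h2) hx)
  refine ⟨?_, ?_, ?_, ?_, ?_, ?_, ?_, ?_⟩
  · rw [hexc, show Nmon = _ from hmon φ ψ]
    exact octicCount_eq hθ hM hM0 hqM φ ψ
  · rw [hexc', quarticSum_eq hθ hM hqM, hq1]
    field_simp
    ring
  · intro l hl
    rw [hexc', quarticSum_eq_of_four hθ hM hτ (l := l) (by omega), mul_div_cancel_left₀ _ hM0']
    simp only [hG]
  · intro h4
    obtain ⟨m, hm⟩ : ∃ m : ℤ, (M : ℤ) = 2 * m := ⟨M / 2, by omega⟩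
    rw [hexc', quarticSum_eq_of_two hθ hM hτ hm (by omega), zero_div]
  · intro hφ hψ
    have h := hN φ ψ
    rw [hφ, hψ] at h
    subst hφ hψ
    exact ⟨fun k hk => eq_of_affineSum_zero_zero_of_eight hM hθ hτ hqM hG h hk,
      fun l hl hl8 => eq_of_affineSum_zero_zero_of_four hM hθ hτ hqM hG h hl hl8,
      fun m hm hm4 => eq_of_affineSum_zero_zero_of_two hM hθ hτ hqM hG h hm hm4⟩
  · intro hφ hψ
    subst hφ
    have h := hN 0 ψ
    exact ⟨fun k hk => eq_of_affineSum_zero_left_of_eight hM hθ hτ hqM hG (h8' ψ hψ) h hk,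
      fun l hl hl8 => eq_of_affineSum_zero_left_of_four hM hθ hτ hqM hG (h8' ψ hψ) h hl hl8,
      fun m hm hm4 => eq_of_affineSum_zero_left_of_two hM hθ hτ hqM hG (h8' ψ hψ) h hm hm4⟩
  · intro hφ hψ
    subst hψ
    have h := hN φ 0
    exact ⟨fun k hk => eq_of_affineSum_zero_right_of_eight hM hθ hτ hqM hG (h8 φ hφ) h hk,
      fun l hl hl8 => eq_of_affineSum_zero_right_of_four hM hθ hτ hqM hG (h8 φ hφ) h hl hl8,
      fun m hm hm4 => eq_of_affineSum_zero_right_of_two hM hθ hτ hqM hG (h8 φ hφ) h hm hm4⟩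
  · intro hφ hψ
    have h := hN φ ψ
    exact ⟨fun k hk =>
        eq_of_affineSum_ne_zero_of_eight hM hθ hτ hqM hG (h8 φ hφ) (h8' ψ hψ) h hk,
      fun l hl hl8 =>
        eq_of_affineSum_ne_zero_of_four hM hθ hτ hqM hG (h8 φ hφ) (h8' ψ hψ) h hl hl8,
      fun m hm hm4 =>
        eq_of_affineSum_ne_zero_of_two hM hθ hτ hqM hG (h8 φ hφ) (h8' ψ hψ) h hm hm4⟩
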